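/- Let $\mathbb T=\mathbb R/2\pi\mathbb Z$, $\widehat f(k)=\frac1{2\pi}\int_0^{2\pi}f(x)e^{-ikx}\,dx$, $\langle k\rangle=(1+k^2)^{1/2}$ and $\|f\|_{H^r}^2=\sum_{k\in\mathbb Z}\langle k\rangle^{2r}|\widehat f(k)|^2$. Let $(-\Delta)^\alpha$ and $e^{it(-\Delta)^\alpha}$ be the Fourier multipliers with symbols $|k|^{2\alpha}$ and $e^{it|k|^{2\alpha}}$. Fix $\frac12<\alpha\le1$, $s>\frac12$ and $a\le 2\alpha-1$. For a sign $\sigma\in\{1,-1\}$ and $u_0\in H^s(\mathbb T)$ let $u\in C^0_t(I;H^s(\mathbb T))$ be the solution of $$iu_t+(-\Delta)^\alpha u=\sigma|u|^2u,\qquad u(0)=u_0,$$ on its maximal (open) interval of existence $I\ni0$, and put $P=\frac1\pi\int_0^{2\pi}|u_0(x)|^2\,dx$. (i) The function $t\mapsto u(t)-e^{it(-\Delta)^\alpha-i\sigma Pt}u_0$ belongs to $C^0_t(I;H^{s+a}(\mathbb T))$. For every $\varepsilon>0$ with $\frac12+\varepsilon\le s$ there is a constant $C>0$, depending only on $\alpha,s,a,\varepsilon$,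 such that, for all $\sigma$, all $u_0\in H^s(\mathbb T)$ and all $t\in I$, $$\begin{aligned}\big\|u(t)-e^{it(-\Delta)^\alpha-i\sigma Pt}u_0\big\|_{H^{s+a}}\le C\Big(&\|u_0\|_{H^s}\big(1+\|u_0\|_{H^{\frac12+\varepsilon}}^2\big)+\|u(t)\|_{H^s}\|u(t)\|_{H^{\frac12+\varepsilon}}^2\\&+\Big|\int_0^t\|u(t')\|_{H^s}\big(\|u(t')\|_{H^{\frac12+\varepsilon}}^2+\|u(t')\|_{H^{\frac12+\varepsilon}}^4\big)\,dt'\Big|\Big).\end{aligned}$$ (ii) If moreover $s\ge\alpha$, then $I=\mathbb R$, and for every $M$ there is a constant $C>0$, depending only on $\alpha,s,a,M$, such that, for all $\sigma$, all $u_0\in H^s(\mathbb T)$ with $\|u_0\|_{H^\alpha}\le M$ and all $t\in\mathbb R$, $$\big\|u(t)-e^{it(-\Delta)^\alpha-i\sigma Pt}u_0\big\|_{H^{s+a}}\le C\Big(\|u_0\|_{H^s}+\|u(t)\|_{H^s}+\Big|\int_0^t\|u(t')\|_{H^s}\,dt'\Big|\Big).$$ -/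

import Mathlib

noncomputable section

open MeasureTheory AddCircle Filter Topology

namespace FNLS

instance instFactTwoPiPos : Fact (0 < 2 * Real.pi) := ⟨Real.two_pi_pos⟩

/-- The torus `𝕋 = ℝ / 2πℤ`. -/
abbrev Torus : Type := AddCircle (2 * Real.pi)

/-- `L²(𝕋)`. The reference measure is the normalized one, `dx / 2π`. -/
abbrev L2 : Type := Lp ℂ 2 (haarAddCircle : Measure Torus)

/-- The Fourier coefficient `f̂(k) = (1/2π) ∫₀^{2π} f(x) e^{-ikx} dx`. -/
def coeff (f : L2) (k : ℤ) : ℂ := fourierCoeff (f : Torus → ℂ) k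

/-- The bracket `⟨k⟩ = (1 + k²)^{1/2}`. -/
def bracket (k : ℤ) : ℝ := Real.sqrt (1 + (k : ℝ) ^ 2)

/-- `f ∈ H^s(𝕋)`. -/
def MemSobolev (s : ℝ) (f : L2) : Prop :=
  Summable fun k : ℤ => bracket k ^ (2 * s) * ‖coeff f k‖ ^ 2

/-- The norm of `H^s(𝕋)`; it is meaningful for `f` with `MemSobolev s f`. -/
def sobolevNorm (s : ℝ) (f : L2) : ℝ :=
  Real.sqrt (∑' k : ℤ, bracket k ^ (2 * s) * ‖coeff f k‖ ^ 2)

/-- `u ∈ C⁰(I; H^s(𝕋))`. -/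
def ContinuousInSobolev (s : ℝ) (I : Set ℝ) (u : ℝ → L2) : Prop :=
  (∀ t ∈ I, MemSobolev s (u t)) ∧
    ∀ t₀ ∈ I, Tendsto (fun t => sobolevNorm s (u t - u t₀)) (𝓝[I] t₀) (𝓝 0)

/-- The symbol `|k|^{2α}` of `(-Δ)^α`. -/
def symbol (α : ℝ) (k : ℤ) : ℝ := |(k : ℝ)| ^ (2 * α)

theorem freeFlow_memℓp (α t : ℝ) (f : L2) :
    Memℓp (fun k : ℤ => Complex.exp (Complex.I * (t * symbol α k : ℝ)) *
      fourierBasis.repr f k) 2 := by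
  rw [← memℓp_norm_iff]
  have h := memℓp_norm_iff.2 (lp.memℓp (fourierBasis.repr f))
  refine (funext fun k => ?_ : (fun k : ℤ => ‖Complex.exp (Complex.I * (t * symbol α k : ℝ)) *
      fourierBasis.repr f k‖) = fun k => ‖fourierBasis.repr f k‖) ▸ h
  rw [norm_mul, mul_comm Complex.I, Complex.norm_exp_ofReal_mul_I, one_mul]

/-- The linear propagator `e^{it(-Δ)^α}` on `L²(𝕋)`: the Fourier multiplier `e^{it|k|^{2α}}`. -/
def freeFlow (α t : ℝ) (f : L2) : L2 :=
  fourierBasis.repr.symm ⟨_, freeFlow_memℓp α t f⟩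

theorem coeff_freeFlow (α t : ℝ) (f : L2) (k : ℤ) :
    coeff (freeFlow α t f) k =
      Complex.exp (Complex.I * (t * symbol α k : ℝ)) * coeff f k := by
  unfold coeff
  rw [← fourierBasis_repr, ← fourierBasis_repr, freeFlow, LinearIsometryEquiv.apply_symm_apply]

/-- `P = (1/π) ‖f‖²_{L²}`, the `L²` norm being taken with respect to `dx` (total mass `2π`). -/
def phase (f : L2) : ℝ := 1 / Real.pi * ∫ x : Torus, ‖f x‖ ^ 2

/-- `e^{it(-Δ)^α - iσPt} f` with `P = (1/π) ‖f‖²_{L²}`. -/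
def phasedFlow (σ α t : ℝ) (f : L2) : L2 :=
  Complex.exp (-Complex.I * (σ * phase f * t : ℝ)) • freeFlow α t f

/-- The Fourier coefficients of the cubic nonlinearity `|f|² f`. -/
def cubicCoeff (f : L2) (k : ℤ) : ℂ :=
  fourierCoeff (fun x : Torus => ((‖f x‖ ^ 2 : ℝ) : ℂ) * f x) k

/-- `u` is a solution in `C⁰(I; H^s(𝕋))`, on the open time interval `I ∋ 0`, of
`i u_t + (-Δ)^α u = σ |u|² u`, `u(0) = u₀`. The equation is tested against the exponentials
`e^{ikx}`. -/
structure IsSolution (σ α s : ℝ) (u₀ : L2) (I : Set ℝ) (u : ℝ → L2) : Prop where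
  isOpen : IsOpen I
  ordConnected : I.OrdConnected
  zero_mem : (0 : ℝ) ∈ I
  continuous : ContinuousInSobolev s I u
  initial : u 0 = u₀
  equation : ∀ t ∈ I, ∀ k : ℤ,
    DifferentiableAt ℝ (fun τ => coeff (u τ) k) t ∧
      Complex.I * deriv (fun τ => coeff (u τ) k) t + (symbol α k : ℂ) * coeff (u t) k =
        (σ : ℂ) * cubicCoeff (u t) k

/-- `I` is the maximal interval of existence and `u` the solution on it: `u` has no extension to
a solution on a larger interval. -/
structure IsMaximalSolution (σ α s : ℝ) (u₀ : L2) (I : Set ℝ) (u : ℝ → L2) : Prop where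
  isSolution : IsSolution σ α s u₀ I u
  maximal : ∀ (J : Set ℝ) (v : ℝ → L2), IsSolution σ α s u₀ J v → I ⊆ J →
    (∀ t ∈ I, v t = u t) → J = I

end FNLS

end

noncomputable section
open MeasureTheory AddCircle Filter Topology
open scoped ENNReal ComplexConjugate

namespace FNLS

/-! Pass to the Fourier coefficients c(k) of u and write the cubic term at frequency k as the sum
over (j, l) of c(k₁) conj(c(k₂)) c(k₃), with k₁ = k - j, k₂ = k - j - l, k₃ = k - l. The terms with
j = 0 or l = 0 add up to 2 ∑|c|² · c(k) - |c(k)|² c(k) (`cubicSeq_eq`). By Parseval and conservation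
of mass, 2 ∑|c|² is the constant P (`phase_eq`, `SeqSolution.mass_eq`). The only part of the
nonlinearity that gains no regularity is therefore the rotation e^{-iσPt}, which the statement
removes. The diagonal term |c(k)|² c(k) is smoother by itself.

The other terms have j, l ≠ 0 and oscillate at the rate Φ = |k|^{2α} - |k₁|^{2α} + |k₂|^{2α} -
|k₃|^{2α}. Convexity of |x|^{2α} gives |Φ| ≥ c |jl| (|k| + |j| + |l|)^{2α-2} with c > 0 because α >
1/2 (`resonance_ge`). Differentiation by parts in time turns their sum into the time derivative of a
trilinear expression with multiplier 1/Φ, plus quintic terms in which one factor has been replaced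
by the nonlinearity (`SeqSolution.normalForm_identity`). Division by Φ gains 2α - 1 derivatives,
with one factor in H^s and the other two in H^q for some q > 1/2 (`admissible_normalForm`,
`l2e_etri_le`). The boundary terms and the time integral then lie in H^{s+a}, which is part (i).

For s ≥ α the energy ∑|k|^{2α}|c|² - (σ/2) Q is conserved, where Q is the quartic form. Since |Q| is
at most a constant times the mass times the square of the H^q norm, with 1/2 < q < α, interpolation
absorbs Q for either sign (`exists_energy_bound`). A bounded H^α norm makes the equation effectively
linear in H^s, so a solution has a limit at a finite endpoint, can be restarted there and glued
(`SeqSolution.exists_extension`). This contradicts maximality, so I = ℝ, and the second estimate is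
the first with q = α and the H^α norms bounded. -/

/-! ### Square-summable families with values in `ℝ≥0∞` -/

/-- The `ℓ²` norm of a family with values in `ℝ≥0∞`. -/
def l2e {ι : Type*} (a : ι → ℝ≥0∞) : ℝ≥0∞ := (∑' i, a i ^ 2) ^ (1 / 2 : ℝ)

theorem sq_inj {x y : ℝ≥0∞} : x ^ 2 = y ^ 2 ↔ x = y :=
  (ENNReal.pow_right_strictMono two_ne_zero).injective.eq_iff

section l2e
variable {ι : Type*}

theorem l2e_sq (a : ι → ℝ≥0∞) : l2e a ^ 2 = ∑' i, a i ^ 2 := by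
  rw [l2e, ← ENNReal.rpow_natCast, ← ENNReal.rpow_mul]; norm_num

theorem l2e_le_iff {a : ι → ℝ≥0∞} {b : ℝ≥0∞} : l2e a ≤ b ↔ ∑' i, a i ^ 2 ≤ b ^ 2 := by
  rw [← l2e_sq, ENNReal.pow_le_pow_left_iff two_ne_zero]

theorem l2e_mono {a b : ι → ℝ≥0∞} (h : ∀ i, a i ≤ b i) : l2e a ≤ l2e b := by
  rw [l2e_le_iff, l2e_sq]
  exact ENNReal.tsum_le_tsum fun i => pow_le_pow_left' (h i) 2

theorem le_l2e (a : ι → ℝ≥0∞) (i : ι) : a i ≤ l2e a := by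
  rw [← ENNReal.pow_le_pow_left_iff two_ne_zero, l2e_sq]
  exact ENNReal.le_tsum (f := fun i => a i ^ 2) i

theorem l2e_const_mul (c : ℝ≥0∞) (a : ι → ℝ≥0∞) : l2e (fun i => c * a i) = c * l2e a := by
  rw [← sq_inj]
  simp only [mul_pow, l2e_sq, ENNReal.tsum_mul_left]

theorem l2e_add_le (a b : ι → ℝ≥0∞) : l2e (fun i => a i + b i) ≤ l2e a + l2e b := by
  let _ : MeasurableSpace ι := ⊤
  have h := ENNReal.lintegral_Lp_add_le (μ := Measure.count) (f := a) (g := b) (p := 2)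
    (measurable_from_top.aemeasurable) (measurable_from_top.aemeasurable) (by norm_num)
  simp only [lintegral_count, Pi.add_apply, ENNReal.rpow_two] at h
  exact h

theorem tsum_mul_le_l2e (a b : ι → ℝ≥0∞) : ∑' i, a i * b i ≤ l2e a * l2e b := by
  let _ : MeasurableSpace ι := ⊤
  have h := ENNReal.lintegral_mul_le_Lp_mul_Lq (μ := Measure.count) Real.HolderConjugate.two_two
    (f := a) (g := b) (measurable_from_top.aemeasurable) (measurable_from_top.aemeasurable)
  simp only [lintegral_count, Pi.mul_apply, ENNReal.rpow_two] at h
  exact h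

theorem l2e_comp_equiv {κ : Type*} (e : κ ≃ ι) (a : ι → ℝ≥0∞) :
    l2e (fun i => a (e i)) = l2e a := by
  rw [l2e, l2e, e.tsum_eq (fun i => a i ^ 2)]

theorem l2e_prod_mul {κ : Type*} (a : ι → ℝ≥0∞) (b : κ → ℝ≥0∞) :
    l2e (fun p : ι × κ => a p.1 * b p.2) = l2e a * l2e b := by
  rw [← sq_inj]
  simp only [mul_pow, l2e_sq]
  rw [ENNReal.tsum_prod (f := fun i j => a i ^ 2 * b j ^ 2)]
  simp only [ENNReal.tsum_mul_left, ENNReal.tsum_mul_right]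

end l2e

/-! ### A trilinear estimate by Cauchy-Schwarz -/

/-- `(k, (j, l)) ↦ (k - j, (k - j - l, k - l))`. -/
def freqEquiv : ℤ × (ℤ × ℤ) ≃ ℤ × (ℤ × ℤ) where
  toFun x := (x.1 - x.2.1, (x.1 - x.2.1 - x.2.2, x.1 - x.2.2))
  invFun y := (y.1 - y.2.1 + y.2.2, (y.2.2 - y.2.1, y.1 - y.2.1))
  left_inv x := by ext <;> simp
  right_inv y := by ext <;> simp <;> ring

/-- `(j, l) ↦ (k - j - l, k - l)`. -/
def pairEquiv₂₃ (k : ℤ) : ℤ × ℤ ≃ ℤ × ℤ where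
  toFun p := (k - p.1 - p.2, k - p.2)
  invFun y := (y.2 - y.1, k - y.2)
  left_inv p := by ext <;> simp
  right_inv y := by ext <;> simp

/-- `(j, l) ↦ (k - j, k - l)`. -/
def pairEquiv₁₃ (k : ℤ) : ℤ × ℤ ≃ ℤ × ℤ where
  toFun p := (k - p.1, k - p.2)
  invFun y := (k - y.1, k - y.2)
  left_inv p := by ext <;> simp
  right_inv y := by ext <;> simp

/-- `(j, l) ↦ (k - j, k - j - l)`. -/
def pairEquiv₁₂ (k : ℤ) : ℤ × ℤ ≃ ℤ × ℤ where
  toFun p := (k - p.1, k - p.1 - p.2)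
  invFun y := (k - y.1, y.1 - y.2)
  left_inv p := by ext <;> simp
  right_inv y := by ext <;> simp

/-- For fixed k, Cauchy-Schwarz in (j, l) splits off the kernel. Taking ℓ² in k as well leaves the
full ℓ² norm of a product over (k, j, l), and the change of variables to (k₁, k₂, k₃) makes it
factor. -/
theorem l2e_trilinear_le {K : ℤ → ℤ × ℤ → ℝ≥0∞} {Z : ℝ≥0∞} (hK : ∀ k, l2e (K k) ≤ Z)
    (a b c : ℤ → ℝ≥0∞) :
    l2e (fun k => ∑' p : ℤ × ℤ, K k p * (a (k - p.1) * (b (k - p.1 - p.2) * c (k - p.2)))) ≤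
      Z * (l2e a * (l2e b * l2e c)) := by
  have h1 : ∀ k, ∑' p : ℤ × ℤ, K k p * (a (k - p.1) * (b (k - p.1 - p.2) * c (k - p.2))) ≤
      Z * l2e (fun p : ℤ × ℤ => a (k - p.1) * (b (k - p.1 - p.2) * c (k - p.2))) := fun k =>
    (tsum_mul_le_l2e _ _).trans (mul_le_mul_left (hK k) _)
  refine (l2e_mono h1).trans ?_
  rw [l2e_const_mul]
  refine mul_le_mul_right (le_of_eq ?_) _
  rw [← l2e_prod_mul, ← l2e_prod_mul, ← l2e_comp_equiv freqEquiv,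
    ← sq_inj]
  simp only [l2e_sq]
  rw [ENNReal.tsum_prod']
  rfl

/-! ### Brackets -/

theorem one_le_bracket (k : ℤ) : 1 ≤ bracket k := by
  rw [bracket, Real.one_le_sqrt]; nlinarith [sq_nonneg (k : ℝ)]

theorem bracket_pos (k : ℤ) : 0 < bracket k := zero_lt_one.trans_le (one_le_bracket k)

theorem bracket_sq (k : ℤ) : bracket k ^ 2 = 1 + (k : ℝ) ^ 2 :=
  Real.sq_sqrt (by positivity)

theorem abs_le_bracket (k : ℤ) : |(k : ℝ)| ≤ bracket k := by
  rw [bracket]; exact Real.abs_le_sqrt (by linarith)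

theorem bracket_le_one_add_abs (k : ℤ) : bracket k ≤ 1 + |(k : ℝ)| := by
  rw [bracket, Real.sqrt_le_left (by positivity)]
  nlinarith [abs_nonneg (k : ℝ), sq_abs (k : ℝ)]

theorem bracket_le_add_abs_sub (k n : ℤ) : bracket k ≤ bracket n + |((k - n : ℤ) : ℝ)| := by
  have h0 := bracket_pos n
  have h1 := abs_le_bracket n
  refine le_of_sq_le_sq ?_ (by positivity)
  rw [add_sq, bracket_sq, bracket_sq, sq_abs]
  push_cast
  have : (n : ℝ) * (k - n) ≤ bracket n * |(k : ℝ) - n| := by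
    refine (le_abs_self _).trans ?_
    rw [abs_mul]; gcongr
  nlinarith

theorem bracket_rpow_pos (k : ℤ) (r : ℝ) : 0 < bracket k ^ r := Real.rpow_pos_of_pos (bracket_pos k) r

theorem bracket_rpow_le {r r' : ℝ} (h : r ≤ r') (k : ℤ) : bracket k ^ r ≤ bracket k ^ r' :=
  Real.rpow_le_rpow_of_exponent_le (one_le_bracket k) h

theorem summable_bracket_rpow {q : ℝ} (hq : 1 / 2 < q) :
    Summable fun k : ℤ => bracket k ^ (-(2 * q)) := by
  have h1 : Summable fun k : ℤ => |(k : ℝ)| ^ (-(2 * q)) := by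
    have := Real.summable_abs_int_rpow (b := 2 * q) (by linarith)
    exact this
  refine Summable.of_norm_bounded_eventually h1 ?_
  rw [Filter.eventually_cofinite]
  refine (Set.finite_singleton (0 : ℤ)).subset fun k hk => ?_
  by_contra h
  have h0 : k ≠ 0 := h
  refine hk ?_
  rw [Real.norm_of_nonneg (bracket_rpow_pos k _).le]
  exact Real.rpow_le_rpow_of_nonpos (by positivity) (abs_le_bracket k) (by linarith)

/-- The constant `(∑ ⟨k⟩^{-2 * q})^{1/2}`. -/
def bracketConst (q : ℝ) : ℝ≥0∞ := l2e fun k : ℤ => ENNReal.ofReal (bracket k ^ (-q))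

theorem bracketConst_lt_top {q : ℝ} (hq : 1 / 2 < q) : bracketConst q < ∞ := by
  rw [bracketConst, l2e]
  refine ENNReal.rpow_lt_top_of_nonneg (by norm_num) ?_
  have h : ∀ k : ℤ, ENNReal.ofReal (bracket k ^ (-q)) ^ 2 =
      ENNReal.ofReal (bracket k ^ (-(2 * q))) := fun k => by
    rw [← ENNReal.ofReal_pow (bracket_rpow_pos k _).le, ← Real.rpow_mul_natCast (bracket_pos k).le]
    congr 2; push_cast; ring
  simp only [h]
  exact (summable_bracket_rpow hq).tsum_ofReal_ne_top

/-! ### Weighted norms of coefficient sequences -/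

/-- The `H^r` norm of a sequence of Fourier coefficients. -/
def wnorm (r : ℝ) (c : ℤ → ℂ) : ℝ≥0∞ := l2e fun k => ENNReal.ofReal (bracket k ^ r) * ‖c k‖ₑ

theorem wnorm_mono_exp {r r' : ℝ} (h : r ≤ r') (c : ℤ → ℂ) : wnorm r c ≤ wnorm r' c :=
  l2e_mono fun k => mul_le_mul_left (ENNReal.ofReal_le_ofReal (bracket_rpow_le h k)) _

theorem wnorm_mono (r : ℝ) {c d : ℤ → ℂ} (h : ∀ k, ‖c k‖ ≤ ‖d k‖) : wnorm r c ≤ wnorm r d :=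
  l2e_mono fun k => mul_le_mul_right (enorm_le_iff_norm_le.2 (h k)) _

theorem wnorm_congr_norm (r : ℝ) {c d : ℤ → ℂ} (h : ∀ k, ‖c k‖ = ‖d k‖) :
    wnorm r c = wnorm r d :=
  le_antisymm (wnorm_mono r fun k => (h k).le) (wnorm_mono r fun k => (h k).ge)

theorem wnorm_add_le (r : ℝ) (c d : ℤ → ℂ) : wnorm r (c + d) ≤ wnorm r c + wnorm r d := by
  refine le_trans (l2e_mono fun k => ?_) (l2e_add_le _ _)
  rw [← mul_add]
  exact mul_le_mul_right (enorm_add_le _ _) _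

theorem wnorm_neg (r : ℝ) (c : ℤ → ℂ) : wnorm r (-c) = wnorm r c :=
  wnorm_congr_norm r fun k => by simp

theorem wnorm_sub_comm (r : ℝ) (c d : ℤ → ℂ) : wnorm r (c - d) = wnorm r (d - c) :=
  wnorm_congr_norm r fun _ => norm_sub_rev _ _

theorem wnorm_sub_le (r : ℝ) (c d : ℤ → ℂ) : wnorm r (c - d) ≤ wnorm r c + wnorm r d := by
  rw [sub_eq_add_neg, ← wnorm_neg r d]; exact wnorm_add_le r c (-d)

theorem wnorm_smul (r : ℝ) (z : ℂ) (c : ℤ → ℂ) : wnorm r (z • c) = ‖z‖ₑ * wnorm r c := by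
  rw [wnorm, wnorm, ← l2e_const_mul]
  congr 1; ext k
  rw [Pi.smul_apply, smul_eq_mul, enorm_mul]; ring

@[simp] theorem wnorm_zero (r : ℝ) : wnorm r 0 = 0 := by
  simp [wnorm, l2e]

theorem enorm_le_wnorm (r : ℝ) (c : ℤ → ℂ) (k : ℤ) :
    ‖c k‖ₑ ≤ ENNReal.ofReal (bracket k ^ (-r)) * wnorm r c := by
  have h := le_l2e (fun k => ENNReal.ofReal (bracket k ^ r) * ‖c k‖ₑ) k
  refine le_trans (le_of_eq ?_) (mul_le_mul_right h _)
  rw [← mul_assoc, ← ENNReal.ofReal_mul (bracket_rpow_pos k _).le, ← Real.rpow_add (bracket_pos k)]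
  simp

/-! ### Trilinear Fourier multipliers -/

/-- The summands of `tri`. -/
def triTerm (m : ℤ → ℤ × ℤ → ℂ) (f g h : ℤ → ℂ) (k : ℤ) (p : ℤ × ℤ) : ℂ :=
  m k p * (f (k - p.1) * (conj (g (k - p.1 - p.2)) * h (k - p.2)))

/-- The trilinear multiplier `∑ m(k; j, l) f(k - j) conj (g (k - j - l)) h(k - l)`; the three
frequencies `k₁ = k - j`, `k₂ = k - j - l`, `k₃ = k - l` satisfy `k₁ - k₂ + k₃ = k`. -/
def tri (m : ℤ → ℤ × ℤ → ℂ) (f g h : ℤ → ℂ) (k : ℤ) : ℂ := ∑' p, triTerm m f g h k p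

/-- The sum of the absolute values of the summands of `tri`. -/
def etri (m : ℤ → ℤ × ℤ → ℂ) (f g h : ℤ → ℂ) (k : ℤ) : ℝ≥0∞ := ∑' p, ‖triTerm m f g h k p‖ₑ

theorem enorm_tri_le (m : ℤ → ℤ × ℤ → ℂ) (f g h : ℤ → ℂ) (k : ℤ) :
    ‖tri m f g h k‖ₑ ≤ etri m f g h k := enorm_tsum_le_tsum_enorm

/-- The pointwise bound on a multiplier under which `tri` maps into `H^r`, with one factor measured
in `H^s` and the others in `H^q`. -/
def Admissible (r s q A : ℝ) (m : ℤ → ℤ × ℤ → ℂ) : Prop :=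
  ∀ k p, ‖m k p‖ * bracket k ^ r ≤
    A * (bracket (k - p.1) ^ s + bracket (k - p.1 - p.2) ^ s + bracket (k - p.2) ^ s +
      bracket (k - p.1) ^ s * bracket (k - p.1 - p.2) ^ q * bracket (k - p.2) ^ q *
        (bracket p.1 ^ (-1 : ℝ) * bracket p.2 ^ (-1 : ℝ)))

/-- The symmetrized product of two `H^q` norms and one `H^s` norm. -/
def mixedNorm (s q : ℝ) (f g h : ℤ → ℂ) : ℝ≥0∞ :=
  wnorm s f * (wnorm q g * wnorm q h) + wnorm q f * (wnorm s g * wnorm q h) +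
    wnorm q f * (wnorm q g * wnorm s h)

/-- The constant of the trilinear estimate. -/
def triConst (q A : ℝ) : ℝ≥0∞ :=
  ENNReal.ofReal A * (bracketConst q ^ 2 + bracketConst 1 ^ 2)

theorem triConst_lt_top {q : ℝ} (hq : 1 / 2 < q) (A : ℝ) : triConst q A < ∞ := by
  refine ENNReal.mul_lt_top ENNReal.ofReal_lt_top (ENNReal.add_lt_top.2 ⟨?_, ?_⟩)
  · exact ENNReal.pow_lt_top (bracketConst_lt_top hq)
  · exact ENNReal.pow_lt_top (bracketConst_lt_top (by norm_num))

/-- The weight `⟨k⟩^r` as an extended nonnegative number. -/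
def ebr (r : ℝ) (k : ℤ) : ℝ≥0∞ := ENNReal.ofReal (bracket k ^ r)

theorem ebr_neg_mul (r : ℝ) (k : ℤ) : ebr (-r) k * ebr r k = 1 := by
  rw [ebr, ebr, ← ENNReal.ofReal_mul (bracket_rpow_pos k _).le, ← Real.rpow_add (bracket_pos k)]
  simp

theorem Admissible.enorm_le {r s q A : ℝ} {m : ℤ → ℤ × ℤ → ℂ} (hA : 0 ≤ A)
    (hm : Admissible r s q A m) (k : ℤ) (p : ℤ × ℤ) :
    ‖m k p‖ₑ * ebr r k ≤ ENNReal.ofReal A *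
      (ebr s (k - p.1) + ebr s (k - p.1 - p.2) + ebr s (k - p.2) +
      ebr s (k - p.1) * ebr q (k - p.1 - p.2) * ebr q (k - p.2) * (ebr (-1) p.1 * ebr (-1) p.2)) := by
  have h := ENNReal.ofReal_le_ofReal (hm k p)
  have hp := fun (n : ℤ) (x : ℝ) => (bracket_rpow_pos n x).le
  have e1 := hp (k - p.1) s
  have e2 := hp (k - p.1 - p.2) s
  have e3 := hp (k - p.2) s
  have e4 := hp (k - p.1 - p.2) q
  have e5 := hp (k - p.2) q
  have e6 := hp p.1 (-1)
  have e7 := hp p.2 (-1)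
  rw [ENNReal.ofReal_mul (norm_nonneg _), ofReal_norm, ENNReal.ofReal_mul hA,
    ENNReal.ofReal_add (by positivity) (by positivity),
    ENNReal.ofReal_add (by positivity) (by positivity),
    ENNReal.ofReal_add (by positivity) (by positivity),
    ENNReal.ofReal_mul (by positivity), ENNReal.ofReal_mul (by positivity),
    ENNReal.ofReal_mul (by positivity), ENNReal.ofReal_mul (by positivity)] at h
  exact h

theorem l2e_kernel₂₃ (q : ℝ) (k : ℤ) :
    l2e (fun p : ℤ × ℤ => ebr (-q) (k - p.1 - p.2) * ebr (-q) (k - p.2)) = bracketConst q ^ 2 := by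
  rw [sq]
  exact (l2e_comp_equiv (pairEquiv₂₃ k) (fun p : ℤ × ℤ => ebr (-q) p.1 * ebr (-q) p.2)).trans
    (l2e_prod_mul _ _)

theorem l2e_kernel₁₃ (q : ℝ) (k : ℤ) :
    l2e (fun p : ℤ × ℤ => ebr (-q) (k - p.1) * ebr (-q) (k - p.2)) = bracketConst q ^ 2 := by
  rw [sq]
  exact (l2e_comp_equiv (pairEquiv₁₃ k) (fun p : ℤ × ℤ => ebr (-q) p.1 * ebr (-q) p.2)).trans
    (l2e_prod_mul _ _)

theorem l2e_kernel₁₂ (q : ℝ) (k : ℤ) :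
    l2e (fun p : ℤ × ℤ => ebr (-q) (k - p.1) * ebr (-q) (k - p.1 - p.2)) = bracketConst q ^ 2 := by
  rw [sq]
  exact (l2e_comp_equiv (pairEquiv₁₂ k) (fun p : ℤ × ℤ => ebr (-q) p.1 * ebr (-q) p.2)).trans
    (l2e_prod_mul _ _)

theorem l2e_kernel (q : ℝ) :
    l2e (fun p : ℤ × ℤ => ebr (-q) p.1 * ebr (-q) p.2) = bracketConst q ^ 2 := by
  rw [sq]; exact l2e_prod_mul _ _

/-- Each of the four terms in `Admissible` reduces to `l2e_trilinear_le`. In the first three, the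
two factors that carry no weight receive ⟨·⟩^{-q}⟨·⟩^q and the negative powers form the kernel. In
the fourth the kernel is ⟨j⟩^{-1}⟨l⟩^{-1}. All kernels have ℓ² norm in (j, l) independent of k,
finite when q > 1/2. -/
theorem l2e_etri_le {r s q A : ℝ} {m : ℤ → ℤ × ℤ → ℂ} (hA : 0 ≤ A) (hm : Admissible r s q A m)
    (f g h : ℤ → ℂ) :
    l2e (fun k => ebr r k * etri m f g h k) ≤ triConst q A * mixedNorm s q f g h := by
  let w (x : ℝ) (c : ℤ → ℂ) (k : ℤ) : ℝ≥0∞ := ebr x k * ‖c k‖ₑ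
  let T (K : ℤ → ℤ × ℤ → ℝ≥0∞) (x y z : ℝ) (k : ℤ) : ℝ≥0∞ :=
    ∑' p : ℤ × ℤ, K k p * (w x f (k - p.1) * (w y g (k - p.1 - p.2) * w z h (k - p.2)))
  let K₁ (k : ℤ) (p : ℤ × ℤ) := ebr (-q) (k - p.1 - p.2) * ebr (-q) (k - p.2)
  let K₂ (k : ℤ) (p : ℤ × ℤ) := ebr (-q) (k - p.1) * ebr (-q) (k - p.2)
  let K₃ (k : ℤ) (p : ℤ × ℤ) := ebr (-q) (k - p.1) * ebr (-q) (k - p.1 - p.2)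
  let K₄ (_ : ℤ) (p : ℤ × ℤ) := ebr (-1) p.1 * ebr (-1) p.2
  have hpt : ∀ k, ebr r k * etri m f g h k ≤ ENNReal.ofReal A *
      (T K₁ s q q k + T K₂ q s q k + T K₃ q q s k + T K₄ s q q k) := fun k => by
    simp only [T]
    rw [etri, ← ENNReal.tsum_mul_left, ← ENNReal.tsum_add, ← ENNReal.tsum_add, ← ENNReal.tsum_add,
      ← ENNReal.tsum_mul_left]
    refine ENNReal.tsum_le_tsum fun p => ?_
    have h0 : ebr r k * ‖triTerm m f g h k p‖ₑ = (‖m k p‖ₑ * ebr r k) *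
        (‖f (k - p.1)‖ₑ * (‖g (k - p.1 - p.2)‖ₑ * ‖h (k - p.2)‖ₑ)) := by
      rw [triTerm, enorm_mul, enorm_mul, enorm_mul, RCLike.enorm_conj]; ring
    rw [h0]
    refine (mul_le_mul_left (hm.enorm_le hA k p) _).trans (le_of_eq ?_)
    simp only [K₁, K₂, K₃, K₄, w]
    have e1 := ebr_neg_mul q (k - p.1)
    have e2 := ebr_neg_mul q (k - p.1 - p.2)
    have e3 := ebr_neg_mul q (k - p.2)
    generalize ‖f (k - p.1)‖ₑ = F
    generalize ‖g (k - p.1 - p.2)‖ₑ = G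
    generalize ‖h (k - p.2)‖ₑ = H
    generalize ebr (-q) (k - p.1) = a1 at *
    generalize ebr (-q) (k - p.1 - p.2) = a2 at *
    generalize ebr (-q) (k - p.2) = a3 at *
    generalize ebr q (k - p.1) = b1 at *
    generalize ebr q (k - p.1 - p.2) = b2 at *
    generalize ebr q (k - p.2) = b3 at *
    generalize ebr s (k - p.1) = c1
    generalize ebr s (k - p.1 - p.2) = c2
    generalize ebr s (k - p.2) = c3
    generalize ebr (-1) p.1 = d1
    generalize ebr (-1) p.2 = d2
    rw [mul_assoc]
    congr 1
    -- The unit factors mark where ⟨n⟩^{-q}⟨n⟩^q = 1 is inserted.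
    calc _ = 1 * 1 * c1 * F * G * H + 1 * 1 * c2 * F * G * H + 1 * 1 * c3 * F * G * H +
          d1 * d2 * (c1 * F * (b2 * G * (b3 * H))) := by ring
      _ = (a2 * b2) * (a3 * b3) * c1 * F * G * H + (a1 * b1) * (a3 * b3) * c2 * F * G * H +
          (a1 * b1) * (a2 * b2) * c3 * F * G * H +
          d1 * d2 * (c1 * F * (b2 * G * (b3 * H))) := by rw [e1, e2, e3]
      _ = _ := by ring
  refine (l2e_mono hpt).trans ?_
  rw [l2e_const_mul, triConst, mul_assoc]
  refine mul_le_mul_right ?_ _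
  have b1 := l2e_trilinear_le (K := K₁) (fun k => (l2e_kernel₂₃ q k).le) (w s f) (w q g) (w q h)
  have b2 := l2e_trilinear_le (K := K₂) (fun k => (l2e_kernel₁₃ q k).le) (w q f) (w s g) (w q h)
  have b3 := l2e_trilinear_le (K := K₃) (fun k => (l2e_kernel₁₂ q k).le) (w q f) (w q g) (w s h)
  have b4 := l2e_trilinear_le (K := K₄) (fun _ => (l2e_kernel 1).le) (w s f) (w q g) (w q h)
  refine (l2e_add_le _ _).trans ((add_le_add ((l2e_add_le _ _).trans
    (add_le_add ((l2e_add_le _ _).trans (add_le_add b1 b2)) b3)) b4).trans ?_)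
  change bracketConst q ^ 2 * (wnorm s f * (wnorm q g * wnorm q h)) +
    bracketConst q ^ 2 * (wnorm q f * (wnorm s g * wnorm q h)) +
    bracketConst q ^ 2 * (wnorm q f * (wnorm q g * wnorm s h)) +
    bracketConst 1 ^ 2 * (wnorm s f * (wnorm q g * wnorm q h)) ≤ _
  -- The fourth term has the same norms as the first one, so it costs only the second summand of the
  -- constant.
  rw [add_mul, mixedNorm, mul_add, mul_add]
  refine add_le_add_right (mul_le_mul_right ?_ _) _
  rw [add_assoc]
  exact le_self_add

theorem wnorm_tri_le {r s q A : ℝ} {m : ℤ → ℤ × ℤ → ℂ} (hA : 0 ≤ A) (hm : Admissible r s q A m)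
    (f g h : ℤ → ℂ) : wnorm r (tri m f g h) ≤ triConst q A * mixedNorm s q f g h :=
  (l2e_mono fun k => mul_le_mul_right (enorm_tri_le m f g h k) _).trans (l2e_etri_le hA hm f g h)

theorem etri_le {r s q A : ℝ} {m : ℤ → ℤ × ℤ → ℂ} (hA : 0 ≤ A) (hm : Admissible r s q A m)
    (f g h : ℤ → ℂ) (k : ℤ) :
    etri m f g h k ≤ ebr (-r) k * (triConst q A * mixedNorm s q f g h) := by
  have h1 := (le_l2e (fun k => ebr r k * etri m f g h k) k).trans (l2e_etri_le hA hm f g h)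
  refine le_trans (le_of_eq ?_) (mul_le_mul_right h1 _)
  rw [← mul_assoc, ebr_neg_mul, one_mul]

theorem mixedNorm_le {s q : ℝ} (hqs : q ≤ s) (f g h : ℤ → ℂ) :
    mixedNorm s q f g h ≤ 3 * (wnorm s f * (wnorm s g * wnorm s h)) := by
  have hf := wnorm_mono_exp hqs f
  have hg := wnorm_mono_exp hqs g
  have hh := wnorm_mono_exp hqs h
  rw [mixedNorm]
  calc _ ≤ wnorm s f * (wnorm s g * wnorm s h) + wnorm s f * (wnorm s g * wnorm s h) +
        wnorm s f * (wnorm s g * wnorm s h) := by gcongr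
    _ = _ := by ring

theorem mixedNorm_self (s q : ℝ) (f : ℤ → ℂ) :
    mixedNorm s q f f f = 3 * (wnorm s f * wnorm q f ^ 2) := by
  rw [mixedNorm]; ring

theorem summable_triTerm {r s q A : ℝ} {m : ℤ → ℤ × ℤ → ℂ} (hq : 1 / 2 < q) (hqs : q ≤ s)
    (hA : 0 ≤ A) (hm : Admissible r s q A m) {f g h : ℤ → ℂ} (hf : wnorm s f < ∞)
    (hg : wnorm s g < ∞) (hh : wnorm s h < ∞) (k : ℤ) : Summable (triTerm m f g h k) := by
  refine Summable.of_norm ?_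
  rw [← tsum_enorm_ne_top_iff_summable_norm]
  refine ((etri_le hA hm f g h k).trans_lt ?_).ne
  refine ENNReal.mul_lt_top ENNReal.ofReal_lt_top (ENNReal.mul_lt_top (triConst_lt_top hq A) ?_)
  exact (mixedNorm_le hqs f g h).trans_lt (ENNReal.mul_lt_top (by norm_num)
    (ENNReal.mul_lt_top hf (ENNReal.mul_lt_top hg hh)))

theorem wnorm_sub_lt_top {r : ℝ} {f g : ℤ → ℂ} (hf : wnorm r f < ∞) (hg : wnorm r g < ∞) :
    wnorm r (f - g) < ∞ :=
  (wnorm_sub_le r f g).trans_lt (ENNReal.add_lt_top.2 ⟨hf, hg⟩)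

theorem tri_sub {r s q A : ℝ} {m : ℤ → ℤ × ℤ → ℂ} (hq : 1 / 2 < q) (hqs : q ≤ s)
    (hA : 0 ≤ A) (hm : Admissible r s q A m) {f g h f' g' h' : ℤ → ℂ} (hf : wnorm s f < ∞)
    (hg : wnorm s g < ∞) (hh : wnorm s h < ∞) (hf' : wnorm s f' < ∞) (hg' : wnorm s g' < ∞)
    (hh' : wnorm s h' < ∞) :
    tri m f g h - tri m f' g' h' =
      tri m (f - f') g h + tri m f' (g - g') h + tri m f' g' (h - h') := by
  have df := wnorm_sub_lt_top hf hf'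
  have dg := wnorm_sub_lt_top hg hg'
  have dh := wnorm_sub_lt_top hh hh'
  ext k
  have S := fun {a b c : ℤ → ℂ} (ha : wnorm s a < ∞) (hb : wnorm s b < ∞) (hc : wnorm s c < ∞) =>
    summable_triTerm hq hqs hA hm ha hb hc k
  simp only [Pi.sub_apply, Pi.add_apply, tri]
  rw [← (S hf hg hh).tsum_sub (S hf' hg' hh'), ← (S df hg hh).tsum_add (S hf' dg hh),
    ← ((S df hg hh).add (S hf' dg hh)).tsum_add (S hf' hg' dh)]
  congr 1; ext p
  simp only [triTerm, Pi.sub_apply, map_sub]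
  ring

theorem wnorm_tri_sub_le {r s q A : ℝ} {m : ℤ → ℤ × ℤ → ℂ} (hq : 1 / 2 < q) (hqs : q ≤ s)
    (hA : 0 ≤ A) (hm : Admissible r s q A m) {f g h f' g' h' : ℤ → ℂ} (hf : wnorm s f < ∞)
    (hg : wnorm s g < ∞) (hh : wnorm s h < ∞) (hf' : wnorm s f' < ∞) (hg' : wnorm s g' < ∞)
    (hh' : wnorm s h' < ∞) :
    wnorm r (tri m f g h - tri m f' g' h') ≤ 3 * triConst q A *
      (wnorm s (f - f') * (wnorm s g * wnorm s h) + wnorm s f' * (wnorm s (g - g') * wnorm s h) +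
        wnorm s f' * (wnorm s g' * wnorm s (h - h'))) := by
  rw [tri_sub hq hqs hA hm hf hg hh hf' hg' hh']
  have B := fun a b c => (wnorm_tri_le hA hm a b c).trans
    (mul_le_mul_right (mixedNorm_le hqs a b c) _)
  refine (wnorm_add_le _ _ _).trans ((add_le_add ((wnorm_add_le _ _ _).trans
    (add_le_add (B _ _ _) (B _ _ _))) (B _ _ _)).trans (le_of_eq ?_))
  ring

/-! ### Lower bound for the resonance function -/

/-- Away from 0 the second derivative of |x|^p is p(p-1)|x|^{p-2}, and since p ≤ 2 this is at least
its value at R. To avoid the singularity at 0, the function is treated as h(|x|) with h convex and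
increasing on [0, R]. -/
theorem convexOn_abs_rpow_sub_sq {p R : ℝ} (hp : 1 < p) (hp2 : p ≤ 2) (hR : 0 < R) :
    ConvexOn ℝ (Set.Icc (-R) R) fun x => |x| ^ p - p * (p - 1) * R ^ (p - 2) / 2 * x ^ 2 := by
  set c := p * (p - 1) * R ^ (p - 2) with hc
  have hc0 : 0 ≤ c := mul_nonneg (mul_nonneg (by linarith) (by linarith)) (by positivity)
  let h : ℝ → ℝ := fun y => y ^ p - c / 2 * y ^ 2
  have hd : ∀ y, HasDerivAt h (p * y ^ (p - 1) - c * y) y := fun y => by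
    have h1 := (Real.hasDerivAt_rpow_const (x := y) (p := p) (Or.inr hp.le))
    have h2 := ((hasDerivAt_id y).pow 2).const_mul (c / 2)
    refine (h1.sub h2).congr_deriv ?_
    simp; ring
  have hRle : ∀ y, 0 < y → y ≤ R → R ^ (p - 2) ≤ y ^ (p - 2) := fun y hy hyR =>
    Real.rpow_le_rpow_of_nonpos hy hyR (by linarith)
  -- Here h'(y) = y (p y^{p-2} - c), and c ≤ p y^{p-2} because p - 1 ≤ 1 and y ≤ R.
  have hdn : ∀ y, 0 < y → y < R → 0 ≤ deriv h y := fun y hy hyR => by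
    rw [(hd y).deriv]
    have e : y ^ (p - 1) = y ^ (p - 2) * y := by
      rw [← Real.rpow_add_one hy.ne']; congr 1; ring
    have := hRle y hy hyR.le
    rw [e, hc]
    have h3 : p * (p - 1) * R ^ (p - 2) ≤ p * y ^ (p - 2) := by
      have h4 : (p - 1) * R ^ (p - 2) ≤ 1 * y ^ (p - 2) := by
        refine mul_le_mul (by linarith) this (by positivity) (by norm_num)
      nlinarith
    nlinarith
  have hcont : Continuous h := continuous_iff_continuousAt.2 fun y => (hd y).continuousAt
  have hconv : ConvexOn ℝ (Set.Icc 0 R) h := by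
    refine convexOn_of_deriv2_nonneg (convex_Icc 0 R) hcont.continuousOn
      (fun y _ => (hd y).differentiableAt.differentiableWithinAt) ?_ ?_
    · intro y hy
      rw [interior_Icc] at hy
      have : deriv h = fun y => p * y ^ (p - 1) - c * y := funext fun y => (hd y).deriv
      rw [this]
      exact (((Real.hasDerivAt_rpow_const (x := y) (p := p - 1) (Or.inl hy.1.ne')).const_mul p).sub
        ((hasDerivAt_id y).const_mul c)).differentiableAt.differentiableWithinAt
    · intro y hy
      rw [interior_Icc] at hy
      have : deriv h = fun y => p * y ^ (p - 1) - c * y := funext fun y => (hd y).deriv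
      rw [Function.iterate_succ, Function.iterate_one, Function.comp_apply, this]
      have h5 := (((Real.hasDerivAt_rpow_const (x := y) (p := p - 1) (Or.inl hy.1.ne')).const_mul
        p).sub ((hasDerivAt_id y).const_mul c)).deriv
      have h6 : deriv (fun y => p * y ^ (p - 1) - c * y) y =
        p * ((p - 1) * y ^ (p - 1 - 1)) - c * 1 := h5
      rw [h6, hc, show p - 1 - 1 = p - 2 by ring]
      have := hRle y hy.1 hy.2.le
      have h7 : p * (p - 1) * R ^ (p - 2) ≤ p * (p - 1) * y ^ (p - 2) :=
        mul_le_mul_of_nonneg_left this (mul_nonneg (by linarith) (by linarith))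
      linarith
  have hmono : MonotoneOn h (Set.Icc 0 R) := by
    refine monotoneOn_of_deriv_nonneg (convex_Icc 0 R) hcont.continuousOn
      (fun y _ => (hd y).differentiableAt.differentiableWithinAt) fun y hy => ?_
    rw [interior_Icc] at hy
    exact hdn y hy.1 hy.2
  have habs : ∀ x ∈ Set.Icc (-R) R, |x| ∈ Set.Icc 0 R := fun x hx => ⟨abs_nonneg x, abs_le.2 hx⟩
  refine ⟨convex_Icc _ _, fun x hx y hy a b ha hb hab => ?_⟩
  have e : ∀ z : ℝ, |z| ^ p - c / 2 * z ^ 2 = h |z| := fun z => by simp [h]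
  simp only [e]
  have hm := (convex_Icc (-R) R) hx hy ha hb hab
  have hm' := (convex_Icc 0 R) (habs x hx) (habs y hy) ha hb hab
  refine (hmono (habs _ hm) hm' ?_).trans (hconv.2 (habs x hx) (habs y hy) ha hb hab)
  simp only [smul_eq_mul]
  refine (abs_add_le _ _).trans ?_
  rw [abs_mul, abs_mul, abs_of_nonneg ha, abs_of_nonneg hb]

/-- The inner points x - j and x - l are convex combinations of the outer points x and x - j - l
with complementary weights. Adding the two convexity inequalities gives the claim. -/
theorem second_difference_nonneg {g : ℝ → ℝ} {S : Set ℝ} (hg : ConvexOn ℝ S g) {x j l : ℝ}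
    (hj : 0 < j) (hl : 0 < l) (h1 : x ∈ S) (h2 : x - j - l ∈ S) :
    0 ≤ g x - g (x - j) + g (x - j - l) - g (x - l) := by
  have hjl : 0 < j + l := by linarith
  have e1 : l / (j + l) + j / (j + l) = 1 := by field_simp; ring
  have a1 := hg.2 h1 h2 (div_nonneg hl.le hjl.le) (div_nonneg hj.le hjl.le) e1
  have a2 := hg.2 h1 h2 (div_nonneg hj.le hjl.le) (div_nonneg hl.le hjl.le) (by linarith)
  have e2 : (l / (j + l)) • x + (j / (j + l)) • (x - j - l) = x - j := by
    simp only [smul_eq_mul]; field_simp; ring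
  have e3 : (j / (j + l)) • x + (l / (j + l)) • (x - j - l) = x - l := by
    simp only [smul_eq_mul]; field_simp; ring
  rw [e2] at a1
  rw [e3] at a2
  simp only [smul_eq_mul] at a1 a2
  have e4 : l / (j + l) = 1 - j / (j + l) := by linarith
  rw [e4] at a1 a2
  nlinarith

/-- The second difference of x² is 2jl, so subtracting the quadratic in `convexOn_abs_rpow_sub_sq`
produces exactly the constant times jl. -/
theorem abs_second_difference_ge {p R : ℝ} (hp : 1 < p) (hp2 : p ≤ 2) (hR : 0 < R) {x j l : ℝ}
    (h1 : x ∈ Set.Icc (-R) R) (h2 : x - j ∈ Set.Icc (-R) R) (h3 : x - l ∈ Set.Icc (-R) R)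
    (h4 : x - j - l ∈ Set.Icc (-R) R) (hj : j ≠ 0) (hl : l ≠ 0) :
    p * (p - 1) * R ^ (p - 2) * |j * l| ≤
      |(|x| ^ p - |x - j| ^ p + |x - j - l| ^ p - |x - l| ^ p)| := by
  have key : ∀ {x j l : ℝ}, 0 < j → 0 < l → x ∈ Set.Icc (-R) R → x - j - l ∈ Set.Icc (-R) R →
      p * (p - 1) * R ^ (p - 2) * |j * l| ≤
        |(|x| ^ p - |x - j| ^ p + |x - j - l| ^ p - |x - l| ^ p)| := by
    intro x j l hj hl hx hy
    have := second_difference_nonneg (convexOn_abs_rpow_sub_sq hp hp2 hR) hj hl hx hy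
    refine le_trans ?_ (le_abs_self _)
    rw [abs_of_pos (mul_pos hj hl)]
    linarith
  -- In each sign pattern the base point moves to the corner of the parallelogram from which both
  -- steps are positive. Opposite signs of j and l reverse the sign of the second difference.
  rcases lt_or_gt_of_ne hj with hj | hj <;> rcases lt_or_gt_of_ne hl with hl | hl
  · have := key (x := x - j - l) (neg_pos.2 hj) (neg_pos.2 hl) h4 (by
      rw [show x - j - l - -j - -l = x by ring]; exact h1)
    rw [neg_mul_neg] at this
    refine this.trans (le_of_eq ?_)
    rw [show x - j - l - -j = x - l by ring, show x - l - -l = x by ring,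
      show x - j - l - -l = x - j by ring]
    congr 1; ring
  · have := key (x := x - j) (neg_pos.2 hj) hl h2 (by simpa using h3)
    rw [neg_mul, abs_neg] at this
    refine this.trans (le_of_eq ?_)
    rw [show x - j - -j = x by ring, ← abs_neg]
    congr 1; ring
  · have := key (x := x - l) hj (neg_pos.2 hl) h3 (by
      rw [show x - l - j - -l = x - j by ring]; exact h2)
    rw [mul_neg, abs_neg] at this
    refine this.trans (le_of_eq ?_)
    rw [show x - l - j - -l = x - j by ring, show x - l - -l = x by ring, ← abs_neg,
      show x - l - j = x - j - l by ring]
    congr 1; ring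
  · exact key hj hl h1 h4

/-- The resonance function `|k|^{2α} - |k₁|^{2α} + |k₂|^{2α} - |k₃|^{2α}`. -/
def resonance (α : ℝ) (k : ℤ) (p : ℤ × ℤ) : ℝ :=
  symbol α k - symbol α (k - p.1) + symbol α (k - p.1 - p.2) - symbol α (k - p.2)

/-- The radius R = |k| + |j| + |l| is chosen because it bounds all four frequencies in absolute
value. -/
theorem resonance_ge {α : ℝ} (hα : 1 / 2 < α) (hα' : α ≤ 1) {k : ℤ} {p : ℤ × ℤ} (h1 : p.1 ≠ 0)
    (h2 : p.2 ≠ 0) :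
    2 * α * (2 * α - 1) * (|(k : ℝ)| + |(p.1 : ℝ)| + |(p.2 : ℝ)|) ^ (2 * α - 2) *
      |(p.1 : ℝ) * p.2| ≤ |resonance α k p| := by
  have h1' : (p.1 : ℝ) ≠ 0 := by exact_mod_cast h1
  have h2' : (p.2 : ℝ) ≠ 0 := by exact_mod_cast h2
  have hR : 0 < |(k : ℝ)| + |(p.1 : ℝ)| + |(p.2 : ℝ)| := by positivity
  have a1 := abs_le.1 (le_refl |(k : ℝ)|)
  have a2 := abs_le.1 (le_refl |(p.1 : ℝ)|)
  have a3 := abs_le.1 (le_refl |(p.2 : ℝ)|)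
  have := abs_second_difference_ge (p := 2 * α) (x := (k : ℝ)) (by linarith) (by linarith) hR
    ⟨by linarith, by linarith⟩ ⟨by linarith, by linarith⟩ ⟨by linarith, by linarith⟩
    ⟨by linarith, by linarith⟩ h1' h2'
  simpa [resonance, symbol] using this

theorem resonance_ne_zero {α : ℝ} (hα : 1 / 2 < α) (hα' : α ≤ 1) {k : ℤ} {p : ℤ × ℤ}
    (h1 : p.1 ≠ 0) (h2 : p.2 ≠ 0) : resonance α k p ≠ 0 := by
  have h := resonance_ge hα hα' (k := k) h1 h2
  have h1' : (p.1 : ℝ) ≠ 0 := by exact_mod_cast h1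
  have h2' : (p.2 : ℝ) ≠ 0 := by exact_mod_cast h2
  refine abs_pos.1 (lt_of_lt_of_le ?_ h)
  have : 0 < 2 * α - 1 := by linarith
  have : 0 < α := by linarith
  positivity

/-! ### The multipliers of the normal form -/

/-- The multiplier of the nonresonant part of the cubic nonlinearity. -/
def nonres (_ : ℤ) (p : ℤ × ℤ) : ℂ := if p.1 = 0 ∨ p.2 = 0 then 0 else 1

/-- The multiplier of `f ↦ |f̂(k)|² f̂(k)`. -/
def diagRes (_ : ℤ) (p : ℤ × ℤ) : ℂ := if p.1 = 0 ∧ p.2 = 0 then 1 else 0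

/-- The multiplier of the normal form transformation. -/
def normalForm (α : ℝ) (k : ℤ) (p : ℤ × ℤ) : ℂ :=
  if p.1 = 0 ∨ p.2 = 0 then 0 else (resonance α k p : ℂ)⁻¹

theorem bracket_le_sum (k : ℤ) (p : ℤ × ℤ) :
    bracket k ≤ bracket (k - p.1) + bracket (k - p.1 - p.2) + bracket (k - p.2) := by
  have h1 := bracket_le_add_abs_sub k (k - p.1)
  have h2 := abs_le_bracket (k - p.1 - p.2)
  have h3 := abs_le_bracket (k - p.2)
  have h4 : |((k - (k - p.1) : ℤ) : ℝ)| ≤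
      |((k - p.1 - p.2 : ℤ) : ℝ)| + |((k - p.2 : ℤ) : ℝ)| := by
    rw [add_comm]
    refine le_trans (le_of_eq ?_) (abs_sub _ _)
    push_cast; congr 1; ring
  linarith

theorem max_rpow_le_sum {x y z s : ℝ} (hx : 0 < x) (hy : 0 < y) (hz : 0 < z) :
    (max x (max y z)) ^ s ≤ x ^ s + y ^ s + z ^ s := by
  have := Real.rpow_nonneg hx.le s
  have := Real.rpow_nonneg hy.le s
  have := Real.rpow_nonneg hz.le s
  rcases max_choice x (max y z) with h | h <;> rw [h]
  · linarith
  · rcases max_choice y z with h | h <;> rw [h] <;> linarith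

/-- Since k = k₁ - k₂ + k₃, the bracket of k is at most three times the largest of the other
brackets. The kernel term of `Admissible` is not used. -/
theorem admissible_of_norm_le_one {s : ℝ} (hs : 0 ≤ s) (q : ℝ) {m : ℤ → ℤ × ℤ → ℂ}
    (hm : ∀ k p, ‖m k p‖ ≤ 1) : Admissible s s q (3 ^ s) m := by
  intro k p
  have p1 := bracket_pos (k - p.1)
  have p2 := bracket_pos (k - p.1 - p.2)
  have p3 := bracket_pos (k - p.2)
  have p4 := bracket_pos p.1
  have p5 := bracket_pos p.2
  set W := max (bracket (k - p.1)) (max (bracket (k - p.1 - p.2)) (bracket (k - p.2))) with hW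
  have w1 : bracket (k - p.1) ≤ W := le_max_left _ _
  have w2 : bracket (k - p.1 - p.2) ≤ W := (le_max_left _ _).trans (le_max_right _ _)
  have w3 : bracket (k - p.2) ≤ W := (le_max_right _ _).trans (le_max_right _ _)
  have hk : bracket k ≤ 3 * W := by linarith [bracket_le_sum k p]
  calc ‖m k p‖ * bracket k ^ s ≤ 1 * (3 * W) ^ s := by
        gcongr
        · exact Real.rpow_nonneg (bracket_pos k).le s
        · exact hm k p
        · exact (bracket_pos k).le
    _ = 3 ^ s * W ^ s := by rw [one_mul, Real.mul_rpow (by norm_num) (p1.le.trans w1)]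
    _ ≤ 3 ^ s * (bracket (k - p.1) ^ s + bracket (k - p.1 - p.2) ^ s + bracket (k - p.2) ^ s) := by
        gcongr; exact max_rpow_le_sum p1 p2 p3
    _ ≤ _ := mul_le_mul_of_nonneg_left (le_add_of_nonneg_right (by positivity)) (by positivity)

theorem norm_nonres_le_one (k : ℤ) (p : ℤ × ℤ) : ‖nonres k p‖ ≤ 1 := by
  rw [nonres]; split_ifs <;> simp

theorem norm_diagRes_le_one (k : ℤ) (p : ℤ × ℤ) : ‖diagRes k p‖ ≤ 1 := by
  rw [diagRes]; split_ifs <;> simp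

/-- At j = l = 0 all three frequencies equal k, so the kernel term is ⟨k⟩^{s+2q}, and 2q ≥ 1 yields
a gain of one full derivative. -/
theorem admissible_diagRes {r s q : ℝ} (hq : 1 / 2 ≤ q) (hr : r ≤ s + 1) :
    Admissible r s q 1 diagRes := by
  intro k p
  have p1 := bracket_pos (k - p.1)
  have p2 := bracket_pos (k - p.1 - p.2)
  have p3 := bracket_pos (k - p.2)
  have p4 := bracket_pos p.1
  have p5 := bracket_pos p.2
  rw [diagRes]
  split_ifs with h
  · have hb0 : bracket 0 = 1 := by simp [bracket]
    rw [h.1, h.2]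
    simp only [sub_zero, hb0, Real.one_rpow, mul_one, norm_one, one_mul]
    refine le_add_of_nonneg_of_le (by have := bracket_pos k; positivity) ?_
    rw [← Real.rpow_add (bracket_pos k), ← Real.rpow_add (bracket_pos k)]
    exact bracket_rpow_le (by linarith) k
  · simp only [norm_zero, zero_mul]; positivity

-- This is the source of the smoothing. With W the largest of the three input brackets, the lower
-- bound for Φ costs W^{2-2α}/|jl| and the gain of regularity costs W^{2α-1}, so only W/|jl| has to
-- be beaten. Either |jl| is comparable to W, or all three frequencies are comparable and W splits
-- evenly between the second and third factors.
set_option maxHeartbeats 400000 in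
theorem admissible_normalForm {α r s q : ℝ} (hα : 1 / 2 < α) (hα' : α ≤ 1) (hs : 0 ≤ s)
    (hq : 1 / 2 ≤ q) (hr : r ≤ s + (2 * α - 1)) :
    ∃ A, 0 ≤ A ∧ Admissible r s q A (normalForm α) := by
  have hc0 : 0 < 2 * α * (2 * α - 1) := mul_pos (by linarith) (by linarith)
  set c := 2 * α * (2 * α - 1) with hc
  set D := c⁻¹ * (21 * 3 ^ s) with hD
  have hD0 : 0 < D := by positivity
  -- The summand 16 serves the case |jl| ≥ W/16 and the other one serves |jl| < W/16. In D the
  -- factor 21 is 7 · 3, from R ≤ 7W and ⟨k⟩ ≤ 3W, whose exponents 2 - 2α and 2α - 1 are at most 1.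
  refine ⟨D * (16 + 4 * 2 ^ (s + 2 * q)), by positivity, fun k p => ?_⟩
  have p0 := bracket_pos k
  have p1 := bracket_pos (k - p.1)
  have p2 := bracket_pos (k - p.1 - p.2)
  have p3 := bracket_pos (k - p.2)
  have p4 := bracket_pos p.1
  have p5 := bracket_pos p.2
  rw [normalForm]
  split_ifs with h
  · simp only [norm_zero, zero_mul]; positivity
  rw [not_or] at h
  have j1 : (1 : ℝ) ≤ |(p.1 : ℝ)| := by exact_mod_cast Int.one_le_abs h.1
  have l1 : (1 : ℝ) ≤ |(p.2 : ℝ)| := by exact_mod_cast Int.one_le_abs h.2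
  set W := max (bracket (k - p.1)) (max (bracket (k - p.1 - p.2)) (bracket (k - p.2))) with hW
  have w1 : bracket (k - p.1) ≤ W := le_max_left _ _
  have w2 : bracket (k - p.1 - p.2) ≤ W := (le_max_left _ _).trans (le_max_right _ _)
  have w3 : bracket (k - p.2) ≤ W := (le_max_right _ _).trans (le_max_right _ _)
  have hW1 : 1 ≤ W := (one_le_bracket _).trans w1
  have hW0 : 0 < W := by linarith
  have hk : bracket k ≤ 3 * W := by linarith [bracket_le_sum k p]
  have a1 := (abs_le_bracket (k - p.1)).trans w1
  have a2 := (abs_le_bracket (k - p.1 - p.2)).trans w2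
  have a3 := (abs_le_bracket (k - p.2)).trans w3
  push_cast at a1 a2 a3
  have hjW : |(p.1 : ℝ)| ≤ 2 * W := by
    rw [abs_le] at *; constructor <;> linarith [a2.1, a2.2, a3.1, a3.2]
  have hlW : |(p.2 : ℝ)| ≤ 2 * W := by
    rw [abs_le] at *; constructor <;> linarith [a1.1, a1.2, a2.1, a2.2]
  have hkW : |(k : ℝ)| ≤ 3 * W := (abs_le_bracket k).trans hk
  set R := |(k : ℝ)| + |(p.1 : ℝ)| + |(p.2 : ℝ)| with hRdef
  have hR0 : 0 < R := by positivity
  have hRW : R ≤ 7 * W := by linarith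
  have hjl : 0 < |(p.1 : ℝ) * p.2| := by rw [abs_mul]; positivity
  have hΦ := resonance_ge hα hα' (k := k) h.1 h.2
  have hΦ0 : 0 < c * R ^ (2 * α - 2) * |(p.1 : ℝ) * p.2| := by positivity
  -- The powers combine because (2 - 2α) + (2α - 1) = 1.
  have main : ‖((resonance α k p : ℂ))⁻¹‖ * bracket k ^ r ≤
      D * (W ^ s * W) / |(p.1 : ℝ) * p.2| := by
    rw [norm_inv, Complex.norm_real, Real.norm_eq_abs]
    have e1 : bracket k ^ r ≤ (3 ^ s * W ^ s) * (3 * W ^ (2 * α - 1)) := by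
      calc bracket k ^ r ≤ bracket k ^ (s + (2 * α - 1)) := bracket_rpow_le hr k
        _ = bracket k ^ s * bracket k ^ (2 * α - 1) := Real.rpow_add p0 _ _
        _ ≤ (3 * W) ^ s * (3 * W) ^ (2 * α - 1) := by
            have := Real.rpow_le_rpow p0.le hk hs
            have := Real.rpow_le_rpow p0.le hk (z := 2 * α - 1) (by linarith)
            gcongr
        _ = (3 ^ s * W ^ s) * (3 ^ (2 * α - 1) * W ^ (2 * α - 1)) := by
            rw [Real.mul_rpow (by norm_num) hW0.le, Real.mul_rpow (by norm_num) hW0.le]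
        _ ≤ _ := by
            gcongr
            calc (3 : ℝ) ^ (2 * α - 1) ≤ 3 ^ (1 : ℝ) :=
                  Real.rpow_le_rpow_of_exponent_le (by norm_num) (by linarith)
              _ = 3 := Real.rpow_one 3
    have e2 : (R ^ (2 * α - 2))⁻¹ ≤ 7 * W ^ (2 - 2 * α) := by
      calc (R ^ (2 * α - 2))⁻¹ = R ^ (2 - 2 * α) := by
            rw [← Real.rpow_neg hR0.le]; congr 1; ring
        _ ≤ (7 * W) ^ (2 - 2 * α) := Real.rpow_le_rpow hR0.le hRW (by linarith)
        _ = 7 ^ (2 - 2 * α) * W ^ (2 - 2 * α) := Real.mul_rpow (by norm_num) hW0.le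
        _ ≤ _ := by
            gcongr
            calc (7 : ℝ) ^ (2 - 2 * α) ≤ 7 ^ (1 : ℝ) :=
                  Real.rpow_le_rpow_of_exponent_le (by norm_num) (by linarith)
              _ = 7 := Real.rpow_one 7
    have e3 : W ^ (2 - 2 * α) * W ^ (2 * α - 1) = W := by
      rw [← Real.rpow_add hW0]
      conv_rhs => rw [← Real.rpow_one W]
      congr 1; ring
    calc |resonance α k p|⁻¹ * bracket k ^ r
        ≤ (c * R ^ (2 * α - 2) * |(p.1 : ℝ) * p.2|)⁻¹ *
          ((3 ^ s * W ^ s) * (3 * W ^ (2 * α - 1))) := by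
          gcongr
      _ = c⁻¹ * (R ^ (2 * α - 2))⁻¹ * |(p.1 : ℝ) * p.2|⁻¹ *
          ((3 ^ s * W ^ s) * (3 * W ^ (2 * α - 1))) := by rw [mul_inv, mul_inv]
      _ ≤ c⁻¹ * (7 * W ^ (2 - 2 * α)) * |(p.1 : ℝ) * p.2|⁻¹ *
          ((3 ^ s * W ^ s) * (3 * W ^ (2 * α - 1))) := by gcongr
      _ = c⁻¹ * (21 * 3 ^ s) * (W ^ s * (W ^ (2 - 2 * α) * W ^ (2 * α - 1))) /
          |(p.1 : ℝ) * p.2| := by ring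
      _ = _ := by rw [e3]
  refine main.trans ?_
  have hsum := max_rpow_le_sum (s := s) p1 p2 p3
  rw [← hW] at hsum
  rcases le_or_gt (W / 16) |(p.1 : ℝ) * p.2| with hcase | hcase
  · calc D * (W ^ s * W) / |(p.1 : ℝ) * p.2| ≤ D * (W ^ s * W) / (W / 16) := by gcongr
      _ = D * 16 * W ^ s := by field_simp
      _ ≤ D * (16 + 4 * 2 ^ (s + 2 * q)) * (bracket (k - p.1) ^ s + bracket (k - p.1 - p.2) ^ s +
          bracket (k - p.2) ^ s) := by
          gcongr
          exact le_add_of_nonneg_right (by positivity)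
      _ ≤ _ := mul_le_mul_of_nonneg_left (le_add_of_nonneg_right (by positivity)) (by positivity)
  -- Since |j|, |l| ≥ 1, a small product makes both small. Any two input frequencies then differ by
  -- at most W/8, so every bracket is at least W/2, and q ≥ 1/2 lets ⟨k₂⟩^q and ⟨k₃⟩^q each absorb
  -- W^{1/2}.
  · have hj' : |(p.1 : ℝ)| < W / 16 := by
      rw [abs_mul] at hcase; nlinarith
    have hl' : |(p.2 : ℝ)| < W / 16 := by
      rw [abs_mul] at hcase; nlinarith
    have d12 := bracket_le_add_abs_sub (k - p.1) (k - p.1 - p.2)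
    have d21 := bracket_le_add_abs_sub (k - p.1 - p.2) (k - p.1)
    have d23 := bracket_le_add_abs_sub (k - p.1 - p.2) (k - p.2)
    have d32 := bracket_le_add_abs_sub (k - p.2) (k - p.1 - p.2)
    rw [show k - p.1 - (k - p.1 - p.2) = p.2 by ring] at d12
    rw [show k - p.1 - p.2 - (k - p.1) = -p.2 by ring, Int.cast_neg, abs_neg] at d21
    rw [show k - p.1 - p.2 - (k - p.2) = -p.1 by ring, Int.cast_neg, abs_neg] at d23
    rw [show k - p.2 - (k - p.1 - p.2) = p.1 by ring] at d32
    have hWle : W ≤ bracket (k - p.1) + W / 8 ∧ W ≤ bracket (k - p.1 - p.2) + W / 8 ∧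
        W ≤ bracket (k - p.2) + W / 8 := by
      refine ⟨?_, ?_, ?_⟩
      · nth_rewrite 1 [hW]
        refine max_le ?_ (max_le ?_ ?_) <;> linarith
      · nth_rewrite 1 [hW]
        refine max_le ?_ (max_le ?_ ?_) <;> linarith
      · nth_rewrite 1 [hW]
        refine max_le ?_ (max_le ?_ ?_) <;> linarith
    obtain ⟨v1, v2, v3⟩ := hWle
    have u1 : W ≤ 2 * bracket (k - p.1) := by linarith
    have u2 : W ≤ 2 * bracket (k - p.1 - p.2) := by linarith
    have u3 : W ≤ 2 * bracket (k - p.2) := by linarith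
    have f1 : W ^ s ≤ 2 ^ s * bracket (k - p.1) ^ s := by
      rw [← Real.mul_rpow (by norm_num) p1.le]; exact Real.rpow_le_rpow hW0.le u1 hs
    have f2 : W ^ (1 / 2 : ℝ) ≤ 2 ^ q * bracket (k - p.1 - p.2) ^ q := by
      rw [← Real.mul_rpow (by norm_num) p2.le]
      exact (Real.rpow_le_rpow_of_exponent_le hW1 hq).trans
        (Real.rpow_le_rpow hW0.le u2 (by linarith))
    have f3 : W ^ (1 / 2 : ℝ) ≤ 2 ^ q * bracket (k - p.2) ^ q := by
      rw [← Real.mul_rpow (by norm_num) p3.le]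
      exact (Real.rpow_le_rpow_of_exponent_le hW1 hq).trans
        (Real.rpow_le_rpow hW0.le u3 (by linarith))
    have f4 : W = W ^ (1 / 2 : ℝ) * W ^ (1 / 2 : ℝ) := by
      rw [← Real.rpow_add hW0]; norm_num
    have f5 : (2 : ℝ) ^ s * 2 ^ q * 2 ^ q = 2 ^ (s + 2 * q) := by
      rw [← Real.rpow_add two_pos, ← Real.rpow_add two_pos, add_assoc, two_mul]
    have g1 : |(p.1 : ℝ)|⁻¹ ≤ 2 * bracket p.1 ^ (-1 : ℝ) := by
      rw [Real.rpow_neg_one, ← div_eq_mul_inv, inv_eq_one_div, div_le_div_iff₀ (by linarith) p4]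
      linarith [bracket_le_one_add_abs p.1]
    have g2 : |(p.2 : ℝ)|⁻¹ ≤ 2 * bracket p.2 ^ (-1 : ℝ) := by
      rw [Real.rpow_neg_one, ← div_eq_mul_inv, inv_eq_one_div, div_le_div_iff₀ (by linarith) p5]
      linarith [bracket_le_one_add_abs p.2]
    calc D * (W ^ s * W) / |(p.1 : ℝ) * p.2|
        = D * (W ^ s * (W ^ (1 / 2 : ℝ) * W ^ (1 / 2 : ℝ))) * (|(p.1 : ℝ)|⁻¹ * |(p.2 : ℝ)|⁻¹) := by
          rw [← f4, abs_mul, div_eq_mul_inv, mul_inv]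
      _ ≤ D * ((2 ^ s * bracket (k - p.1) ^ s) * ((2 ^ q * bracket (k - p.1 - p.2) ^ q) *
          (2 ^ q * bracket (k - p.2) ^ q))) *
          ((2 * bracket p.1 ^ (-1 : ℝ)) * (2 * bracket p.2 ^ (-1 : ℝ))) := by
          gcongr
      _ = D * (4 * (2 ^ s * 2 ^ q * 2 ^ q)) * (bracket (k - p.1) ^ s *
          bracket (k - p.1 - p.2) ^ q * bracket (k - p.2) ^ q *
          (bracket p.1 ^ (-1 : ℝ) * bracket p.2 ^ (-1 : ℝ))) := by ring
      _ = D * (4 * 2 ^ (s + 2 * q)) * (bracket (k - p.1) ^ s *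
          bracket (k - p.1 - p.2) ^ q * bracket (k - p.2) ^ q *
          (bracket p.1 ^ (-1 : ℝ) * bracket p.2 ^ (-1 : ℝ))) := by
          rw [f5]
      _ ≤ D * (16 + 4 * 2 ^ (s + 2 * q)) * (bracket (k - p.1) ^ s *
          bracket (k - p.1 - p.2) ^ q * bracket (k - p.2) ^ q *
          (bracket p.1 ^ (-1 : ℝ) * bracket p.2 ^ (-1 : ℝ))) := by
          gcongr
          linarith
      _ ≤ _ := mul_le_mul_of_nonneg_left (le_add_of_nonneg_left (by positivity)) (by positivity)

/-! ### Sobolev norms and coefficient sequences -/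

theorem coeff_eq_repr (f : L2) (k : ℤ) : coeff f k = fourierBasis.repr f k :=
  (fourierBasis_repr f k).symm

theorem coeff_sub (f g : L2) : coeff (f - g) = coeff f - coeff g := by
  ext k; simp [coeff_eq_repr]

theorem coeff_smul (z : ℂ) (f : L2) : coeff (z • f) = z • coeff f := by
  ext k; simp [coeff_eq_repr]

theorem weight_sq (s : ℝ) (k : ℤ) (z : ℂ) :
    (ENNReal.ofReal (bracket k ^ s) * ‖z‖ₑ) ^ 2 =
      ENNReal.ofReal (bracket k ^ (2 * s) * ‖z‖ ^ 2) := by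
  rw [← ofReal_norm, ← ENNReal.ofReal_mul (bracket_rpow_pos k s).le,
    ← ENNReal.ofReal_pow (mul_nonneg (bracket_rpow_pos k s).le (norm_nonneg _)), mul_pow,
    ← Real.rpow_mul_natCast (bracket_pos k).le]
  congr 3; push_cast; ring

theorem wnorm_sq (s : ℝ) (c : ℤ → ℂ) :
    wnorm s c ^ 2 = ∑' k, ENNReal.ofReal (bracket k ^ (2 * s) * ‖c k‖ ^ 2) := by
  simp only [wnorm, l2e_sq, weight_sq]

theorem weight_nonneg (s : ℝ) (k : ℤ) (z : ℂ) : 0 ≤ bracket k ^ (2 * s) * ‖z‖ ^ 2 :=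
  mul_nonneg (bracket_rpow_pos k _).le (by positivity)

theorem summable_iff_wnorm_lt_top (s : ℝ) (c : ℤ → ℂ) :
    (Summable fun k : ℤ => bracket k ^ (2 * s) * ‖c k‖ ^ 2) ↔ wnorm s c < ∞ := by
  have h : wnorm s c < ∞ ↔ wnorm s c ^ 2 < ∞ := by
    rw [ENNReal.pow_lt_top_iff]; simp
  rw [h, wnorm_sq, lt_top_iff_ne_top]
  constructor
  · exact fun h => h.tsum_ofReal_ne_top
  · intro h
    have := ENNReal.summable_toReal h
    refine this.congr fun k => ?_
    rw [ENNReal.toReal_ofReal (weight_nonneg s k _)]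

theorem memSobolev_iff (s : ℝ) (f : L2) : MemSobolev s f ↔ wnorm s (coeff f) < ∞ :=
  summable_iff_wnorm_lt_top s (coeff f)

theorem sqrt_tsum_eq_wnorm (s : ℝ) (c : ℤ → ℂ) :
    Real.sqrt (∑' k : ℤ, bracket k ^ (2 * s) * ‖c k‖ ^ 2) = (wnorm s c).toReal := by
  have h := congrArg ENNReal.toReal (wnorm_sq s c)
  rw [ENNReal.tsum_toReal_eq fun _ => ENNReal.ofReal_ne_top, ENNReal.toReal_pow] at h
  simp only [ENNReal.toReal_ofReal (weight_nonneg s _ _)] at h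
  rw [← h, Real.sqrt_sq ENNReal.toReal_nonneg]

theorem sobolevNorm_eq (s : ℝ) (f : L2) : sobolevNorm s f = (wnorm s (coeff f)).toReal :=
  sqrt_tsum_eq_wnorm s (coeff f)

/-- Parseval holds for the normalized measure, while P is defined with dx. The ratio 2π against the
prefactor 1/π leaves 2, which is the multiplicity of the resonant terms in `cubicSeq_eq`. -/
theorem phase_eq (f : L2) : phase f = 2 * ∑' k, ‖coeff f k‖ ^ 2 := by
  have h := tsum_sq_fourierCoeff f
  rw [AddCircle.integral_haarAddCircle] at h
  have e : ∑' k, ‖coeff f k‖ ^ 2 = (2 * Real.pi)⁻¹ • ∫ t : Torus, ‖f t‖ ^ 2 := h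
  rw [e, phase, smul_eq_mul, mul_inv]
  have := Real.pi_pos.ne'
  field_simp

/-- The function with given square-summable Fourier coefficients. -/
def ofCoeff (c : ℤ → ℂ) : L2 :=
  open Classical in if h : Memℓp c 2 then fourierBasis.repr.symm ⟨c, h⟩ else 0

theorem memℓp_of_wnorm {c : ℤ → ℂ} (h : wnorm 0 c < ∞) : Memℓp c 2 := by
  rw [memℓp_gen_iff (by norm_num)]
  have := (summable_iff_wnorm_lt_top 0 c).2 h
  simpa using this

theorem coeff_ofCoeff {c : ℤ → ℂ} (h : wnorm 0 c < ∞) : coeff (ofCoeff c) = c := by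
  ext k
  rw [ofCoeff, dif_pos (memℓp_of_wnorm h), coeff_eq_repr, LinearIsometryEquiv.apply_symm_apply]

/-! ### The Fourier coefficients of the cubic nonlinearity -/

theorem tsum_enorm_le (s : ℝ) (c : ℤ → ℂ) : ∑' k, ‖c k‖ₑ ≤ bracketConst s * wnorm s c := by
  refine le_trans (le_of_eq ?_) (tsum_mul_le_l2e _ _)
  congr 1; ext k
  rw [← mul_assoc]
  have := ebr_neg_mul s k
  rw [ebr, ebr] at this
  rw [this, one_mul]

theorem summable_norm_of_wnorm {s : ℝ} (hs : 1 / 2 < s) {c : ℤ → ℂ} (h : wnorm s c < ∞) :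
    Summable fun k => ‖c k‖ := by
  rw [← tsum_enorm_ne_top_iff_summable_norm]
  exact ((tsum_enorm_le s c).trans_lt (ENNReal.mul_lt_top (bracketConst_lt_top hs) h)).ne

/-- The Fourier coefficient as a functional on continuous functions. -/
def coeffCLM (k : ℤ) : C(Torus, ℂ) →L[ℂ] ℂ :=
  (lp.evalCLM ℂ (fun _ : ℤ => ℂ) 2 k).comp
    ((fourierBasis (T := 2 * Real.pi)).repr.toContinuousLinearEquiv.toContinuousLinearMap.comp
      (ContinuousMap.toLp 2 haarAddCircle ℂ))

theorem coeffCLM_apply (k : ℤ) (g : C(Torus, ℂ)) : coeffCLM k g = fourierCoeff g k := by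
  have : coeffCLM k g = fourierBasis.repr (ContinuousMap.toLp 2 haarAddCircle ℂ g) k := rfl
  rw [this, fourierBasis_repr, fourierCoeff_toLp]

theorem coeffCLM_fourier (k n : ℤ) : coeffCLM k (fourier n) = if n = k then 1 else 0 := by
  have : coeffCLM k (fourier n) = fourierBasis.repr (fourierLp 2 n) k := rfl
  rw [this, ← coe_fourierBasis, HilbertBasis.repr_self, lp.single_apply]
  by_cases h : n = k
  · subst h; simp
  · rw [Pi.single_eq_of_ne (Ne.symm h), if_neg h]

theorem hasSum_mul_star_mul {A : Type*} [NormedRing A] [CompleteSpace A] [StarRing A]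
    [NormedStarGroup A] {F : ℤ → A} {g : A}
    (hF : Summable fun k => ‖F k‖) (hg : HasSum F g) :
    HasSum (fun x : ℤ × (ℤ × ℤ) => F x.1 * (star (F x.2.1) * F x.2.2)) (g * (star g * g)) := by
  have hF' : Summable fun k => ‖star (F k)‖ := by
    simpa only [norm_star] using hF
  have h0 : HasSum (fun k => star (F k)) (star g) := hg.star
  have h2 : Summable fun x : ℤ × ℤ => star (F x.1) * F x.2 := summable_mul_of_summable_norm hF' hF
  have h1 : HasSum (fun x : ℤ × ℤ => star (F x.1) * F x.2) (star g * g) := h0.mul hg h2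
  have h3 : Summable fun x : ℤ × ℤ => ‖star (F x.1) * F x.2‖ := hF'.mul_norm hF
  have h4 : Summable fun x : ℤ × (ℤ × ℤ) => F x.1 * (star (F x.2.1) * F x.2.2) :=
    summable_mul_of_summable_norm (f := F) (g := fun x : ℤ × ℤ => star (F x.1) * F x.2)
      hF h3
  exact HasSum.mul (f := F) (g := fun x : ℤ × ℤ => star (F x.1) * F x.2) hg h1 h4

theorem smul_fourier_mul_star_mul (c : ℤ → ℂ) (k : ℤ) (p : ℤ × ℤ) :
    c (k - p.1) • (fourier (k - p.1) : C(Torus, ℂ)) *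
      (star (c (k - p.1 - p.2) • (fourier (k - p.1 - p.2) : C(Torus, ℂ))) *
        (c (k - p.2) • (fourier (k - p.2) : C(Torus, ℂ)))) =
      triTerm (fun _ _ => 1) c c c k p • (fourier k : C(Torus, ℂ)) := by
  ext x
  have e1 : fourier k x = fourier (k - p.1) x *
      (conj (fourier (k - p.1 - p.2) x) * fourier (k - p.2) x) := by
    rw [← fourier_neg, ← fourier_add, ← fourier_add,
      show k - p.1 + (-(k - p.1 - p.2) + (k - p.2)) = k by ring]
  simp only [ContinuousMap.mul_apply, ContinuousMap.smul_apply, ContinuousMap.star_apply,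
    smul_eq_mul, e1, star_mul', RCLike.star_def, triTerm]
  ring

/-- The product of absolutely convergent series converges in C(𝕋), so the continuous functional
`coeffCLM` may be applied term by term. After reindexing by output frequency, orthogonality keeps
only one slice. -/
theorem fourierCoeff_cubic {c : ℤ → ℂ} (hc : Summable fun k => ‖c k‖) {g : C(Torus, ℂ)}
    (hg : HasSum (fun k => c k • (fourier k : C(Torus, ℂ))) g) (k : ℤ) :
    fourierCoeff (g * (star g * g) : C(Torus, ℂ)) k = tri (fun _ _ => 1) c c c k := by
  have hn : Summable fun k => ‖c k • (fourier k : C(Torus, ℂ))‖ := by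
    simpa [norm_smul, fourier_norm] using hc
  have h3 := (coeffCLM k).hasSum (hasSum_mul_star_mul hn hg)
  rw [coeffCLM_apply, ← freqEquiv.hasSum_iff] at h3
  have hinj : Function.Injective fun p : ℤ × ℤ => (k, p) := fun p p' h => (Prod.mk.inj h).2
  have h4 : HasSum (fun x : ℤ × (ℤ × ℤ) =>
      if x.1 = k then triTerm (fun _ _ => 1) c c c k x.2 else 0)
      (fourierCoeff (g * (star g * g) : C(Torus, ℂ)) k) := by
    refine h3.congr_fun fun x => ?_
    have e := smul_fourier_mul_star_mul c x.1 x.2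
    refine Eq.trans ?_ (congrArg (coeffCLM k) e).symm
    rw [map_smul, coeffCLM_fourier]
    split_ifs with h
    · rw [h, smul_eq_mul, mul_one]
    · rw [smul_zero]
  rw [← hinj.hasSum_iff] at h4
  · rw [tri, ← h4.tsum_eq]
    congr 1; ext p; simp
  · intro x hx
    rw [if_neg]
    rintro rfl
    exact hx ⟨x.2, rfl⟩

/-- For s > 1/2 the coefficients are absolutely summable, so f agrees almost everywhere with the
continuous sum g of its Fourier series. The cubic term can then be computed from g. -/
theorem cubicCoeff_eq {s : ℝ} (hs : 1 / 2 < s) {f : L2} (hf : wnorm s (coeff f) < ∞) :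
    cubicCoeff f = tri (fun _ _ => 1) (coeff f) (coeff f) (coeff f) := by
  have hc := summable_norm_of_wnorm hs hf
  have hn : Summable fun k => coeff f k • (fourier k : C(Torus, ℂ)) :=
    Summable.of_norm (by simpa [norm_smul, fourier_norm] using hc)
  obtain ⟨g, hg⟩ := hn
  have h1 := (ContinuousMap.toLp (E := ℂ) 2 (haarAddCircle : Measure Torus) ℂ).hasSum hg
  have h2 : ContinuousMap.toLp (E := ℂ) 2 (haarAddCircle : Measure Torus) ℂ g = f := by
    refine h1.unique ?_
    have := hasSum_fourier_series_L2 f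
    convert this using 1
    ext k
    simp only [map_smul]
    rfl
  have h3 : (f : Torus → ℂ) =ᵐ[haarAddCircle] g := by
    have := ContinuousMap.coeFn_toLp (p := 2) (𝕜 := ℂ) (haarAddCircle : Measure Torus) g
    rw [h2] at this
    exact this
  ext k
  rw [← fourierCoeff_cubic hc hg k, cubicCoeff]
  refine congrFun (fourierCoeff_congr_ae ?_) k
  filter_upwards [h3] with x hx
  rw [hx]
  simp only [ContinuousMap.mul_apply, ContinuousMap.star_apply, RCLike.star_def]
  rw [Complex.conj_mul', mul_comm]
  push_cast; rfl

/-! ### Summation and integration in time -/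

/-- Each term satisfies the fundamental theorem of calculus, and sum and integral are exchanged by
Fubini. The uniform bound on the sum of absolute derivatives supplies integrability, so the sum
itself need not be differentiated. -/
theorem tsum_sub_tsum_eq_integral {ι : Type*} [Countable ι] {f f' : ι → ℝ → ℂ} {a b : ℝ}
    (hd : ∀ i, ∀ t ∈ Set.uIcc a b, HasDerivAt (f i) (f' i t) t)
    (hc : ∀ i, ContinuousOn (f' i) (Set.uIcc a b)) {C : ℝ≥0∞} (hC : C < ∞)
    (hbd : ∀ t ∈ Set.uIcc a b, ∑' i, ‖f' i t‖ₑ ≤ C)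
    (ha : Summable fun i => f i a) (hb : Summable fun i => f i b) :
    ∑' i, f i b - ∑' i, f i a = ∫ t in a..b, ∑' i, f' i t := by
  have h1 : ∀ i, f i b - f i a = ∫ t in a..b, f' i t := fun i =>
    (intervalIntegral.integral_eq_sub_of_hasDerivAt (hd i) (hc i).intervalIntegrable).symm
  rw [← hb.tsum_sub ha]
  simp only [h1, intervalIntegral.intervalIntegral_eq_integral_uIoc]
  have hm : ∀ i, AEStronglyMeasurable (f' i) (volume.restrict (Set.uIoc a b)) := fun i =>
    (((hc i).mono Set.uIoc_subset_uIcc).aestronglyMeasurable measurableSet_uIoc)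
  rw [tsum_const_smul'', integral_tsum hm]
  rw [← lintegral_tsum fun i => (hm i).enorm]
  refine ((setLIntegral_mono' measurableSet_uIoc fun t ht =>
    hbd t (Set.uIoc_subset_uIcc ht)).trans_lt ?_).ne
  rw [setLIntegral_const]
  refine ENNReal.mul_lt_top hC ?_
  rw [Set.uIoc, Real.volume_Ioc]
  exact ENNReal.ofReal_lt_top

/-- Superadditivity of the lower integral needs no measurability. -/
theorem sum_lintegral_le_lintegral_sum {α ι : Type*} [MeasurableSpace α] (μ : Measure α)
    (S : Finset ι) (f : ι → α → ℝ≥0∞) :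
    ∑ i ∈ S, ∫⁻ t, f i t ∂μ ≤ ∫⁻ t, ∑ i ∈ S, f i t ∂μ := by
  classical
  induction S using Finset.induction_on with
  | empty => simp
  | insert i S hi ih =>
    simp only [Finset.sum_insert hi]
    exact (add_le_add_right ih _).trans (le_lintegral_add _ _)

/-- Minkowski's inequality by duality. With x the sequence of integrals and X its ℓ² norm, pair x
with the integrals and apply Cauchy-Schwarz under the integral to get X² ≤ X Y. Only the directions
of linearity valid for arbitrary functions are used, hence no measurability assumption. -/
theorem l2e_lintegral_le {α ι : Type*} [MeasurableSpace α] (μ : Measure α)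
    (f : ι → α → ℝ≥0∞) :
    l2e (fun i => ∫⁻ t, f i t ∂μ) ≤ ∫⁻ t, l2e (fun i => f i t) ∂μ := by
  set Y := ∫⁻ t, l2e (fun i => f i t) ∂μ with hY
  rcases eq_or_ne Y ∞ with hY' | hY'
  · rw [hY']; exact le_top
  have hx : ∀ i, ∫⁻ t, f i t ∂μ ≤ Y := fun i => lintegral_mono fun t => le_l2e (fun i => f i t) i
  rw [l2e_le_iff, ENNReal.tsum_eq_iSup_sum]
  -- On a finite index set X is finite, so it can be cancelled in X² ≤ X Y.
  refine iSup_le fun S => ?_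
  let x : ι → ℝ≥0∞ := fun i => ∫⁻ t, f i t ∂μ
  let X : ℝ≥0∞ := l2e (fun i : S => x i)
  have hX2 : X ^ 2 = ∑ i ∈ S, x i ^ 2 := by
    rw [l2e_sq, tsum_fintype, Finset.sum_coe_sort S fun i => x i ^ 2]
  have hXt : X ≠ ∞ := by
    have : X ^ 2 < ∞ := by
      rw [hX2]
      exact ENNReal.sum_lt_top.2 fun i _ => ENNReal.pow_lt_top ((hx i).trans_lt hY'.lt_top)
    intro h
    simp [h] at this
  have hmain : X ^ 2 ≤ X * Y := by
    calc X ^ 2 = ∑ i ∈ S, x i * ∫⁻ t, f i t ∂μ := by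
          rw [hX2]; exact Finset.sum_congr rfl fun i _ => sq _
      _ ≤ ∑ i ∈ S, ∫⁻ t, x i * f i t ∂μ :=
          Finset.sum_le_sum fun i _ => lintegral_const_mul_le _ _
      _ ≤ ∫⁻ t, ∑ i ∈ S, x i * f i t ∂μ := sum_lintegral_le_lintegral_sum μ S _
      _ ≤ ∫⁻ t, X * l2e (fun i => f i t) ∂μ := by
          refine lintegral_mono fun t => ?_
          change ∑ i ∈ S, x i * f i t ≤ X * l2e (fun i => f i t)
          rw [← Finset.sum_coe_sort S fun i => x i * f i t, ← tsum_fintype (L := .unconditional _)]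
          refine (tsum_mul_le_l2e _ _).trans (mul_le_mul_right ?_ _)
          rw [l2e_le_iff, l2e_sq]
          exact ENNReal.tsum_comp_le_tsum_of_injective Subtype.val_injective (fun i => f i t ^ 2)
      _ = X * Y := lintegral_const_mul' _ _ hXt
  have : X ≤ Y := by
    rcases eq_or_ne X 0 with h0 | h0
    · rw [h0]; exact zero_le
    · rw [sq] at hmain
      exact (ENNReal.mul_le_mul_iff_right h0 hXt).1 hmain
  rw [← hX2]
  exact pow_le_pow_left' this 2

/-- Minkowski's inequality for the `H^r` norm of a time integral. -/
theorem wnorm_integral_le {r : ℝ} {F : ℝ → ℤ → ℂ} {G : ℝ → ℝ} {a b : ℝ}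
    (hG : ContinuousOn G (Set.uIcc a b)) (hG0 : ∀ t ∈ Set.uIcc a b, 0 ≤ G t)
    (h : ∀ t ∈ Set.uIcc a b, wnorm r (F t) ≤ ENNReal.ofReal (G t)) :
    wnorm r (fun k => ∫ t in a..b, F t k) ≤ ENNReal.ofReal |∫ t in a..b, G t| := by
  have h1 : ∀ k, ENNReal.ofReal (bracket k ^ r) * ‖∫ t in a..b, F t k‖ₑ ≤
      ∫⁻ t in Set.uIoc a b, ENNReal.ofReal (bracket k ^ r) * ‖F t k‖ₑ := fun k => by
    rw [lintegral_const_mul' _ _ ENNReal.ofReal_ne_top]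
    refine mul_le_mul_right ?_ _
    rw [← ofReal_norm, intervalIntegral.norm_intervalIntegral_eq, ofReal_norm]
    exact enorm_integral_le_lintegral_enorm _
  refine (l2e_mono h1).trans ((l2e_lintegral_le _ _).trans ?_)
  refine (setLIntegral_mono' measurableSet_uIoc fun t ht =>
    h t (Set.uIoc_subset_uIcc ht)).trans (le_of_eq ?_)
  have hGi : IntegrableOn G (Set.uIoc a b) :=
    (intervalIntegrable_iff.1 hG.intervalIntegrable)
  rw [← ofReal_integral_eq_lintegral_ofReal hGi]
  · congr 1
    rw [intervalIntegral.abs_intervalIntegral_eq, abs_of_nonneg]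
    exact setIntegral_nonneg measurableSet_uIoc fun t ht => hG0 t (Set.uIoc_subset_uIcc ht)
  · exact (ae_restrict_iff' measurableSet_uIoc).2 (Eventually.of_forall fun t ht =>
      hG0 t (Set.uIoc_subset_uIcc ht))

/-! ### Continuity in `H^r` -/

/-- Continuity in `H^r` of a family of coefficient sequences. -/
def WCont (r : ℝ) (I : Set ℝ) (c : ℝ → ℤ → ℂ) : Prop :=
  (∀ t ∈ I, wnorm r (c t) < ∞) ∧
    ∀ t₀ ∈ I, Tendsto (fun t => wnorm r (c t - c t₀)) (𝓝[I] t₀) (𝓝 0)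

/-- The real-valued norm takes a junk value when the sum diverges. The first clause of either
definition excludes this on I, so the two notions of convergence agree. -/
theorem continuousInSobolev_iff {s : ℝ} {I : Set ℝ} {u : ℝ → L2} :
    ContinuousInSobolev s I u ↔ WCont s I (fun t => coeff (u t)) := by
  unfold ContinuousInSobolev WCont
  simp only [memSobolev_iff, sobolevNorm_eq, coeff_sub]
  refine and_congr_right fun hfin => forall₂_congr fun t₀ ht₀ => ?_
  have hne : ∀ᶠ t in 𝓝[I] t₀, wnorm s (coeff (u t) - coeff (u t₀)) ≠ ∞ := by
    filter_upwards [self_mem_nhdsWithin] with t ht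
    exact (wnorm_sub_lt_top (hfin t ht) (hfin t₀ ht₀)).ne
  constructor
  · intro h
    have := ENNReal.tendsto_ofReal h
    rw [ENNReal.ofReal_zero] at this
    refine this.congr' ?_
    filter_upwards [hne] with t ht
    exact ENNReal.ofReal_toReal ht
  · intro h
    exact (ENNReal.tendsto_toReal ENNReal.zero_ne_top).comp h

namespace WCont

variable {r s : ℝ} {I J : Set ℝ} {c d : ℝ → ℤ → ℂ}

theorem tendsto_of_le {l : Filter ℝ} {f g : ℝ → ℝ≥0∞} (hg : Tendsto g l (𝓝 0))
    (h : ∀ᶠ t in l, f t ≤ g t) : Tendsto f l (𝓝 0) :=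
  tendsto_of_tendsto_of_tendsto_of_le_of_le' tendsto_const_nhds hg
    (Eventually.of_forall fun _ => zero_le) h

theorem mono_exp (h : r ≤ s) (hc : WCont s I c) : WCont r I c :=
  ⟨fun t ht => (wnorm_mono_exp h _).trans_lt (hc.1 t ht), fun t₀ ht₀ =>
    tendsto_of_le (hc.2 t₀ ht₀) (Eventually.of_forall fun _ => wnorm_mono_exp h _)⟩

theorem congr (hc : WCont s I c) (h : ∀ t ∈ I, d t = c t) : WCont s I d :=
  ⟨fun t ht => h t ht ▸ hc.1 t ht, fun t₀ ht₀ => by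
    refine (hc.2 t₀ ht₀).congr' ?_
    filter_upwards [self_mem_nhdsWithin] with t ht
    rw [h t ht, h t₀ ht₀]⟩

theorem const {e : ℤ → ℂ} (he : wnorm s e < ∞) : WCont s I (fun _ => e) :=
  ⟨fun _ _ => he, fun t₀ _ => by simpa using tendsto_const_nhds⟩

theorem add (hc : WCont s I c) (hd : WCont s I d) : WCont s I (fun t => c t + d t) :=
  ⟨fun t ht => (wnorm_add_le _ _ _).trans_lt (ENNReal.add_lt_top.2 ⟨hc.1 t ht, hd.1 t ht⟩),
    fun t₀ ht₀ => by
      have h := (hc.2 t₀ ht₀).add (hd.2 t₀ ht₀)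
      rw [add_zero] at h
      refine tendsto_of_le h (Eventually.of_forall fun t => ?_)
      rw [add_sub_add_comm]
      exact wnorm_add_le _ _ _⟩

theorem smul (z : ℂ) (hc : WCont s I c) : WCont s I (fun t => z • c t) :=
  ⟨fun t ht => by
    rw [wnorm_smul]; exact ENNReal.mul_lt_top enorm_lt_top (hc.1 t ht),
    fun t₀ ht₀ => by
      have h := ENNReal.Tendsto.const_mul (a := ‖z‖ₑ) (hc.2 t₀ ht₀) (Or.inr enorm_ne_top)
      rw [mul_zero] at h
      refine h.congr fun t => ?_
      rw [← smul_sub, wnorm_smul]⟩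

theorem sub (hc : WCont s I c) (hd : WCont s I d) : WCont s I (fun t => c t - d t) := by
  refine (hc.add (hd.smul (-1))).congr fun t _ => ?_
  rw [neg_one_smul, sub_eq_add_neg]

theorem norm (hc : WCont s I c) : ContinuousOn (fun t => (wnorm s (c t)).toReal) I := by
  intro t₀ ht₀
  have h := (ENNReal.tendsto_toReal ENNReal.zero_ne_top).comp (hc.2 t₀ ht₀)
  rw [ContinuousWithinAt, tendsto_iff_dist_tendsto_zero]
  refine squeeze_zero' (Eventually.of_forall fun _ => dist_nonneg) ?_ h
  filter_upwards [self_mem_nhdsWithin] with t ht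
  have hs := (wnorm_sub_lt_top (hc.1 t ht) (hc.1 t₀ ht₀)).ne
  have h1 : wnorm s (c t) ≤ wnorm s (c t - c t₀) + wnorm s (c t₀) := by
    simpa using wnorm_add_le s (c t - c t₀) (c t₀)
  have h2 : wnorm s (c t₀) ≤ wnorm s (c t - c t₀) + wnorm s (c t) := by
    rw [wnorm_sub_comm]
    simpa using wnorm_add_le s (c t₀ - c t) (c t)
  have h1' := ENNReal.toReal_mono (ENNReal.add_ne_top.2 ⟨hs, (hc.1 t₀ ht₀).ne⟩) h1
  have h2' := ENNReal.toReal_mono (ENNReal.add_ne_top.2 ⟨hs, (hc.1 t ht).ne⟩) h2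
  rw [ENNReal.toReal_add hs (hc.1 t₀ ht₀).ne] at h1'
  rw [ENNReal.toReal_add hs (hc.1 t ht).ne] at h2'
  rw [Real.dist_eq, abs_le]
  exact ⟨by simp only [Function.comp_apply]; linarith, by simp only [Function.comp_apply]; linarith⟩

theorem enorm_tendsto (hc : WCont s I c) {t₀ : ℝ} (ht₀ : t₀ ∈ I) :
    Tendsto (fun t => wnorm s (c t)) (𝓝[I] t₀) (𝓝 (wnorm s (c t₀))) := by
  have h := ENNReal.tendsto_ofReal (hc.norm t₀ ht₀)
  rw [ENNReal.ofReal_toReal (hc.1 t₀ ht₀).ne] at h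
  refine h.congr' ?_
  filter_upwards [self_mem_nhdsWithin] with t ht
  exact ENNReal.ofReal_toReal (hc.1 t ht).ne

theorem coeff (hc : WCont s I c) (k : ℤ) : ContinuousOn (fun t => c t k) I := by
  intro t₀ ht₀
  rw [ContinuousWithinAt, tendsto_iff_edist_tendsto_0]
  have h := ENNReal.Tendsto.const_mul (a := ENNReal.ofReal (bracket k ^ (-s))) (hc.2 t₀ ht₀)
    (Or.inr ENNReal.ofReal_ne_top)
  rw [mul_zero] at h
  refine tendsto_of_le h (Eventually.of_forall fun t => ?_)
  rw [edist_eq_enorm_sub]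
  exact enorm_le_wnorm s (c t - c t₀) k

theorem bounded_on_uIcc (hc : WCont s I c) {a b : ℝ} (hab : Set.uIcc a b ⊆ I) :
    ∃ K : ℝ, 0 ≤ K ∧ ∀ t ∈ Set.uIcc a b, wnorm s (c t) ≤ ENNReal.ofReal K := by
  obtain ⟨K, hK⟩ := (isCompact_uIcc.image_of_continuousOn (hc.norm.mono hab)).bddAbove
  refine ⟨max K 0, le_max_right _ _, fun t ht => ?_⟩
  rw [ENNReal.le_ofReal_iff_toReal_le (hc.1 t (hab ht)).ne (le_max_right _ _)]
  exact (hK ⟨t, ht, rfl⟩).trans (le_max_left _ _)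

/-- The difference telescopes into three terms, each with one factor tending to 0 and two factors
whose norms converge. -/
theorem tri {f g h : ℝ → ℤ → ℂ} {q A : ℝ} {m : ℤ → ℤ × ℤ → ℂ} (hq : 1 / 2 < q) (hqs : q ≤ s)
    (hA : 0 ≤ A) (hm : Admissible r s q A m) (hf : WCont s I f) (hg : WCont s I g)
    (hh : WCont s I h) : WCont r I (fun t => FNLS.tri m (f t) (g t) (h t)) := by
  have hC := triConst_lt_top hq A
  refine ⟨fun t ht => ?_, fun t₀ ht₀ => ?_⟩
  · refine (wnorm_tri_le hA hm _ _ _).trans_lt (ENNReal.mul_lt_top hC ?_)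
    exact (mixedNorm_le hqs _ _ _).trans_lt (ENNReal.mul_lt_top (by norm_num)
      (ENNReal.mul_lt_top (hf.1 t ht) (ENNReal.mul_lt_top (hg.1 t ht) (hh.1 t ht))))
  · have f0 := (hf.1 t₀ ht₀).ne
    have g0 := (hg.1 t₀ ht₀).ne
    have h0 := (hh.1 t₀ ht₀).ne
    have z := ENNReal.zero_ne_top
    have m1 := ENNReal.Tendsto.mul (hg.enorm_tendsto ht₀) (Or.inr h0) (hh.enorm_tendsto ht₀)
      (Or.inr g0)
    have t1 := ENNReal.Tendsto.mul (hf.2 t₀ ht₀) (Or.inr (ENNReal.mul_ne_top g0 h0)) m1 (Or.inr z)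
    have m2 := ENNReal.Tendsto.mul (hg.2 t₀ ht₀) (Or.inr h0) (hh.enorm_tendsto ht₀) (Or.inr z)
    rw [zero_mul] at m2
    have t2 := ENNReal.Tendsto.const_mul (a := wnorm s (f t₀)) m2 (Or.inr f0)
    have m3 := ENNReal.Tendsto.const_mul (a := wnorm s (g t₀)) (hh.2 t₀ ht₀) (Or.inr g0)
    rw [mul_zero] at m3
    have t3 := ENNReal.Tendsto.const_mul (a := wnorm s (f t₀)) m3 (Or.inr f0)
    have tt := ENNReal.Tendsto.const_mul (a := 3 * triConst q A) ((t1.add t2).add t3)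
      (Or.inr (ENNReal.mul_ne_top (by norm_num) hC.ne))
    simp only [zero_mul, mul_zero, add_zero] at tt
    refine tendsto_of_le tt ?_
    filter_upwards [self_mem_nhdsWithin] with t ht
    exact wnorm_tri_sub_le hq hqs hA hm (hf.1 t ht) (hg.1 t ht) (hh.1 t ht) (hf.1 t₀ ht₀)
      (hg.1 t₀ ht₀) (hh.1 t₀ ht₀)

end WCont

/-! ### Unimodular rotations of Fourier coefficients -/

/-- Multiplication of a coefficient sequence by the unimodular factors `e^{i t θ_k}`. -/
def rot (θ : ℤ → ℝ) (t : ℝ) (c : ℤ → ℂ) : ℤ → ℂ :=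
  fun k => Complex.exp (Complex.I * (t * θ k : ℝ)) * c k

theorem norm_exp_I_mul (x : ℝ) : ‖Complex.exp (Complex.I * (x : ℂ))‖ = 1 := by
  rw [mul_comm, Complex.norm_exp_ofReal_mul_I]

@[simp] theorem wnorm_rot (r : ℝ) (θ : ℤ → ℝ) (t : ℝ) (c : ℤ → ℂ) :
    wnorm r (rot θ t c) = wnorm r c :=
  wnorm_congr_norm r fun k => by rw [rot, norm_mul, norm_exp_I_mul, one_mul]

theorem rot_sub (θ : ℤ → ℝ) (t : ℝ) (c d : ℤ → ℂ) :
    rot θ t (c - d) = rot θ t c - rot θ t d := by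
  ext k; simp [rot, mul_sub]

theorem rot_rot_neg (θ : ℤ → ℝ) (t : ℝ) (c : ℤ → ℂ) : rot θ t (rot θ (-t) c) = c := by
  ext k
  simp only [rot]
  rw [← mul_assoc, ← Complex.exp_add]
  push_cast
  rw [show Complex.I * (↑t * ↑(θ k)) + Complex.I * (-↑t * ↑(θ k)) = 0 by ring, Complex.exp_zero,
    one_mul]

/-- Since θ may be unbounded there is no rate of convergence. Dominated convergence, with four times
the weighted coefficients as majorant, gives strong continuity. -/
theorem tendsto_wnorm_rot_sub {r : ℝ} (θ : ℤ → ℝ) {c : ℤ → ℂ} (hc : wnorm r c < ∞) (t₀ : ℝ) :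
    Tendsto (fun t => wnorm r (rot θ t c - rot θ t₀ c)) (𝓝 t₀) (𝓝 0) := by
  have hs := (summable_iff_wnorm_lt_top r c).2 hc
  have key : Tendsto (fun t => ∑' k, bracket k ^ (2 * r) * ‖(rot θ t c - rot θ t₀ c) k‖ ^ 2) (𝓝 t₀)
      (𝓝 (∑' k : ℤ, (0 : ℝ))) := by
    refine tendsto_tsum_of_dominated_convergence
      (bound := fun k => 4 * (bracket k ^ (2 * r) * ‖c k‖ ^ 2)) (hs.mul_left 4) (fun k => ?_) ?_
    · have : Continuous fun t => bracket k ^ (2 * r) * ‖(rot θ t c - rot θ t₀ c) k‖ ^ 2 := by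
        simp only [rot, Pi.sub_apply]
        fun_prop
      have h := this.tendsto t₀
      simpa using h
    · refine Eventually.of_forall fun t k => ?_
      rw [Real.norm_of_nonneg (weight_nonneg r k _)]
      have h1 : ‖(rot θ t c - rot θ t₀ c) k‖ ≤ 2 * ‖c k‖ := by
        refine (norm_sub_le _ _).trans (le_of_eq ?_)
        rw [rot, rot, norm_mul, norm_mul, norm_exp_I_mul, norm_exp_I_mul]; ring
      have h2 : ‖(rot θ t c - rot θ t₀ c) k‖ ^ 2 ≤ (2 * ‖c k‖) ^ 2 := by gcongr
      have h3 := mul_le_mul_of_nonneg_left h2 (bracket_rpow_pos k (2 * r)).le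
      linarith
  rw [tsum_zero] at key
  have h2 := ENNReal.tendsto_ofReal ((Real.continuous_sqrt.tendsto 0).comp key)
  rw [Real.sqrt_zero, ENNReal.ofReal_zero] at h2
  refine h2.congr fun t => ?_
  rw [Function.comp_apply, sqrt_tsum_eq_wnorm, ENNReal.ofReal_toReal]
  exact (wnorm_sub_lt_top (by rwa [wnorm_rot]) (by rwa [wnorm_rot])).ne

/-- The rotations are isometries, so the moving argument costs nothing and only the strong
continuity at the fixed argument c(t₀) is needed. -/
theorem WCont.rot {r : ℝ} {I : Set ℝ} {c : ℝ → ℤ → ℂ} (θ : ℤ → ℝ) (hc : WCont r I c) :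
    WCont r I (fun t => FNLS.rot θ t (c t)) := by
  refine ⟨fun t ht => by rw [wnorm_rot]; exact hc.1 t ht, fun t₀ ht₀ => ?_⟩
  have h := (hc.2 t₀ ht₀).add
    ((tendsto_wnorm_rot_sub θ (hc.1 t₀ ht₀) t₀).mono_left nhdsWithin_le_nhds)
  rw [add_zero] at h
  refine WCont.tendsto_of_le h (Eventually.of_forall fun t => ?_)
  have e : FNLS.rot θ t (c t) - FNLS.rot θ t₀ (c t₀) = FNLS.rot θ t (c t - c t₀) +
      (FNLS.rot θ t (c t₀) - FNLS.rot θ t₀ (c t₀)) := by rw [rot_sub]; abel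
  rw [e]
  refine (wnorm_add_le _ _ _).trans ?_
  rw [wnorm_rot]

theorem WCont.rot_neg {r : ℝ} {I : Set ℝ} {c : ℝ → ℤ → ℂ} (θ : ℤ → ℝ) (hc : WCont r I c) :
    WCont r I (fun t => FNLS.rot θ (-t) (c t)) := by
  refine (hc.rot fun k => -θ k).congr fun t _ => ?_
  ext k; simp [FNLS.rot]

/-! ### The equation for the Fourier coefficients -/

/-- The Fourier coefficients of the cubic nonlinearity in terms of those of the function. -/
def cubicSeq (c : ℤ → ℂ) : ℤ → ℂ := tri (fun _ _ => 1) c c c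

/-- The right-hand side of the equation for the Fourier coefficients. -/
def rhs (σ α : ℝ) (c : ℤ → ℂ) : ℤ → ℂ :=
  fun k => Complex.I * (symbol α k * c k) - Complex.I * (σ * cubicSeq c k)

/-- Solutions of the equation in terms of Fourier coefficients. -/
structure SeqSolution (σ α s : ℝ) (I : Set ℝ) (c : ℝ → ℤ → ℂ) : Prop where
  isOpen : IsOpen I
  ordConnected : I.OrdConnected
  wcont : WCont s I c
  hasDerivAt : ∀ t ∈ I, ∀ k, HasDerivAt (fun τ => c τ k) (rhs σ α (c t) k) t

theorem IsSolution.seqSolution {σ α s : ℝ} (hs : 1 / 2 < s) {u₀ : L2} {I : Set ℝ} {u : ℝ → L2}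
    (h : IsSolution σ α s u₀ I u) : SeqSolution σ α s I (fun t => coeff (u t)) where
  isOpen := h.isOpen
  ordConnected := h.ordConnected
  wcont := continuousInSobolev_iff.1 h.continuous
  hasDerivAt t ht k := by
    obtain ⟨h1, h2⟩ := h.equation t ht k
    refine h1.hasDerivAt.congr_deriv ?_
    rw [cubicCoeff_eq hs ((continuousInSobolev_iff.1 h.continuous).1 t ht)] at h2
    rw [rhs, cubicSeq]
    linear_combination (-Complex.I) * h2 +
      deriv (fun τ => coeff (u τ) k) t * Complex.I_mul_I

theorem admissible_one {s : ℝ} (hs : 0 ≤ s) (q : ℝ) : Admissible s s q (3 ^ s) fun _ _ => 1 :=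
  admissible_of_norm_le_one hs q fun _ _ => by simp

theorem three_rpow_nonneg (s : ℝ) : (0 : ℝ) ≤ 3 ^ s := by positivity

theorem SeqSolution.wcont_cubicSeq {σ α s : ℝ} (hs : 1 / 2 < s) {I : Set ℝ} {c : ℝ → ℤ → ℂ}
    (h : SeqSolution σ α s I c) : WCont s I (fun t => cubicSeq (c t)) :=
  WCont.tri hs le_rfl (three_rpow_nonneg s) (admissible_one (by linarith) s) h.wcont h.wcont h.wcont

theorem SeqSolution.uIcc_subset {σ α s : ℝ} {I : Set ℝ} {c : ℝ → ℤ → ℂ}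
    (h : SeqSolution σ α s I c) {a b : ℝ} (ha : a ∈ I) (hb : b ∈ I) : Set.uIcc a b ⊆ I :=
  h.ordConnected.uIcc_subset ha hb

/-! ### The quartic form -/

/-- The summands of `∑ conj (a(k)) f(k - j) conj (g(k - j - l)) h(k - l)`. -/
def q4Term (a f g h : ℤ → ℂ) (x : ℤ × (ℤ × ℤ)) : ℂ :=
  conj (a x.1) * triTerm (fun _ _ => 1) f g h x.1 x.2

/-- The quartic form `∑ conj (a(k)) f(k - j) conj (g(k - j - l)) h(k - l)`. -/
def q4 (a f g h : ℤ → ℂ) : ℂ := ∑' x, q4Term a f g h x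

/-- The exchange of `k` and `k₁`. -/
def swap₀₁ : ℤ × (ℤ × ℤ) ≃ ℤ × (ℤ × ℤ) where
  toFun x := (x.1 - x.2.1, (-x.2.1, x.2.2))
  invFun x := (x.1 - x.2.1, (-x.2.1, x.2.2))
  left_inv x := by ext <;> simp
  right_inv x := by ext <;> simp

/-- The exchange of `k` and `k₂`. -/
def swap₀₂ : ℤ × (ℤ × ℤ) ≃ ℤ × (ℤ × ℤ) where
  toFun x := (x.1 - x.2.1 - x.2.2, (-x.2.1, -x.2.2))
  invFun x := (x.1 - x.2.1 - x.2.2, (-x.2.1, -x.2.2))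
  left_inv x := by ext <;> simp; ring
  right_inv x := by ext <;> simp; ring

/-- The exchange of `k₁` and `k₃`. -/
def swap₁₃ : ℤ × (ℤ × ℤ) ≃ ℤ × (ℤ × ℤ) where
  toFun x := (x.1, (x.2.2, x.2.1))
  invFun x := (x.1, (x.2.2, x.2.1))
  left_inv _ := rfl
  right_inv _ := rfl

theorem q4Term_swap₀₁ (a f g h : ℤ → ℂ) (x : ℤ × (ℤ × ℤ)) :
    q4Term f a h g (swap₀₁ x) = conj (q4Term a f g h x) := by
  obtain ⟨k, j, l⟩ := x
  simp only [q4Term, triTerm, swap₀₁, Equiv.coe_fn_mk, map_mul, Complex.conj_conj, map_one]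
  rw [show k - j - -j = k by ring, show k - l = k - j - -j - l by ring]
  rw [show k - j - -j = k by ring]
  ring

theorem q4Term_swap₀₂ (a f g h : ℤ → ℂ) (x : ℤ × (ℤ × ℤ)) :
    q4Term g h a f (swap₀₂ x) = q4Term a f g h x := by
  obtain ⟨k, j, l⟩ := x
  simp only [q4Term, triTerm, swap₀₂, Equiv.coe_fn_mk]
  rw [show k - j - l - -j = k - l by ring, show k - l - -l = k by ring,
    show k - j - l - -l = k - j by ring]
  ring

theorem q4Term_swap₁₃ (a f g h : ℤ → ℂ) (x : ℤ × (ℤ × ℤ)) :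
    q4Term a h g f (swap₁₃ x) = q4Term a f g h x := by
  obtain ⟨k, j, l⟩ := x
  simp only [q4Term, triTerm, swap₁₃, Equiv.coe_fn_mk]
  rw [show k - l - j = k - j - l by ring]
  ring

/-- Conjugation exchanges the barred and unbarred slots. With four equal arguments it shows that the
form is real, which is the reason for conservation of mass. -/
theorem conj_q4 (a f g h : ℤ → ℂ) : conj (q4 a f g h) = q4 f a h g := by
  rw [q4, q4, Complex.conj_tsum, ← swap₀₁.tsum_eq (q4Term f a h g)]
  exact tsum_congr fun x => (q4Term_swap₀₁ a f g h x).symm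

theorem q4_swap₀₂ (a f g h : ℤ → ℂ) : q4 g h a f = q4 a f g h := by
  rw [q4, q4, ← swap₀₂.tsum_eq]
  exact tsum_congr fun x => q4Term_swap₀₂ a f g h x

theorem q4_swap₁₃ (a f g h : ℤ → ℂ) : q4 a h g f = q4 a f g h := by
  rw [q4, q4, ← swap₁₃.tsum_eq]
  exact tsum_congr fun x => q4Term_swap₁₃ a f g h x

/-- The sum of the absolute values of the summands of `q4`. -/
def eq4 (a f g h : ℤ → ℂ) : ℝ≥0∞ := ∑' x, ‖q4Term a f g h x‖ₑ

theorem eq4_swap₀₁ (a f g h : ℤ → ℂ) : eq4 f a h g = eq4 a f g h := by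
  rw [eq4, eq4, ← swap₀₁.tsum_eq]
  exact tsum_congr fun x => by rw [q4Term_swap₀₁, RCLike.enorm_conj]

theorem eq4_swap₀₂ (a f g h : ℤ → ℂ) : eq4 g h a f = eq4 a f g h := by
  rw [eq4, eq4, ← swap₀₂.tsum_eq]
  exact tsum_congr fun x => by rw [q4Term_swap₀₂]

theorem eq4_swap₁₃ (a f g h : ℤ → ℂ) : eq4 a h g f = eq4 a f g h := by
  rw [eq4, eq4, ← swap₁₃.tsum_eq]
  exact tsum_congr fun x => by rw [q4Term_swap₁₃]

theorem eq4_eq (a f g h : ℤ → ℂ) :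
    eq4 a f g h = ∑' k, ‖a k‖ₑ * etri (fun _ _ => 1) f g h k := by
  rw [eq4, ENNReal.tsum_prod']
  refine tsum_congr fun k => ?_
  rw [etri, ← ENNReal.tsum_mul_left]
  exact tsum_congr fun p => by rw [q4Term, enorm_mul, RCLike.enorm_conj]

theorem tsum_mul_le_wnorm (r : ℝ) (a : ℤ → ℂ) (b : ℤ → ℝ≥0∞) :
    ∑' k, ‖a k‖ₑ * b k ≤ wnorm (-r) a * l2e fun k => ebr r k * b k := by
  refine le_trans (le_of_eq ?_) (tsum_mul_le_l2e _ _)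
  refine tsum_congr fun k => ?_
  have := ebr_neg_mul r k
  calc _ = (ebr (-r) k * ebr r k) * (‖a k‖ₑ * b k) := by rw [this, one_mul]
    _ = (ebr (-r) k * ‖a k‖ₑ) * (ebr r k * b k) := by ring

/-- Duality between H^{-r} and H^r lets one argument be rough. This is needed in the energy
identity, where the time derivative of an H^α solution is only in H^{-α}. -/
theorem eq4_le {r q : ℝ} (hr : 0 ≤ r) (a f g h : ℤ → ℂ) :
    eq4 a f g h ≤ wnorm (-r) a * (triConst q (3 ^ r) * mixedNorm r q f g h) := by
  rw [eq4_eq]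
  exact (tsum_mul_le_wnorm r a _).trans (mul_le_mul_right
    (l2e_etri_le (three_rpow_nonneg r) (admissible_one hr q) f g h) _)

theorem summable_q4Term {a f g h : ℤ → ℂ} (H : eq4 a f g h < ∞) : Summable (q4Term a f g h) :=
  Summable.of_norm (tsum_enorm_ne_top_iff_summable_norm.1 H.ne)

theorem hasSum_q4 {a f g h : ℤ → ℂ} (H : eq4 a f g h < ∞) :
    HasSum (fun k => conj (a k) * tri (fun _ _ => 1) f g h k) (q4 a f g h) := by
  have hs := summable_q4Term H
  have h1 := hs.hasSum.prod_fiberwise fun k => (hs.prod_factor k).hasSum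
  refine h1.congr_fun fun k => ?_
  simp only [q4Term, tri, tsum_mul_left]

/-! ### Weighted `ℓ²` balance laws -/

/-- Weight 1 gives the mass and weight |k|^{2α} the kinetic energy. Each mode is differentiated
separately and the sum integrated termwise, so no regularization of the solution is required. -/
theorem SeqSolution.weighted_balance {σ α s r : ℝ} (hs : 1 / 2 < s) (hr : r ≤ s)
    {w : ℤ → ℝ} (hw : ∀ k, |w k| ≤ bracket k ^ (2 * r)) {I : Set ℝ}
    {c : ℝ → ℤ → ℂ} (h : SeqSolution σ α s I c) {t₀ t : ℝ} (ht₀ : t₀ ∈ I) (ht : t ∈ I) :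
    ∑' k, (w k : ℂ) * (c t k * conj (c t k)) - ∑' k, (w k : ℂ) * (c t₀ k * conj (c t₀ k)) =
      ∫ τ in t₀..t, ∑' k, (w k : ℂ) * (-(Complex.I * σ) *
        (conj (c τ k) * cubicSeq (c τ) k - conj (conj (c τ k) * cubicSeq (c τ) k))) := by
  have hsub := h.uIcc_subset ht₀ ht
  have hN := h.wcont_cubicSeq hs
  obtain ⟨K, hK0, hK⟩ := h.wcont.bounded_on_uIcc hsub
  obtain ⟨K', hK0', hK'⟩ := hN.bounded_on_uIcc hsub
  have hwe : ∀ k, ‖(w k : ℂ)‖ₑ ≤ ebr r k * ebr r k := fun k => by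
    rw [ebr, ← ENNReal.ofReal_mul (bracket_rpow_pos k r).le, ← Real.rpow_add (bracket_pos k),
      ← ofReal_norm, Complex.norm_real, Real.norm_eq_abs, ← two_mul]
    exact ENNReal.ofReal_le_ofReal (hw k)
  have hprod : ∀ a b : ℤ → ℂ, ∑' k, ‖(w k : ℂ)‖ₑ * (‖a k‖ₑ * ‖b k‖ₑ) ≤ wnorm s a * wnorm s b := by
    intro a b
    refine le_trans ?_ ((tsum_mul_le_l2e (fun k => ebr r k * ‖a k‖ₑ) fun k => ebr r k * ‖b k‖ₑ).trans
      (mul_le_mul' (wnorm_mono_exp hr a) (wnorm_mono_exp hr b)))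
    refine ENNReal.tsum_le_tsum fun k => ?_
    refine (mul_le_mul_left (hwe k) _).trans (le_of_eq ?_)
    ring
  have hsumm : ∀ τ ∈ I, Summable fun k => (w k : ℂ) * (c τ k * conj (c τ k)) := fun τ hτ => by
    refine Summable.of_norm (tsum_enorm_ne_top_iff_summable_norm.1 (ne_of_lt ?_))
    refine lt_of_le_of_lt (le_of_eq ?_) ((hprod (c τ) (c τ)).trans_lt
      (ENNReal.mul_lt_top (h.wcont.1 τ hτ) (h.wcont.1 τ hτ)))
    exact tsum_congr fun k => by rw [enorm_mul, enorm_mul, RCLike.enorm_conj]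
  refine tsum_sub_tsum_eq_integral (C := 2 * ‖(σ : ℂ)‖ₑ * (ENNReal.ofReal K * ENNReal.ofReal K'))
    (f := fun k τ => (w k : ℂ) * (c τ k * conj (c τ k)))
    (fun k τ hτ => ?_) (fun k => ?_) ?_ (fun τ hτ => ?_) (hsumm t₀ ht₀) (hsumm t ht)
  · have hd := h.hasDerivAt τ (hsub hτ) k
    -- The dispersive part of the equation drops out because its symbol is real.
    refine ((hd.mul hd.star).const_mul (w k : ℂ)).congr_deriv ?_
    simp only [rhs, Complex.star_def, map_sub, map_mul, Complex.conj_I, Complex.conj_ofReal,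
      Complex.conj_conj]
    ring
  · have h1 := (h.wcont.coeff k).mono hsub
    have h2 := (hN.coeff k).mono hsub
    have h3 : ContinuousOn (fun τ => conj (c τ k) * cubicSeq (c τ) k) (Set.uIcc t₀ t) :=
      (Complex.continuous_conj.comp_continuousOn h1).mul h2
    exact continuousOn_const.mul (continuousOn_const.mul
      (h3.sub (Complex.continuous_conj.comp_continuousOn h3)))
  · exact ENNReal.mul_lt_top (ENNReal.mul_lt_top (by norm_num) enorm_lt_top)
      (ENNReal.mul_lt_top ENNReal.ofReal_lt_top ENNReal.ofReal_lt_top)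
  · calc _ ≤ ∑' k, 2 * ‖(σ : ℂ)‖ₑ * (‖(w k : ℂ)‖ₑ * (‖c τ k‖ₑ * ‖cubicSeq (c τ) k‖ₑ)) := by
          refine ENNReal.tsum_le_tsum fun k => ?_
          rw [enorm_mul, enorm_mul, enorm_neg, enorm_mul]
          have e1 : ‖Complex.I‖ₑ = 1 := by rw [← ofReal_norm]; simp
          have e2 := enorm_sub_le (a := conj (c τ k) * cubicSeq (c τ) k)
            (b := conj (conj (c τ k) * cubicSeq (c τ) k))
          rw [RCLike.enorm_conj, enorm_mul, RCLike.enorm_conj] at e2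
          refine (mul_le_mul_right (mul_le_mul_right e2 _) _).trans (le_of_eq ?_)
          rw [e1]; ring
      _ = 2 * ‖(σ : ℂ)‖ₑ * ∑' k, ‖(w k : ℂ)‖ₑ * (‖c τ k‖ₑ * ‖cubicSeq (c τ) k‖ₑ) :=
          ENNReal.tsum_mul_left
      _ ≤ _ := mul_le_mul_right ((hprod _ _).trans (mul_le_mul' (hK τ hτ) (hK' τ hτ))) _

theorem eq4_lt_top {s : ℝ} (hs : 1 / 2 < s) {c : ℤ → ℂ} (hc : wnorm s c < ∞) :
    eq4 c c c c < ∞ := by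
  refine (eq4_le (r := s) (q := s) (by linarith) c c c c).trans_lt (ENNReal.mul_lt_top ?_ ?_)
  · exact (wnorm_mono_exp (by linarith) c).trans_lt hc
  · refine ENNReal.mul_lt_top (triConst_lt_top hs _) ((mixedNorm_le le_rfl c c c).trans_lt ?_)
    exact ENNReal.mul_lt_top (by norm_num) (ENNReal.mul_lt_top hc (ENNReal.mul_lt_top hc hc))

/-- Conservation of mass. -/
theorem SeqSolution.mass_eq {σ α s : ℝ} (hs : 1 / 2 < s) {I : Set ℝ} {c : ℝ → ℤ → ℂ}
    (h : SeqSolution σ α s I c) {t₀ t : ℝ} (ht₀ : t₀ ∈ I) (ht : t ∈ I) :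
    ∑' k, ‖c t k‖ ^ 2 = ∑' k, ‖c t₀ k‖ ^ 2 := by
  have hb := h.weighted_balance (r := 0) hs (by linarith) (w := fun _ => 1) (by simp) ht₀ ht
  have hz : ∀ τ ∈ Set.uIcc t₀ t, ∑' k, ((1 : ℝ) : ℂ) * (-(Complex.I * σ) *
      (conj (c τ k) * cubicSeq (c τ) k - conj (conj (c τ k) * cubicSeq (c τ) k))) = 0 := by
    intro τ hτ
    have h1 := hasSum_q4 (eq4_lt_top hs (h.wcont.1 τ (h.uIcc_subset ht₀ ht hτ)))
    have h2 := ((h1.sub (Complex.hasSum_conj'.2 h1)).mul_left (-(Complex.I * σ))).tsum_eq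
    simp only [Complex.ofReal_one, one_mul]
    -- The integrand is a multiple of the quartic form minus its conjugate, which vanishes since all
    -- four arguments coincide.
    rw [conj_q4, sub_self, mul_zero] at h2
    exact h2
  rw [intervalIntegral.integral_congr (g := fun _ => 0) hz, intervalIntegral.integral_zero,
    sub_eq_zero] at hb
  simp only [Complex.ofReal_one, one_mul, Complex.mul_conj'] at hb
  exact_mod_cast hb

/-! ### Decomposition of the nonlinearity -/

theorem tsum_norm_sq_sub_left (c : ℤ → ℂ) (k : ℤ) :
    ∑' j, ‖c (k - j)‖ ^ 2 = ∑' j, ‖c j‖ ^ 2 :=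
  (Equiv.subLeft k).tsum_eq fun j => ‖c j‖ ^ 2

/-- When l = 0 one has k₃ = k and k₁ = k₂, so the sum over j is the mass times c(k). -/
theorem tri_snd_eq_zero (c : ℤ → ℂ) (k : ℤ) :
    tri (fun _ p => if p.2 = 0 then 1 else 0) c c c k = (∑' j, ‖c j‖ ^ 2 : ℝ) * c k := by
  have hinj : Function.Injective fun j : ℤ => (j, (0 : ℤ)) := fun a b h => (Prod.mk.inj h).1
  rw [tri, ← hinj.tsum_eq, ← tsum_norm_sq_sub_left c k, Complex.ofReal_tsum, ← tsum_mul_right]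
  · refine tsum_congr fun j => ?_
    simp only [triTerm, sub_zero, if_true, one_mul, Complex.ofReal_pow]
    rw [← mul_assoc, Complex.mul_conj']
  · intro p hp
    by_contra h
    refine hp ?_
    have h2 : p.2 ≠ 0 := fun h2 => h ⟨p.1, by rw [← h2]⟩
    simp [triTerm, h2]

theorem tri_fst_eq_zero (c : ℤ → ℂ) (k : ℤ) :
    tri (fun _ p => if p.1 = 0 then 1 else 0) c c c k = (∑' j, ‖c j‖ ^ 2 : ℝ) * c k := by
  rw [← tri_snd_eq_zero, tri, tri, ← (Equiv.prodComm ℤ ℤ).tsum_eq]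
  refine tsum_congr fun p => ?_
  change (if p.2 = 0 then (1 : ℂ) else 0) *
      (c (k - p.2) * (conj (c (k - p.2 - p.1)) * c (k - p.1))) =
    (if p.2 = 0 then 1 else 0) * (c (k - p.1) * (conj (c (k - p.1 - p.2)) * c (k - p.2)))
  rw [show k - p.2 - p.1 = k - p.1 - p.2 by ring]
  ring

/-- Inclusion-exclusion over the lines j = 0 and l = 0. Each line contributes the mass times c(k),
and their common point j = l = 0 is counted twice. -/
theorem cubicSeq_eq {s : ℝ} (hs : 1 / 2 < s) {c : ℤ → ℂ} (hc : wnorm s c < ∞) (k : ℤ) :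
    cubicSeq c k = (2 * ∑' j, ‖c j‖ ^ 2 : ℝ) * c k +
      (tri nonres c c c k - tri diagRes c c c k) := by
  have S : ∀ m : ℤ → ℤ × ℤ → ℂ, (∀ k p, ‖m k p‖ ≤ 1) → Summable (triTerm m c c c k) := fun m hm =>
    summable_triTerm hs le_rfl (three_rpow_nonneg s)
      (admissible_of_norm_le_one (by linarith) s hm) hc hc hc k
  have S1 := S (fun _ p => if p.1 = 0 then 1 else 0) fun k p => by split_ifs <;> simp
  have S2 := S (fun _ p => if p.2 = 0 then 1 else 0) fun k p => by split_ifs <;> simp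
  have S3 := S nonres norm_nonres_le_one
  have S4 := S diagRes norm_diagRes_le_one
  have h1 := tri_fst_eq_zero c k
  have h2 := tri_snd_eq_zero c k
  have e : ((2 * ∑' j, ‖c j‖ ^ 2 : ℝ) : ℂ) * c k =
      tri (fun _ p => if p.1 = 0 then 1 else 0) c c c k +
        tri (fun _ p => if p.2 = 0 then 1 else 0) c c c k := by
    rw [h1, h2]; push_cast; ring
  rw [e]
  simp only [cubicSeq, tri]
  rw [← S1.tsum_add S2, ← S3.tsum_sub S4, ← (S1.add S2).tsum_add (S3.sub S4)]
  refine tsum_congr fun p => ?_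
  simp only [triTerm, nonres, diagRes]
  by_cases a : p.1 = 0 <;> by_cases b : p.2 = 0 <;> simp [a, b]

/-- The nonlinearity without its phase rotation. -/
def forcing (σ : ℝ) (c : ℤ → ℂ) : ℤ → ℂ :=
  (-(Complex.I * σ)) • (tri nonres c c c - tri diagRes c c c)

/-- The integrand left over by the normal form transformation. -/
def remainder (σ α : ℝ) (c : ℤ → ℂ) : ℤ → ℂ :=
  (Complex.I * σ) • tri diagRes c c c - (σ : ℂ) • (tri (normalForm α) (forcing σ c) c c +
    tri (normalForm α) c (forcing σ c) c + tri (normalForm α) c c (forcing σ c))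

theorem enorm_sign {σ : ℝ} (hσ : σ = 1 ∨ σ = -1) : ‖(σ : ℂ)‖ₑ = 1 := by
  rcases hσ with rfl | rfl <;> simp

theorem enorm_I : ‖Complex.I‖ₑ = 1 := by rw [← ofReal_norm]; simp

theorem wnorm_forcing_le {σ r : ℝ} (hσ : σ = 1 ∨ σ = -1) (hr : 0 ≤ r) (q : ℝ) (c : ℤ → ℂ) :
    wnorm r (forcing σ c) ≤ 6 * triConst q (3 ^ r) * (wnorm r c * wnorm q c ^ 2) := by
  rw [forcing, wnorm_smul, enorm_neg, enorm_mul, enorm_I, enorm_sign hσ, one_mul, one_mul]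
  have h1 := wnorm_tri_le (three_rpow_nonneg r) (admissible_of_norm_le_one hr q norm_nonres_le_one)
    c c c
  have h2 := wnorm_tri_le (three_rpow_nonneg r) (admissible_of_norm_le_one hr q norm_diagRes_le_one)
    c c c
  refine (wnorm_sub_le _ _ _).trans ((add_le_add h1 h2).trans (le_of_eq ?_))
  rw [mixedNorm_self]; ring

/-- The diagonal term is cubic. The other terms are quintic, since the normal form is applied with
one argument replaced by the cubic `forcing`, which loses no derivatives. -/
theorem wnorm_remainder_le {α r s q : ℝ} (hα : 1 / 2 < α) (hα' : α ≤ 1) (hq : 1 / 2 < q)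
    (hqs : q ≤ s) (hr : r ≤ s + (2 * α - 1)) :
    ∃ C : ℝ≥0∞, C < ∞ ∧ ∀ σ : ℝ, σ = 1 ∨ σ = -1 → ∀ c : ℤ → ℂ,
      wnorm r (remainder σ α c) ≤ C * (wnorm s c * (wnorm q c ^ 2 + wnorm q c ^ 4)) := by
  obtain ⟨A, hA, hm⟩ := admissible_normalForm hα hα' (s := s) (q := q) (r := r) (by linarith)
    hq.le hr
  have hres : Admissible r s q 1 diagRes := admissible_diagRes hq.le (by linarith)
  -- A single constant that controls the forcing both in H^s and in H^q, because the replaced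
  -- argument may carry either norm.
  let D := 6 * triConst q (3 ^ s) + 6 * triConst q (3 ^ q)
  have hD : D < ∞ := ENNReal.add_lt_top.2 ⟨ENNReal.mul_lt_top (by norm_num) (triConst_lt_top hq _),
    ENNReal.mul_lt_top (by norm_num) (triConst_lt_top hq _)⟩
  refine ⟨3 * triConst q 1 + 9 * (triConst q A * D), ENNReal.add_lt_top.2
    ⟨ENNReal.mul_lt_top (by norm_num) (triConst_lt_top hq _), ENNReal.mul_lt_top (by norm_num)
      (ENNReal.mul_lt_top (triConst_lt_top hq _) hD)⟩, fun σ hσ c => ?_⟩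
  have hxs : wnorm s (forcing σ c) ≤ D * (wnorm s c * wnorm q c ^ 2) :=
    (wnorm_forcing_le hσ (by linarith) q c).trans (mul_le_mul_left le_self_add _)
  have hxq : wnorm q (forcing σ c) ≤ D * (wnorm q c * wnorm q c ^ 2) :=
    (wnorm_forcing_le hσ (by linarith) q c).trans (mul_le_mul_left le_add_self _)
  have B := fun a b c => wnorm_tri_le hA hm a b c
  have h1 := (wnorm_tri_le zero_le_one hres c c c)
  rw [remainder]
  refine (wnorm_sub_le _ _ _).trans ?_
  rw [wnorm_smul, wnorm_smul, enorm_mul, enorm_I, enorm_sign hσ, one_mul, one_mul, one_mul]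
  refine (add_le_add h1 ((wnorm_add_le _ _ _).trans (add_le_add ((wnorm_add_le _ _ _).trans
    (add_le_add (B _ _ _) (B _ _ _))) (B _ _ _)))).trans ?_
  rw [mixedNorm_self]
  simp only [mixedNorm]
  generalize wnorm s (forcing σ c) = xs at *
  generalize wnorm q (forcing σ c) = xq at *
  generalize wnorm s c = ns at *
  generalize wnorm q c = nq at *
  generalize triConst q A = T at *
  generalize triConst q 1 = T1 at *
  calc _ ≤ T1 * (3 * (ns * nq ^ 2)) +
        (T * ((D * (ns * nq ^ 2)) * (nq * nq) + (D * (nq * nq ^ 2)) * (ns * nq) +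
          (D * (nq * nq ^ 2)) * (nq * ns)) +
        T * (ns * ((D * (nq * nq ^ 2)) * nq) + nq * ((D * (ns * nq ^ 2)) * nq) +
          nq * ((D * (nq * nq ^ 2)) * ns)) +
        T * (ns * (nq * (D * (nq * nq ^ 2))) + nq * (ns * (D * (nq * nq ^ 2))) +
          nq * (nq * (D * (ns * nq ^ 2))))) := by gcongr
    _ = 3 * T1 * (ns * nq ^ 2) + 9 * (T * D) * (ns * nq ^ 4) := by ring
    _ ≤ (3 * T1 + 9 * (T * D)) * (ns * nq ^ 2) + (3 * T1 + 9 * (T * D)) * (ns * nq ^ 4) :=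
        add_le_add (mul_le_mul_left le_self_add _) (mul_le_mul_left le_add_self _)
    _ = _ := by ring

/-! ### The normal form transformation -/

/-- The dispersion relation shifted by the phase `P`. -/
def shifted (σ α P : ℝ) (k : ℤ) : ℝ := symbol α k - σ * P

/-- The constant phase shift enters twice with each sign, so removing it does not change the
resonance function. -/
theorem shifted_resonance (σ α P : ℝ) (k : ℤ) (p : ℤ × ℤ) :
    shifted σ α P k - shifted σ α P (k - p.1) + shifted σ α P (k - p.1 - p.2) -
      shifted σ α P (k - p.2) = resonance α k p := by
  simp only [shifted, resonance]; ring

/-- Once the resonant mass term is moved into the dispersion relation, the nonlinearity left over is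
exactly `forcing`. -/
theorem rhs_eq {σ α s P : ℝ} (hs : 1 / 2 < s) {c : ℤ → ℂ} (hc : wnorm s c < ∞)
    (hP : P = 2 * ∑' j, ‖c j‖ ^ 2) (k : ℤ) :
    rhs σ α c k = Complex.I * (shifted σ α P k * c k) + forcing σ c k := by
  rw [rhs, cubicSeq_eq hs hc, ← hP, forcing, shifted]
  simp only [Pi.smul_apply, Pi.sub_apply, smul_eq_mul]
  push_cast
  ring

theorem resonance_mul_normalForm {α : ℝ} (hα : 1 / 2 < α) (hα' : α ≤ 1) (k : ℤ) (p : ℤ × ℤ) :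
    (resonance α k p : ℂ) * normalForm α k p = nonres k p := by
  rw [normalForm, nonres]
  split_ifs with h
  · simp
  · rw [not_or] at h
    exact mul_inv_cancel₀ (by exact_mod_cast resonance_ne_zero hα hα' h.1 h.2)

theorem hasDerivAt_exp_neg_I (θ t : ℝ) :
    HasDerivAt (fun τ : ℝ => Complex.exp (Complex.I * ((-τ * θ : ℝ) : ℂ)))
      (-(Complex.I * θ) * Complex.exp (Complex.I * ((-t * θ : ℝ) : ℂ))) t := by
  have h1 : HasDerivAt (fun τ : ℝ => Complex.I * ((-τ * θ : ℝ) : ℂ)) (-(Complex.I * θ)) t := by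
    have h2 : HasDerivAt (fun τ : ℝ => -τ * θ) (-1 * θ) t := (hasDerivAt_id t).neg.mul_const θ
    refine (h2.ofReal_comp.const_mul Complex.I).congr_deriv ?_
    push_cast; ring
  exact (h1.cexp).congr_deriv (mul_comm _ _)

section NormalForm

variable {σ α s P r : ℝ} {I : Set ℝ} {c : ℝ → ℤ → ℂ}

theorem SeqSolution.wcont_forcing (hs : 1 / 2 < s) (h : SeqSolution σ α s I c) :
    WCont s I (fun t => forcing σ (c t)) := by
  have T : ∀ m : ℤ → ℤ × ℤ → ℂ, (∀ k p, ‖m k p‖ ≤ 1) →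
      WCont s I (fun t => tri m (c t) (c t) (c t)) := fun m hm =>
    WCont.tri hs le_rfl (three_rpow_nonneg s) (admissible_of_norm_le_one (by linarith) s hm)
      h.wcont h.wcont h.wcont
  exact ((T nonres norm_nonres_le_one).sub (T diagRes norm_diagRes_le_one)).smul _

theorem SeqSolution.wcont_normalForm (hα : 1 / 2 < α) (hα' : α ≤ 1) (hs : 1 / 2 < s)
    (hr : r ≤ s + (2 * α - 1)) {f g h : ℝ → ℤ → ℂ} (hf : WCont s I f) (hg : WCont s I g)
    (hh : WCont s I h) : WCont r I (fun t => tri (normalForm α) (f t) (g t) (h t)) := by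
  obtain ⟨A, hA, hm⟩ := admissible_normalForm hα hα' (s := s) (q := s) (r := r) (by linarith)
    hs.le hr
  exact WCont.tri hs le_rfl hA hm hf hg hh

theorem SeqSolution.wcont_remainder (hα : 1 / 2 < α) (hα' : α ≤ 1) (hs : 1 / 2 < s)
    (hr : r ≤ s + (2 * α - 1)) (h : SeqSolution σ α s I c) :
    WCont r I (fun t => remainder σ α (c t)) := by
  have hx := h.wcont_forcing hs
  have B := fun {f g h : ℝ → ℤ → ℂ} (hf : WCont s I f) (hg : WCont s I g) (hh : WCont s I h) =>
    SeqSolution.wcont_normalForm hα hα' hs hr hf hg hh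
  have hd : WCont r I (fun t => tri diagRes (c t) (c t) (c t)) :=
    WCont.tri hs le_rfl zero_le_one (admissible_diagRes hs.le (by linarith)) h.wcont h.wcont h.wcont
  exact (hd.smul _).sub ((((B hx h.wcont h.wcont).add (B h.wcont hx h.wcont)).add
    (B h.wcont h.wcont hx)).smul _)

/-- Supplies the uniform majorant on a compact time interval that termwise integration requires. -/
theorem etri_bounded {q A : ℝ} {m : ℤ → ℤ × ℤ → ℂ} (hq : 1 / 2 < q) (hqs : q ≤ s) (hA : 0 ≤ A)
    (hm : Admissible r s q A m) {f g h : ℝ → ℤ → ℂ} (hf : WCont s I f) (hg : WCont s I g)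
    (hh : WCont s I h) {a b : ℝ} (hab : Set.uIcc a b ⊆ I) (k : ℤ) :
    ∃ C : ℝ≥0∞, C < ∞ ∧ ∀ t ∈ Set.uIcc a b, etri m (f t) (g t) (h t) k ≤ C := by
  obtain ⟨F, -, hF⟩ := hf.bounded_on_uIcc hab
  obtain ⟨G, -, hG⟩ := hg.bounded_on_uIcc hab
  obtain ⟨H, -, hH⟩ := hh.bounded_on_uIcc hab
  refine ⟨ebr (-r) k * (triConst q A * (3 * (ENNReal.ofReal F *
    (ENNReal.ofReal G * ENNReal.ofReal H)))), ?_, fun t ht => ?_⟩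
  · exact ENNReal.mul_lt_top ENNReal.ofReal_lt_top (ENNReal.mul_lt_top (triConst_lt_top hq _)
      (ENNReal.mul_lt_top (by norm_num) (ENNReal.mul_lt_top ENNReal.ofReal_lt_top
        (ENNReal.mul_lt_top ENNReal.ofReal_lt_top ENNReal.ofReal_lt_top))))
  · refine (etri_le hA hm _ _ _ k).trans ?_
    have h1 := mixedNorm_le hqs (f t) (g t) (h t)
    have h2 := hF t ht
    have h3 := hG t ht
    have h4 := hH t ht
    gcongr
    refine h1.trans ?_
    gcongr

/-- The linear parts of the four factors together produce -iΦ, which cancels the denominator of the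
normal form multiplier and leaves the nonresonant term. The forcing parts give one term for each
slot. -/
theorem SeqSolution.normalForm_term_hasDerivAt (hα : 1 / 2 < α) (hα' : α ≤ 1) (hs : 1 / 2 < s)
    (h : SeqSolution σ α s I c) (hP : ∀ t ∈ I, P = 2 * ∑' j, ‖c t j‖ ^ 2) {t : ℝ} (ht : t ∈ I)
    (k : ℤ) (p : ℤ × ℤ) :
    HasDerivAt (fun τ => Complex.exp (Complex.I * ((-τ * shifted σ α P k : ℝ) : ℂ)) *
        triTerm (normalForm α) (c τ) (c τ) (c τ) k p)
      (Complex.exp (Complex.I * ((-t * shifted σ α P k : ℝ) : ℂ)) *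
        (-Complex.I * triTerm nonres (c t) (c t) (c t) k p +
          (triTerm (normalForm α) (forcing σ (c t)) (c t) (c t) k p +
          triTerm (normalForm α) (c t) (forcing σ (c t)) (c t) k p +
          triTerm (normalForm α) (c t) (c t) (forcing σ (c t)) k p))) t := by
  have hd : ∀ n, HasDerivAt (fun τ => c τ n)
      (Complex.I * (shifted σ α P n * c t n) + forcing σ (c t) n) t := fun n =>
    (h.hasDerivAt t ht n).congr_deriv (rhs_eq hs (h.wcont.1 t ht) (hP t ht) n)
  have h1 := hd (k - p.1)
  have h2 := (hd (k - p.1 - p.2)).star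
  have h3 := hd (k - p.2)
  have hprod := (hasDerivAt_exp_neg_I (shifted σ α P k) t).mul
    ((h1.mul (h2.mul h3)).const_mul (normalForm α k p))
  refine hprod.congr_deriv ?_
  have hres := resonance_mul_normalForm hα hα' k p
  rw [← shifted_resonance σ α P] at hres
  simp only [triTerm, Complex.star_def, map_add, map_mul, Complex.conj_I, Complex.conj_ofReal,
    Pi.mul_apply, ← hres]
  push_cast
  ring

/-- Differentiation by parts in time. The rotated solution has derivative given by the rotated
forcing, whose nonresonant part is σ times the corresponding part of the derivative of the trilinear
correction. The two cancel in the difference, leaving `remainder`. -/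
theorem SeqSolution.normalForm_identity (hα : 1 / 2 < α) (hα' : α ≤ 1) (hs : 1 / 2 < s)
    (h : SeqSolution σ α s I c) (hP : ∀ t ∈ I, P = 2 * ∑' j, ‖c t j‖ ^ 2) {t₀ t : ℝ}
    (ht₀ : t₀ ∈ I) (ht : t ∈ I) (k : ℤ) :
    rot (shifted σ α P) (-t) (c t - (σ : ℂ) • tri (normalForm α) (c t) (c t) (c t)) k -
      rot (shifted σ α P) (-t₀) (c t₀ - (σ : ℂ) • tri (normalForm α) (c t₀) (c t₀) (c t₀)) k =
      ∫ τ in t₀..t, rot (shifted σ α P) (-τ) (remainder σ α (c τ)) k := by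
  have hsub := h.uIcc_subset ht₀ ht
  have hx := h.wcont_forcing hs
  -- The target exponent s suffices here, as only absolute convergence at each fixed frequency is at
  -- stake. The gain of regularity is used later.
  obtain ⟨A, hA, hm⟩ := admissible_normalForm hα hα' (s := s) (q := s) (r := s) (by linarith)
    hs.le (by linarith)
  have hnr : Admissible s s s (3 ^ s) nonres :=
    admissible_of_norm_le_one (by linarith) s norm_nonres_le_one
  have hA3 := three_rpow_nonneg s
  have hu := h.wcont
  let e : ℝ → ℂ := fun τ => Complex.exp (Complex.I * ((-τ * shifted σ α P k : ℝ) : ℂ))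
  have he : Continuous e := by fun_prop
  have hen : ∀ τ, ‖e τ‖ₑ = 1 := fun τ => by
    rw [← ofReal_norm, norm_exp_I_mul, ENNReal.ofReal_one]
  have S := fun {f g h : ℤ → ℂ} (hf : wnorm s f < ∞) (hg : wnorm s g < ∞) (hh : wnorm s h < ∞) =>
    summable_triTerm hs le_rfl hA hm hf hg hh k
  have hvd : ∀ τ ∈ Set.uIcc t₀ t, HasDerivAt (fun τ => e τ * c τ k) (e τ * forcing σ (c τ) k) τ := by
    intro τ hτ
    have hd := (h.hasDerivAt τ (hsub hτ) k).congr_deriv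
      (rhs_eq hs (hu.1 τ (hsub hτ)) (hP τ (hsub hτ)) k)
    refine ((hasDerivAt_exp_neg_I (shifted σ α P k) τ).mul hd).congr_deriv ?_
    simp only [e]; ring
  have hvc : ContinuousOn (fun τ => e τ * forcing σ (c τ) k) (Set.uIcc t₀ t) :=
    he.continuousOn.mul ((hx.coeff k).mono hsub)
  have hv := intervalIntegral.integral_eq_sub_of_hasDerivAt hvd hvc.intervalIntegrable
  obtain ⟨C₀, hC₀, hb₀⟩ := etri_bounded hs le_rfl hA3 hnr hu hu hu hsub k
  obtain ⟨C₁, hC₁, hb₁⟩ := etri_bounded hs le_rfl hA hm hx hu hu hsub k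
  obtain ⟨C₂, hC₂, hb₂⟩ := etri_bounded hs le_rfl hA hm hu hx hu hsub k
  obtain ⟨C₃, hC₃, hb₃⟩ := etri_bounded hs le_rfl hA hm hu hu hx hsub k
  have hb := tsum_sub_tsum_eq_integral (C := C₀ + (C₁ + C₂ + C₃))
    (fun p τ hτ => h.normalForm_term_hasDerivAt hα hα' hs hP (hsub hτ) k p) (fun p => ?_)
    (by simp [hC₀, hC₁, hC₂, hC₃]) (fun τ hτ => ?_)
    ((S (hu.1 t₀ ht₀) (hu.1 t₀ ht₀) (hu.1 t₀ ht₀)).mul_left _)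
    ((S (hu.1 t ht) (hu.1 t ht) (hu.1 t ht)).mul_left _)
  · have hsum : ∀ τ ∈ Set.uIcc t₀ t, ∑' p, e τ *
        (-Complex.I * triTerm nonres (c τ) (c τ) (c τ) k p +
          (triTerm (normalForm α) (forcing σ (c τ)) (c τ) (c τ) k p +
          triTerm (normalForm α) (c τ) (forcing σ (c τ)) (c τ) k p +
          triTerm (normalForm α) (c τ) (c τ) (forcing σ (c τ)) k p)) =
        e τ * (-Complex.I * tri nonres (c τ) (c τ) (c τ) k +
          (tri (normalForm α) (forcing σ (c τ)) (c τ) (c τ) k +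
          tri (normalForm α) (c τ) (forcing σ (c τ)) (c τ) k +
          tri (normalForm α) (c τ) (c τ) (forcing σ (c τ)) k)) := by
      intro τ hτ
      have u1 := hu.1 τ (hsub hτ)
      have x1 := hx.1 τ (hsub hτ)
      have s0 : Summable (triTerm nonres (c τ) (c τ) (c τ) k) :=
        summable_triTerm hs le_rfl hA3 hnr u1 u1 u1 k
      simp only [tri]
      rw [tsum_mul_left, (s0.mul_left _).tsum_add (((S x1 u1 u1).add (S u1 x1 u1)).add
        (S u1 u1 x1)), ((S x1 u1 u1).add (S u1 x1 u1)).tsum_add (S u1 u1 x1),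
        (S x1 u1 u1).tsum_add (S u1 x1 u1), tsum_mul_left]
    rw [intervalIntegral.integral_congr hsum] at hb
    have hBc : ContinuousOn (fun τ => e τ * (-Complex.I * tri nonres (c τ) (c τ) (c τ) k +
          (tri (normalForm α) (forcing σ (c τ)) (c τ) (c τ) k +
          tri (normalForm α) (c τ) (forcing σ (c τ)) (c τ) k +
          tri (normalForm α) (c τ) (c τ) (forcing σ (c τ)) k))) (Set.uIcc t₀ t) := by
      have c0 := ((WCont.tri hs le_rfl hA3 hnr hu hu hu).coeff k).mono hsub
      have c1 := ((WCont.tri hs le_rfl hA hm hx hu hu).coeff k).mono hsub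
      have c2 := ((WCont.tri hs le_rfl hA hm hu hx hu).coeff k).mono hsub
      have c3 := ((WCont.tri hs le_rfl hA hm hu hu hx).coeff k).mono hsub
      exact he.continuousOn.mul ((continuousOn_const.mul c0).add ((c1.add c2).add c3))
    have hfin : ∀ τ, rot (shifted σ α P) (-τ)
        (c τ - (σ : ℂ) • tri (normalForm α) (c τ) (c τ) (c τ)) k =
        e τ * c τ k - σ * ∑' p, e τ * triTerm (normalForm α) (c τ) (c τ) (c τ) k p := fun τ => by
      rw [tsum_mul_left]
      simp only [rot, e, Pi.sub_apply, Pi.smul_apply, smul_eq_mul, tri]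
      ring
    rw [hfin, hfin]
    have hcomb : e t * c t k - σ * ∑' p, e t * triTerm (normalForm α) (c t) (c t) (c t) k p -
        (e t₀ * c t₀ k - σ * ∑' p, e t₀ * triTerm (normalForm α) (c t₀) (c t₀) (c t₀) k p) =
        (e t * c t k - e t₀ * c t₀ k) - σ *
        (∑' p, e t * triTerm (normalForm α) (c t) (c t) (c t) k p -
          ∑' p, e t₀ * triTerm (normalForm α) (c t₀) (c t₀) (c t₀) k p) := by ring
    rw [hcomb, hb, ← hv, ← intervalIntegral.integral_const_mul,
      ← intervalIntegral.integral_sub hvc.intervalIntegrable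
        (hBc.intervalIntegrable.const_mul (σ : ℂ))]
    refine intervalIntegral.integral_congr fun τ _ => ?_
    simp only [rot, remainder, forcing, e, Pi.sub_apply, Pi.add_apply, Pi.smul_apply, smul_eq_mul]
    ring
  · have t1 : ∀ {m : ℤ → ℤ × ℤ → ℂ} {f g h : ℝ → ℤ → ℂ}, WCont s I f → WCont s I g → WCont s I h →
        ContinuousOn (fun τ => triTerm m (f τ) (g τ) (h τ) k p) (Set.uIcc t₀ t) := by
      intro m f g h hf hg hh
      exact continuousOn_const.mul (((hf.coeff _).mono hsub).mul
        ((Complex.continuous_conj.comp_continuousOn ((hg.coeff _).mono hsub)).mul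
          ((hh.coeff _).mono hsub)))
    exact he.continuousOn.mul ((continuousOn_const.mul (t1 hu hu hu)).add
      (((t1 hx hu hu).add (t1 hu hx hu)).add (t1 hu hu hx)))
  · refine le_trans ?_ (add_le_add (hb₀ τ hτ) (add_le_add (add_le_add (hb₁ τ hτ) (hb₂ τ hτ))
      (hb₃ τ hτ)))
    simp only [etri]
    rw [← ENNReal.tsum_add, ← ENNReal.tsum_add, ← ENNReal.tsum_add]
    refine ENNReal.tsum_le_tsum fun p => ?_
    rw [enorm_mul]
    change ‖e τ‖ₑ * _ ≤ _
    rw [hen, one_mul]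
    refine (enorm_add_le _ _).trans (add_le_add (le_of_eq ?_) ((enorm_add_le _ _).trans
      (add_le_add (enorm_add_le _ _) le_rfl)))
    rw [enorm_mul, enorm_neg, enorm_I, one_mul]

end NormalForm

/-! ### Smoothing -/

section Smoothing

variable {σ α s P r : ℝ} {I : Set ℝ} {c : ℝ → ℤ → ℂ}

/-- The transformed solution minus its initial value. -/
def profile (σ α P : ℝ) (c : ℝ → ℤ → ℂ) (t : ℝ) : ℤ → ℂ :=
  rot (shifted σ α P) (-t) (c t - (σ : ℂ) • tri (normalForm α) (c t) (c t) (c t)) -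
    rot (shifted σ α P) (-0) (c 0 - (σ : ℂ) • tri (normalForm α) (c 0) (c 0) (c 0))

theorem rot_neg_difference (σ α P : ℝ) (c : ℝ → ℤ → ℂ) (t : ℝ) :
    rot (shifted σ α P) (-t) (c t - rot (shifted σ α P) t (c 0)) =
      profile σ α P c t + rot (shifted σ α P) (-t)
        ((σ : ℂ) • tri (normalForm α) (c t) (c t) (c t)) -
          (σ : ℂ) • tri (normalForm α) (c 0) (c 0) (c 0) := by
  have h0 : ∀ d : ℤ → ℂ, rot (shifted σ α P) (-0) d = d := fun d => by ext k; simp [rot]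
  have h1 : rot (shifted σ α P) (-t) (rot (shifted σ α P) t (c 0)) = c 0 := by
    have := rot_rot_neg (shifted σ α P) (-t) (c 0)
    rwa [neg_neg] at this
  rw [profile, h0, rot_sub, rot_sub, h1]
  abel

theorem difference_eq (σ α P : ℝ) (c : ℝ → ℤ → ℂ) (t : ℝ) :
    c t - rot (shifted σ α P) t (c 0) = rot (shifted σ α P) t
      (profile σ α P c t + rot (shifted σ α P) (-t)
        ((σ : ℂ) • tri (normalForm α) (c t) (c t) (c t)) -
          (σ : ℂ) • tri (normalForm α) (c 0) (c 0) (c 0)) := by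
  rw [← rot_neg_difference, rot_rot_neg]

/-- The majorant G is left free. For continuity it is the norm of the remainder itself, and for the
quantitative bound it is the explicit expression in the H^s and H^q norms. -/
theorem SeqSolution.wnorm_profile_sub_le (hα : 1 / 2 < α) (hα' : α ≤ 1) (hs : 1 / 2 < s)
    (h : SeqSolution σ α s I c) (hP : ∀ t ∈ I, P = 2 * ∑' j, ‖c t j‖ ^ 2)
    {t₀ t : ℝ} (ht₀ : t₀ ∈ I) (ht : t ∈ I) {G : ℝ → ℝ} (hG : ContinuousOn G I)
    (hG0 : ∀ τ ∈ I, 0 ≤ G τ)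
    (hGr : ∀ τ ∈ I, wnorm r (remainder σ α (c τ)) ≤ ENNReal.ofReal (G τ)) :
    wnorm r (profile σ α P c t - profile σ α P c t₀) ≤ ENNReal.ofReal |∫ τ in t₀..t, G τ| := by
  have hsub := h.uIcc_subset ht₀ ht
  have e : profile σ α P c t - profile σ α P c t₀ =
      fun k => ∫ τ in t₀..t, rot (shifted σ α P) (-τ) (remainder σ α (c τ)) k := by
    ext k
    rw [← h.normalForm_identity hα hα' hs hP ht₀ ht k]
    simp only [profile, Pi.sub_apply]
    ring
  rw [e]
  refine wnorm_integral_le (hG.mono hsub) (fun τ hτ => hG0 τ (hsub hτ)) fun τ hτ => ?_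
  rw [wnorm_rot]
  exact hGr τ (hsub hτ)

theorem profile_zero (σ α P : ℝ) (c : ℝ → ℤ → ℂ) : profile σ α P c 0 = 0 := sub_self _

theorem tendsto_abs_integral {I : Set ℝ} (hI : IsOpen I) {G : ℝ → ℝ} (hG : ContinuousOn G I)
    {t₀ : ℝ} (ht₀ : t₀ ∈ I) :
    Tendsto (fun t => ENNReal.ofReal |∫ τ in t₀..t, G τ|) (𝓝 t₀) (𝓝 0) := by
  have h1 := intervalIntegral.integral_hasDerivAt_right (a := t₀) (b := t₀) (f := G) (by simp)
    (hG.stronglyMeasurableAtFilter hI t₀ ht₀) (hG.continuousAt (hI.mem_nhds ht₀))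
  have h2 := ENNReal.tendsto_ofReal h1.continuousAt.abs.tendsto
  simpa using h2

theorem SeqSolution.wcont_profile (hα : 1 / 2 < α) (hα' : α ≤ 1) (hs : 1 / 2 < s)
    (hr : r ≤ s + (2 * α - 1)) (h : SeqSolution σ α s I c) (h0 : (0 : ℝ) ∈ I)
    (hP : ∀ t ∈ I, P = 2 * ∑' j, ‖c t j‖ ^ 2) : WCont r I (profile σ α P c) := by
  have hR := h.wcont_remainder hα hα' hs hr
  have key := fun {t₀ t : ℝ} (ht₀ : t₀ ∈ I) (ht : t ∈ I) =>
    h.wnorm_profile_sub_le hα hα' hs hP ht₀ ht hR.norm (fun _ _ => ENNReal.toReal_nonneg)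
      (fun τ hτ => (ENNReal.ofReal_toReal (hR.1 τ hτ).ne).ge)
  refine ⟨fun t ht => ?_, fun t₀ ht₀ => ?_⟩
  · have := key h0 ht
    rw [profile_zero, sub_zero] at this
    exact this.trans_lt ENNReal.ofReal_lt_top
  · refine WCont.tendsto_of_le
      ((tendsto_abs_integral h.isOpen hR.norm ht₀).mono_left nhdsWithin_le_nhds) ?_
    filter_upwards [self_mem_nhdsWithin] with t ht
    exact key ht₀ ht

/-- By `difference_eq` the difference is a rotation of the profile and of two trilinear boundary
terms, all of which are continuous in the smoother space although c itself need not take values in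
it. -/
theorem SeqSolution.wcont_difference (hα : 1 / 2 < α) (hα' : α ≤ 1) (hs : 1 / 2 < s)
    (hr : r ≤ s + (2 * α - 1)) (h : SeqSolution σ α s I c) (h0 : (0 : ℝ) ∈ I)
    (hP : ∀ t ∈ I, P = 2 * ∑' j, ‖c t j‖ ^ 2) :
    WCont r I (fun t => c t - rot (shifted σ α P) t (c 0)) := by
  have hB := SeqSolution.wcont_normalForm hα hα' hs hr h.wcont h.wcont h.wcont
  have h1 := (((h.wcont_profile hα hα' hs hr h0 hP).add ((hB.smul (σ : ℂ)).rot_neg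
    (shifted σ α P))).sub (WCont.const ((hB.smul (σ : ℂ)).1 0 h0))).rot (shifted σ α P)
  exact h1.congr fun t _ => difference_eq σ α P c t

theorem smoothing_estimate {q : ℝ} (hα : 1 / 2 < α) (hα' : α ≤ 1) (hq : 1 / 2 < q)
    (hqs : q ≤ s) (hr : r ≤ s + (2 * α - 1)) :
    ∃ C : ℝ, 0 < C ∧ ∀ (σ : ℝ) (I : Set ℝ) (c : ℝ → ℤ → ℂ) (P : ℝ), σ = 1 ∨ σ = -1 →
      SeqSolution σ α s I c → (0 : ℝ) ∈ I → (∀ t ∈ I, P = 2 * ∑' j, ‖c t j‖ ^ 2) → ∀ t ∈ I,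
      (wnorm r (c t - rot (shifted σ α P) t (c 0))).toReal ≤
        C * ((wnorm s (c 0)).toReal * (wnorm q (c 0)).toReal ^ 2 +
          (wnorm s (c t)).toReal * (wnorm q (c t)).toReal ^ 2 +
          |∫ τ in (0 : ℝ)..t, (wnorm s (c τ)).toReal *
            ((wnorm q (c τ)).toReal ^ 2 + (wnorm q (c τ)).toReal ^ 4)|) := by
  obtain ⟨D, hD, hrem⟩ := wnorm_remainder_le hα hα' hq hqs hr
  obtain ⟨A, hA, hm⟩ := admissible_normalForm hα hα' (s := s) (q := q) (r := r) (by linarith)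
    hq.le hr
  have hT := triConst_lt_top hq A
  -- One constant for the remainder (D) and for the boundary terms (three times the trilinear
  -- constant). The summand 1 keeps it positive.
  set C : ℝ := D.toReal + 3 * (triConst q A).toReal + 1 with hC
  have hD0 : 0 ≤ D.toReal := ENNReal.toReal_nonneg
  have hT0 : 0 ≤ (triConst q A).toReal := ENNReal.toReal_nonneg
  refine ⟨C, by positivity, fun σ I c P hσ h h0 hP t ht => ?_⟩
  have hs : 1 / 2 < s := hq.trans_le hqs
  have hcq : WCont q I c := h.wcont.mono_exp hqs
  let ns : ℝ → ℝ := fun τ => (wnorm s (c τ)).toReal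
  let nq : ℝ → ℝ := fun τ => (wnorm q (c τ)).toReal
  have hns : ∀ τ ∈ I, wnorm s (c τ) = ENNReal.ofReal (ns τ) := fun τ hτ =>
    (ENNReal.ofReal_toReal (h.wcont.1 τ hτ).ne).symm
  have hnq : ∀ τ ∈ I, wnorm q (c τ) = ENNReal.ofReal (nq τ) := fun τ hτ =>
    (ENNReal.ofReal_toReal (hcq.1 τ hτ).ne).symm
  have ns0 : ∀ τ, 0 ≤ ns τ := fun τ => ENNReal.toReal_nonneg
  have nq0 : ∀ τ, 0 ≤ nq τ := fun τ => ENNReal.toReal_nonneg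
  have hB : ∀ τ ∈ I, wnorm r ((σ : ℂ) • tri (normalForm α) (c τ) (c τ) (c τ)) ≤
      ENNReal.ofReal (C * (ns τ * nq τ ^ 2)) := fun τ hτ => by
    rw [wnorm_smul, enorm_sign hσ, one_mul]
    refine (wnorm_tri_le hA hm _ _ _).trans ?_
    rw [mixedNorm_self, hns τ hτ, hnq τ hτ, ← ENNReal.ofReal_toReal hT.ne,
      ← ENNReal.ofReal_pow (nq0 τ), ← ENNReal.ofReal_mul (ns0 τ),
      show (3 : ℝ≥0∞) = ENNReal.ofReal 3 by simp, ← ENNReal.ofReal_mul (by norm_num),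
      ← ENNReal.ofReal_mul hT0]
    refine ENNReal.ofReal_le_ofReal ?_
    have : 0 ≤ ns τ * nq τ ^ 2 := mul_nonneg (ns0 τ) (by positivity)
    rw [hC]; nlinarith
  let G : ℝ → ℝ := fun τ => C * (ns τ * (nq τ ^ 2 + nq τ ^ 4))
  have hGr : ∀ τ ∈ I, wnorm r (remainder σ α (c τ)) ≤ ENNReal.ofReal (G τ) := fun τ hτ => by
    refine (hrem σ hσ (c τ)).trans ?_
    rw [hns τ hτ, hnq τ hτ, ← ENNReal.ofReal_toReal hD.ne, ← ENNReal.ofReal_pow (nq0 τ),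
      ← ENNReal.ofReal_pow (nq0 τ), ← ENNReal.ofReal_add (by positivity) (by positivity),
      ← ENNReal.ofReal_mul (ns0 τ), ← ENNReal.ofReal_mul hD0]
    refine ENNReal.ofReal_le_ofReal ?_
    have : 0 ≤ ns τ * (nq τ ^ 2 + nq τ ^ 4) := mul_nonneg (ns0 τ) (by positivity)
    simp only [G]
    rw [hC]; nlinarith
  have hG : ContinuousOn G I :=
    continuousOn_const.mul (h.wcont.norm.mul ((hcq.norm.pow 2).add (hcq.norm.pow 4)))
  have hG0 : ∀ τ ∈ I, 0 ≤ G τ := fun τ _ =>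
    mul_nonneg (by positivity) (mul_nonneg (ns0 τ) (by positivity))
  have hprof := h.wnorm_profile_sub_le hα hα' hs hP h0 ht hG hG0 hGr
  rw [profile_zero, sub_zero] at hprof
  have hGint : |∫ τ in (0 : ℝ)..t, G τ| =
      C * |∫ τ in (0 : ℝ)..t, ns τ * (nq τ ^ 2 + nq τ ^ 4)| := by
    rw [intervalIntegral.integral_const_mul, abs_mul, abs_of_nonneg (by positivity)]
  refine ENNReal.toReal_le_of_le_ofReal (by have := ns0; have := nq0; positivity) ?_
  have hrot : wnorm r (c t - rot (shifted σ α P) t (c 0)) =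
      wnorm r (rot (shifted σ α P) (-t) (c t - rot (shifted σ α P) t (c 0))) := by
    rw [wnorm_rot]
  rw [hrot, rot_neg_difference]
  have hBt := (wnorm_rot r (shifted σ α P) (-t)
    ((σ : ℂ) • tri (normalForm α) (c t) (c t) (c t))).le.trans (hB t ht)
  refine (wnorm_sub_le _ _ _).trans ((add_le_add ((wnorm_add_le _ _ _).trans (add_le_add hprof
    hBt)) (hB 0 h0)).trans ?_)
  · have p1 : 0 ≤ C * (ns t * nq t ^ 2) :=
      mul_nonneg (by positivity) (mul_nonneg (ns0 t) (by positivity))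
    have p2 : 0 ≤ C * (ns 0 * nq 0 ^ 2) :=
      mul_nonneg (by positivity) (mul_nonneg (ns0 0) (by positivity))
    rw [← ENNReal.ofReal_add (abs_nonneg _) p1, ← ENNReal.ofReal_add (by positivity) p2, hGint]
    refine ENNReal.ofReal_le_ofReal (le_of_eq ?_)
    simp only [ns, nq]
    ring

/-! ### Smoothing for solutions in L²(𝕋) -/

theorem coeff_phasedFlow (σ α t : ℝ) (f : L2) :
    coeff (phasedFlow σ α t f) = rot (shifted σ α (phase f)) t (coeff f) := by
  ext k
  rw [phasedFlow, coeff_smul, Pi.smul_apply, coeff_freeFlow, smul_eq_mul, ← mul_assoc,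
    ← Complex.exp_add, rot, shifted]
  congr 2
  push_cast
  ring

/-- Conservation of mass makes the resonant frequency shift constant in time. This is why the phase
correction is linear in t and can be read off from the initial datum. -/
theorem IsSolution.phase_eq_tsum {u₀ : L2} {u : ℝ → L2} (hs : 1 / 2 < s)
    (h : IsSolution σ α s u₀ I u) {t : ℝ} (ht : t ∈ I) :
    phase u₀ = 2 * ∑' j, ‖coeff (u t) j‖ ^ 2 := by
  rw [phase_eq, (h.seqSolution hs).mass_eq hs h.zero_mem ht, h.initial]

theorem IsSolution.coeff_difference {u₀ : L2} {u : ℝ → L2} (h : IsSolution σ α s u₀ I u) (t : ℝ) :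
    coeff (u t - phasedFlow σ α t u₀) =
      coeff (u t) - rot (shifted σ α (phase u₀)) t (coeff (u 0)) := by
  rw [coeff_sub, coeff_phasedFlow, h.initial]

theorem IsSolution.continuousInSobolev_difference {u₀ : L2} {u : ℝ → L2} (hα : 1 / 2 < α)
    (hα' : α ≤ 1) (hs : 1 / 2 < s) (hr : r ≤ s + (2 * α - 1)) (h : IsSolution σ α s u₀ I u) :
    ContinuousInSobolev r I (fun t => u t - phasedFlow σ α t u₀) := by
  rw [continuousInSobolev_iff]
  refine ((h.seqSolution hs).wcont_difference hα hα' hs hr h.zero_mem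
    fun t ht => h.phase_eq_tsum hs ht).congr fun t _ => ?_
  exact h.coeff_difference t

theorem exists_smoothing_bound {q : ℝ} (hα : 1 / 2 < α) (hα' : α ≤ 1) (hq : 1 / 2 < q)
    (hqs : q ≤ s) (hr : r ≤ s + (2 * α - 1)) :
    ∃ C : ℝ, 0 < C ∧ ∀ σ : ℝ, σ = 1 ∨ σ = -1 → ∀ (u₀ : L2) (I : Set ℝ) (u : ℝ → L2),
      IsSolution σ α s u₀ I u → ∀ t ∈ I,
      sobolevNorm r (u t - phasedFlow σ α t u₀) ≤
        C * (sobolevNorm s u₀ * sobolevNorm q u₀ ^ 2 + sobolevNorm s (u t) * sobolevNorm q (u t) ^ 2 +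
          |∫ τ in (0 : ℝ)..t, sobolevNorm s (u τ) *
            (sobolevNorm q (u τ) ^ 2 + sobolevNorm q (u τ) ^ 4)|) := by
  obtain ⟨C, hC, H⟩ := smoothing_estimate hα hα' hq hqs hr
  refine ⟨C, hC, fun σ hσ u₀ I u h t ht => ?_⟩
  have hs := hq.trans_le hqs
  have := H σ I (fun t => coeff (u t)) (phase u₀) hσ (h.seqSolution hs) h.zero_mem
    (fun t ht => h.phase_eq_tsum hs ht) t ht
  simp only [sobolevNorm_eq]
  rw [h.coeff_difference t, ← h.initial]
  simpa only [h.initial] using this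

end Smoothing

/-! ### Conservation of energy -/

theorem symbol_nonneg (α : ℝ) (k : ℤ) : 0 ≤ symbol α k := Real.rpow_nonneg (abs_nonneg _) _

theorem symbol_le_bracket {α : ℝ} (hα : 0 ≤ α) (k : ℤ) : symbol α k ≤ bracket k ^ (2 * α) :=
  Real.rpow_le_rpow (abs_nonneg _) (abs_le_bracket k) (by linarith)

/-- Subadditivity of x ↦ x^α for 0 ≤ α ≤ 1. Mass and kinetic energy together thus control the H^α
norm with constant 1. -/
theorem bracket_rpow_le_one_add_symbol {α : ℝ} (hα : 0 ≤ α) (hα' : α ≤ 1) (k : ℤ) :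
    bracket k ^ (2 * α) ≤ 1 + symbol α k := by
  have h1 : bracket k ^ (2 * α) = (1 + (k : ℝ) ^ 2) ^ α := by
    rw [Real.rpow_mul (bracket_pos k).le, Real.rpow_two, bracket_sq]
  have h2 : symbol α k = ((k : ℝ) ^ 2) ^ α := by
    rw [symbol, Real.rpow_mul (abs_nonneg _), Real.rpow_two, sq_abs]
  rw [h1, h2]
  have := Real.rpow_add_le_add_rpow (zero_le_one) (sq_nonneg (k : ℝ)) hα hα'
  rwa [Real.one_rpow] at this

section Energy

variable {σ α s : ℝ} {I : Set ℝ} {c : ℝ → ℤ → ℂ}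

theorem SeqSolution.mono_exp {r : ℝ} (hr : r ≤ s) (h : SeqSolution σ α s I c) :
    SeqSolution σ α r I c :=
  ⟨h.isOpen, h.ordConnected, h.wcont.mono_exp hr, h.hasDerivAt⟩

/-- The dispersive part takes H^α to H^{-α}, and this is the exact regularity with which the time
derivative can be paired in the quartic form. -/
theorem wnorm_rhs_le (hα : 0 ≤ α) (σ : ℝ) (c : ℤ → ℂ) :
    wnorm (-α) (rhs σ α c) ≤ wnorm α c + ‖(σ : ℂ)‖ₑ * wnorm α (cubicSeq c) := by
  have e : rhs σ α c = (fun k => Complex.I * (symbol α k * c k)) -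
      (Complex.I * σ) • cubicSeq c := by
    ext k; simp only [rhs, Pi.sub_apply, Pi.smul_apply, smul_eq_mul]; ring
  rw [e]
  refine (wnorm_sub_le _ _ _).trans (add_le_add (l2e_mono fun k => ?_) ?_)
  · rw [enorm_mul, enorm_mul, enorm_I, one_mul, ← mul_assoc]
    refine mul_le_mul_left ?_ _
    rw [← ofReal_norm, Complex.norm_real, Real.norm_of_nonneg (symbol_nonneg α k),
      ← ENNReal.ofReal_mul (bracket_rpow_pos k _).le]
    refine ENNReal.ofReal_le_ofReal ?_
    calc bracket k ^ (-α) * symbol α k ≤ bracket k ^ (-α) * bracket k ^ (2 * α) :=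
          mul_le_mul_of_nonneg_left (symbol_le_bracket hα k) (bracket_rpow_pos k _).le
      _ = bracket k ^ α := by rw [← Real.rpow_add (bracket_pos k)]; congr 1; ring
  · rw [wnorm_smul, enorm_mul, enorm_I, one_mul]
    exact mul_le_mul_right (wnorm_mono_exp (by linarith) _) _

theorem q4Term_hasDerivAt {c : ℝ → ℤ → ℂ} {y : ℤ → ℂ} {t : ℝ}
    (h : ∀ k, HasDerivAt (fun τ => c τ k) (y k) t) (x : ℤ × (ℤ × ℤ)) :
    HasDerivAt (fun τ => q4Term (c τ) (c τ) (c τ) (c τ) x)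
      (q4Term y (c t) (c t) (c t) x + q4Term (c t) y (c t) (c t) x +
        (q4Term (c t) (c t) y (c t) x + q4Term (c t) (c t) (c t) y x)) t := by
  have h0 := (h x.1).star
  have h1 := h (x.1 - x.2.1)
  have h2 := (h (x.1 - x.2.1 - x.2.2)).star
  have h3 := h (x.1 - x.2.2)
  refine (h0.mul ((h1.mul (h2.mul h3)).const_mul 1)).congr_deriv ?_
  simp only [q4Term, triTerm, Complex.star_def, Pi.mul_apply]
  ring

/-- The symmetries of the form identify the derivatives in the two barred slots with each other, and
those in the two unbarred slots with their conjugates. -/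
theorem hasSum_q4_deriv {σ α : ℝ} {c : ℤ → ℂ} (H : eq4 (rhs σ α c) c c c < ∞) :
    HasSum (fun x => q4Term (rhs σ α c) c c c x + q4Term c (rhs σ α c) c c x +
        (q4Term c c (rhs σ α c) c x + q4Term c c c (rhs σ α c) x))
      (2 * (q4 (rhs σ α c) c c c + conj (q4 (rhs σ α c) c c c))) := by
  have H1 : eq4 c (rhs σ α c) c c < ∞ := by rwa [eq4_swap₀₁]
  have H2 : eq4 c c (rhs σ α c) c < ∞ := by rwa [eq4_swap₀₂]
  have H3 : eq4 c c c (rhs σ α c) < ∞ := by rwa [eq4_swap₁₃]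
  have h := ((summable_q4Term H).hasSum.add (summable_q4Term H1).hasSum).add
    ((summable_q4Term H2).hasSum.add (summable_q4Term H3).hasSum)
  convert h using 1
  change _ = q4 _ _ _ _ + q4 _ _ _ _ + (q4 _ _ _ _ + q4 _ _ _ _)
  rw [q4_swap₀₂ (rhs σ α c) c c c, q4_swap₁₃ c (rhs σ α c) c c, conj_q4]
  ring

/-- With N = `cubicSeq c`, the product conj(`rhs`) N contains iσ|N|², which is imaginary and
disappears on adding the conjugate. What remains is the rate of change of the kinetic energy. -/
theorem tsum_q4_deriv {σ α : ℝ} {c : ℤ → ℂ} (H : eq4 (rhs σ α c) c c c < ∞) :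
    ∑' k, (symbol α k : ℂ) * (-(Complex.I * σ) *
        (conj (c k) * cubicSeq c k - conj (conj (c k) * cubicSeq c k))) =
      (σ / 2 : ℂ) * ∑' x, (q4Term (rhs σ α c) c c c x + q4Term c (rhs σ α c) c c x +
        (q4Term c c (rhs σ α c) c x + q4Term c c c (rhs σ α c) x)) := by
  rw [(hasSum_q4_deriv H).tsum_eq]
  have h1 := hasSum_q4 H
  have h2 := ((h1.add (Complex.hasSum_conj'.2 h1)).mul_left 2).mul_left (σ / 2 : ℂ)
  rw [← h2.tsum_eq]
  refine tsum_congr fun k => ?_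
  change _ = (σ / 2 : ℂ) * (2 * (conj (rhs σ α c k) * cubicSeq c k +
    conj (conj (rhs σ α c k) * cubicSeq c k)))
  simp only [rhs, map_sub, map_mul, map_neg, Complex.conj_I, Complex.conj_ofReal,
    Complex.conj_conj]
  ring

/-- Conservation of energy. -/
theorem SeqSolution.energy_identity (hα : 1 / 2 < α) (h : SeqSolution σ α α I c) {t₀ t : ℝ}
    (ht₀ : t₀ ∈ I) (ht : t ∈ I) :
    ∑' k, (symbol α k : ℂ) * (c t k * conj (c t k)) -
      ∑' k, (symbol α k : ℂ) * (c t₀ k * conj (c t₀ k)) =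
      (σ / 2 : ℂ) * (q4 (c t) (c t) (c t) (c t) - q4 (c t₀) (c t₀) (c t₀) (c t₀)) := by
  have hsub := h.uIcc_subset ht₀ ht
  have hN := h.wcont_cubicSeq hα
  obtain ⟨K, hK0, hK⟩ := h.wcont.bounded_on_uIcc hsub
  obtain ⟨K', hK0', hK'⟩ := hN.bounded_on_uIcc hsub
  set B : ℝ≥0∞ := (ENNReal.ofReal K + ‖(σ : ℂ)‖ₑ * ENNReal.ofReal K') * (triConst α (3 ^ α) *
    (3 * (ENNReal.ofReal K * (ENNReal.ofReal K * ENNReal.ofReal K)))) with hB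
  have hBt : B < ∞ := by
    refine ENNReal.mul_lt_top (ENNReal.add_lt_top.2 ⟨ENNReal.ofReal_lt_top,
      ENNReal.mul_lt_top enorm_lt_top ENNReal.ofReal_lt_top⟩)
      (ENNReal.mul_lt_top (triConst_lt_top hα _) (ENNReal.mul_lt_top (by norm_num) ?_))
    exact ENNReal.mul_lt_top ENNReal.ofReal_lt_top
      (ENNReal.mul_lt_top ENNReal.ofReal_lt_top ENNReal.ofReal_lt_top)
  have hE : ∀ τ ∈ Set.uIcc t₀ t, eq4 (rhs σ α (c τ)) (c τ) (c τ) (c τ) ≤ B := fun τ hτ => by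
    refine (eq4_le (r := α) (q := α) (by linarith) _ _ _ _).trans ?_
    have h1 := wnorm_rhs_le (by linarith : 0 ≤ α) σ (c τ)
    have h2 := mixedNorm_le (le_refl α) (c τ) (c τ) (c τ)
    have h3 := hK τ hτ
    have h4 := hK' τ hτ
    refine mul_le_mul' (h1.trans ?_) (mul_le_mul_right (h2.trans ?_) _)
    · gcongr
    · gcongr
  -- The factor 4 counts the slots on which the derivative can fall; by symmetry each contribution
  -- is bounded by B.
  have hQ := tsum_sub_tsum_eq_integral (C := 4 * B)
    (fun x τ hτ => q4Term_hasDerivAt (h.hasDerivAt τ (hsub hτ)) x) (fun x => ?_)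
    (ENNReal.mul_lt_top (by norm_num) hBt) (fun τ hτ => ?_)
    (summable_q4Term (eq4_lt_top hα (h.wcont.1 t₀ ht₀)))
    (summable_q4Term (eq4_lt_top hα (h.wcont.1 t ht)))
  · have hb := h.weighted_balance hα le_rfl (w := symbol α) (fun k => by
      rw [abs_of_nonneg (symbol_nonneg α k)]
      exact symbol_le_bracket (by linarith) k) ht₀ ht
    rw [hb, q4, q4, hQ, ← intervalIntegral.integral_const_mul]
    exact intervalIntegral.integral_congr fun τ hτ => tsum_q4_deriv ((hE τ hτ).trans_lt hBt)
  · have hc : ∀ n, ContinuousOn (fun τ => c τ n) (Set.uIcc t₀ t) := fun n =>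
      (h.wcont.coeff n).mono hsub
    have hy : ∀ n, ContinuousOn (fun τ => rhs σ α (c τ) n) (Set.uIcc t₀ t) := fun n =>
      (continuousOn_const.mul (continuousOn_const.mul (hc n))).sub
        (continuousOn_const.mul (continuousOn_const.mul ((hN.coeff n).mono hsub)))
    have t1 : ∀ {a f g h : ℝ → ℤ → ℂ}, (∀ n, ContinuousOn (fun τ => a τ n) (Set.uIcc t₀ t)) →
        (∀ n, ContinuousOn (fun τ => f τ n) (Set.uIcc t₀ t)) →
        (∀ n, ContinuousOn (fun τ => g τ n) (Set.uIcc t₀ t)) →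
        (∀ n, ContinuousOn (fun τ => h τ n) (Set.uIcc t₀ t)) →
        ContinuousOn (fun τ => q4Term (a τ) (f τ) (g τ) (h τ) x) (Set.uIcc t₀ t) := by
      intro a f g h ha hf hg hh
      exact (Complex.continuous_conj.comp_continuousOn (ha _)).mul (continuousOn_const.mul
        ((hf _).mul ((Complex.continuous_conj.comp_continuousOn (hg _)).mul (hh _))))
    exact ((t1 hy hc hc hc).add (t1 hc hy hc hc)).add ((t1 hc hc hy hc).add (t1 hc hc hc hy))
  · have H := hE τ hτ
    have H1 : eq4 (c τ) (rhs σ α (c τ)) (c τ) (c τ) ≤ B := by rwa [eq4_swap₀₁]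
    have H2 : eq4 (c τ) (c τ) (rhs σ α (c τ)) (c τ) ≤ B := by rwa [eq4_swap₀₂]
    have H3 : eq4 (c τ) (c τ) (c τ) (rhs σ α (c τ)) ≤ B := by rwa [eq4_swap₁₃]
    calc _ ≤ eq4 (rhs σ α (c τ)) (c τ) (c τ) (c τ) + eq4 (c τ) (rhs σ α (c τ)) (c τ) (c τ) +
          (eq4 (c τ) (c τ) (rhs σ α (c τ)) (c τ) + eq4 (c τ) (c τ) (c τ) (rhs σ α (c τ))) := by
          simp only [eq4]
          rw [← ENNReal.tsum_add, ← ENNReal.tsum_add, ← ENNReal.tsum_add]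
          exact ENNReal.tsum_le_tsum fun x => (enorm_add_le _ _).trans
            (add_le_add (enorm_add_le _ _) (enorm_add_le _ _))
      _ ≤ B + B + (B + B) := add_le_add (add_le_add H H1) (add_le_add H2 H3)
      _ = 4 * B := by ring

end Energy

/-! ### A priori bounds -/

theorem toReal_wnorm_sq (r : ℝ) (c : ℤ → ℂ) :
    (wnorm r c).toReal ^ 2 = ∑' k : ℤ, bracket k ^ (2 * r) * ‖c k‖ ^ 2 := by
  rw [← sqrt_tsum_eq_wnorm, Real.sq_sqrt (tsum_nonneg fun k => weight_nonneg r k _)]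

/-- The two regimes are split at b = δ^{-1/(2α-2q)}: beyond it δ x^{2α} already dominates, and below
it x^{2q} is at most b^{2q}. -/
theorem rpow_interpolation {q α δ : ℝ} (hq : 0 ≤ q) (hqα : q < α) (hδ : 0 < δ) :
    ∃ B : ℝ, 0 ≤ B ∧ ∀ x : ℝ, 1 ≤ x → x ^ (2 * q) ≤ δ * x ^ (2 * α) + B := by
  set b : ℝ := δ⁻¹ ^ (2 * α - 2 * q)⁻¹ with hb
  have hb0 : 0 ≤ b := by positivity
  refine ⟨b ^ (2 * q), by positivity, fun x hx => ?_⟩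
  have hx0 : 0 < x := by linarith
  rcases le_total x b with h | h
  · have := Real.rpow_le_rpow hx0.le h (by linarith : 0 ≤ 2 * q)
    have : 0 ≤ δ * x ^ (2 * α) := by positivity
    linarith
  · have h1 : δ⁻¹ ≤ x ^ (2 * α - 2 * q) := by
      have h2 := Real.rpow_le_rpow hb0 h (by linarith : 0 ≤ 2 * α - 2 * q)
      rwa [hb, ← Real.rpow_mul (by positivity), inv_mul_cancel₀ (by linarith), Real.rpow_one] at h2
    have h3 : x ^ (2 * α) = x ^ (2 * α - 2 * q) * x ^ (2 * q) := by
      rw [← Real.rpow_add hx0]; congr 1; ring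
    have h4 : 1 ≤ δ * x ^ (2 * α - 2 * q) := by
      rw [inv_le_iff_one_le_mul₀' hδ] at h1; exact h1
    have h5 : 0 ≤ x ^ (2 * q) := by positivity
    have h6 : 0 ≤ b ^ (2 * q) := by positivity
    rw [h3]
    nlinarith

theorem wnorm_interpolation {q α δ : ℝ} (hq : 0 ≤ q) (hqα : q < α) (hδ : 0 < δ) :
    ∃ B : ℝ, 0 ≤ B ∧ ∀ c : ℤ → ℂ, wnorm α c < ∞ →
      (wnorm q c).toReal ^ 2 ≤ δ * (wnorm α c).toReal ^ 2 + B * ∑' k, ‖c k‖ ^ 2 := by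
  obtain ⟨B, hB, H⟩ := rpow_interpolation hq hqα hδ
  refine ⟨B, hB, fun c hc => ?_⟩
  have s1 := (summable_iff_wnorm_lt_top α c).2 hc
  have s2 := (summable_iff_wnorm_lt_top q c).2 ((wnorm_mono_exp hqα.le c).trans_lt hc)
  have s3 : Summable fun k => ‖c k‖ ^ 2 := by
    have := (summable_iff_wnorm_lt_top 0 c).2
      ((wnorm_mono_exp (hq.trans hqα.le) c).trans_lt hc)
    simpa using this
  rw [toReal_wnorm_sq, toReal_wnorm_sq, ← tsum_mul_left, ← tsum_mul_left,
    ← (s1.mul_left δ).tsum_add (s3.mul_left B)]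
  refine s2.tsum_le_tsum (fun k => ?_) ((s1.mul_left δ).add (s3.mul_left B))
  have := H (bracket k) (one_le_bracket k)
  have h2 := mul_le_mul_of_nonneg_right this (sq_nonneg ‖c k‖)
  linarith

/-- Duality at regularity 0 puts two factors in L², so only two powers of the H^q norm appear. This
leaves room to absorb the quartic form into the energy. -/
theorem norm_q4_self_le {q : ℝ} (hq : 1 / 2 < q) {c : ℤ → ℂ} (hc : wnorm q c < ∞) :
    ‖q4 c c c c‖ ≤ 3 * (triConst q 1).toReal *
      ((∑' k, ‖c k‖ ^ 2) * (wnorm q c).toReal ^ 2) := by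
  have h0 : (wnorm 0 c).toReal ^ 2 = ∑' k, ‖c k‖ ^ 2 := by
    rw [toReal_wnorm_sq]; simp
  have h1 : ‖q4 c c c c‖ₑ ≤ wnorm 0 c * (triConst q 1 * (3 * (wnorm 0 c * wnorm q c ^ 2))) := by
    have e1 := eq4_le (r := 0) (q := q) le_rfl c c c c
    rw [neg_zero, Real.rpow_zero, mixedNorm_self] at e1
    exact enorm_tsum_le_tsum_enorm.trans e1
  have hc0 : wnorm 0 c < ∞ := (wnorm_mono_exp (by linarith) c).trans_lt hc
  have hfin : wnorm 0 c * (triConst q 1 * (3 * (wnorm 0 c * wnorm q c ^ 2))) < ∞ :=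
    ENNReal.mul_lt_top hc0 (ENNReal.mul_lt_top (triConst_lt_top hq 1) (ENNReal.mul_lt_top
      (by norm_num) (ENNReal.mul_lt_top hc0 (ENNReal.pow_lt_top hc))))
  have h2 := ENNReal.toReal_mono hfin.ne h1
  rw [toReal_enorm] at h2
  refine h2.trans (le_of_eq ?_)
  rw [← h0]
  simp only [ENNReal.toReal_mul, ENNReal.toReal_pow, ENNReal.toReal_ofNat]
  ring

/-- Since α > 1/2 there is q with 1/2 < q < α. The quartic form is then bounded by a small multiple
of the squared H^α norm plus a power of the conserved mass, so it is absorbed for both signs σ and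
for data of any size. -/
theorem exists_energy_bound {α : ℝ} (hα : 1 / 2 < α) (hα' : α ≤ 1) (M : ℝ) :
    ∃ R : ℝ, 0 ≤ R ∧ ∀ (σ : ℝ) (I : Set ℝ) (c : ℝ → ℤ → ℂ), σ = 1 ∨ σ = -1 →
      SeqSolution σ α α I c → ∀ t₀ ∈ I, (wnorm α (c t₀)).toReal ≤ M →
        ∀ t ∈ I, (wnorm α (c t)).toReal ≤ R := by
  set q : ℝ := (α + 1 / 2) / 2 with hqdef
  have hq : 1 / 2 < q := by linarith
  have hqα : q < α := by linarith
  set T := (triConst q 1).toReal with hT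
  have hT0 : 0 ≤ T := ENNReal.toReal_nonneg
  -- Chosen so that 3TM²δ ≤ 1. Half of the quartic form then costs at most half of the squared H^α
  -- norm.
  set δ : ℝ := (3 * T * M ^ 2 + 1)⁻¹ with hδdef
  have hδ : 0 < δ := by positivity
  obtain ⟨B, hB0, hB⟩ := wnorm_interpolation (by linarith : 0 ≤ q) hqα hδ
  -- The result of solving n² ≤ m + K(t₀) + (n² + 3TBM⁴ + 3TM⁴)/2 for n², with m and K(t₀) both at
  -- most M².
  set Y : ℝ := 4 * M ^ 2 + 3 * T * M ^ 4 + 3 * T * B * M ^ 4 with hY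
  refine ⟨Real.sqrt Y, Real.sqrt_nonneg _, fun σ I c hσ h t₀ ht₀ hM t ht => ?_⟩
  refine Real.le_sqrt_of_sq_le ?_
  have hc := h.wcont.1 t ht
  have hc₀ := h.wcont.1 t₀ ht₀
  have summ : ∀ τ ∈ I, Summable fun k => ‖c τ k‖ ^ 2 := fun τ hτ => by
    have := (summable_iff_wnorm_lt_top 0 (c τ)).2
      ((wnorm_mono_exp (by linarith) (c τ)).trans_lt (h.wcont.1 τ hτ))
    simpa using this
  have summα : ∀ τ ∈ I, Summable fun k => bracket k ^ (2 * α) * ‖c τ k‖ ^ 2 := fun τ hτ =>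
    (summable_iff_wnorm_lt_top α (c τ)).2 (h.wcont.1 τ hτ)
  have hKle : ∀ τ (k : ℤ), symbol α k * ‖c τ k‖ ^ 2 ≤ bracket k ^ (2 * α) * ‖c τ k‖ ^ 2 :=
    fun τ k => mul_le_mul_of_nonneg_right (symbol_le_bracket (by linarith) k) (sq_nonneg _)
  have summK : ∀ τ ∈ I, Summable fun k => symbol α k * ‖c τ k‖ ^ 2 := fun τ hτ =>
    Summable.of_nonneg_of_le (fun k => mul_nonneg (symbol_nonneg α k) (sq_nonneg _)) (hKle τ)
      (summα τ hτ)
  set m := ∑' k, ‖c t₀ k‖ ^ 2 with hm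
  have hm0 : 0 ≤ m := tsum_nonneg fun k => sq_nonneg _
  have hmt : ∑' k, ‖c t k‖ ^ 2 = m := h.mass_eq hα ht₀ ht
  set K : ℝ → ℝ := fun τ => ∑' k, symbol α k * ‖c τ k‖ ^ 2 with hK
  set Q : ℝ → ℂ := fun τ => q4 (c τ) (c τ) (c τ) (c τ) with hQ
  set n : ℝ → ℝ := fun τ => (wnorm α (c τ)).toReal with hn
  have hn0 : ∀ τ, 0 ≤ n τ := fun τ => ENNReal.toReal_nonneg
  have hM0 : 0 ≤ M := (hn0 t₀).trans hM
  have hnM : n t₀ ^ 2 ≤ M ^ 2 := pow_le_pow_left₀ (hn0 t₀) hM 2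
  have hmn : m ≤ n t₀ ^ 2 := by
    simp only [hn]
    rw [toReal_wnorm_sq]
    refine (summ t₀ ht₀).tsum_le_tsum (fun k => ?_) (summα t₀ ht₀)
    have : 1 ≤ bracket k ^ (2 * α) := Real.one_le_rpow (one_le_bracket k) (by linarith)
    nlinarith [sq_nonneg ‖c t₀ k‖]
  have hKn : K t₀ ≤ n t₀ ^ 2 := by
    simp only [hn, hK]
    rw [toReal_wnorm_sq]
    exact (summK t₀ ht₀).tsum_le_tsum (hKle t₀) (summα t₀ ht₀)
  have hnK : n t ^ 2 ≤ m + K t := by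
    simp only [hn, hK]
    rw [toReal_wnorm_sq, ← hmt, ← (summ t ht).tsum_add (summK t ht)]
    refine (summα t ht).tsum_le_tsum (fun k => ?_) ((summ t ht).add (summK t ht))
    have := mul_le_mul_of_nonneg_right (bracket_rpow_le_one_add_symbol (by linarith) hα' k)
      (sq_nonneg ‖c t k‖)
    linarith
  have hEn : K t - K t₀ ≤ 1 / 2 * (‖Q t‖ + ‖Q t₀‖) := by
    have h1 := h.energy_identity hα ht₀ ht
    have e : ∀ τ, ∑' k, (symbol α k : ℂ) * (c τ k * conj (c τ k)) = (K τ : ℂ) := fun τ => by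
      simp only [hK, Complex.ofReal_tsum, Complex.mul_conj', Complex.ofReal_mul, Complex.ofReal_pow]
    rw [e, e] at h1
    have h2 := congrArg norm h1
    rw [← Complex.ofReal_sub, Complex.norm_real, Real.norm_eq_abs, norm_mul] at h2
    have h3 : ‖(σ / 2 : ℂ)‖ = 1 / 2 := by
      rcases hσ with rfl | rfl <;> simp
    rw [h3] at h2
    refine (le_abs_self _).trans (h2.le.trans ?_)
    exact mul_le_mul_of_nonneg_left (norm_sub_le _ _) (by norm_num)
  have hcq := (wnorm_mono_exp hqα.le (c t)).trans_lt hc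
  have hcq₀ := (wnorm_mono_exp hqα.le (c t₀)).trans_lt hc₀
  have hQt := norm_q4_self_le hq hcq
  have hQ0 := norm_q4_self_le hq hcq₀
  rw [hmt] at hQt
  have hqt := hB (c t) hc
  rw [hmt] at hqt
  have hq0 : (wnorm q (c t₀)).toReal ^ 2 ≤ n t₀ ^ 2 :=
    pow_le_pow_left₀ ENNReal.toReal_nonneg
      (ENNReal.toReal_mono hc₀.ne (wnorm_mono_exp hqα.le _)) 2
  have hmM : m ≤ M ^ 2 := hmn.trans hnM
  have b0 : ‖Q t₀‖ ≤ 3 * T * M ^ 4 := by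
    refine hQ0.trans ?_
    calc 3 * T * (m * (wnorm q (c t₀)).toReal ^ 2) ≤ 3 * T * (M ^ 2 * M ^ 2) :=
          mul_le_mul_of_nonneg_left (mul_le_mul hmM (hq0.trans hnM) (sq_nonneg _) (sq_nonneg _))
            (by positivity)
      _ = _ := by ring
  have b1 : ‖Q t‖ ≤ n t ^ 2 + 3 * T * B * M ^ 4 := by
    refine hQt.trans ?_
    calc 3 * T * (m * (wnorm q (c t)).toReal ^ 2)
        ≤ 3 * T * (M ^ 2 * (δ * n t ^ 2 + B * M ^ 2)) := by
          gcongr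
          refine hqt.trans ?_
          gcongr
      _ = (3 * T * M ^ 2 * δ) * n t ^ 2 + 3 * T * B * M ^ 4 := by ring
      _ ≤ 1 * n t ^ 2 + 3 * T * B * M ^ 4 := by
          gcongr
          rw [hδdef, ← div_eq_mul_inv, div_le_one (by positivity)]
          linarith
      _ = _ := by ring
  rw [hY]
  linarith

/-! ### Local existence -/

/-- The space `ℓ²(ℤ)`. -/
abbrev EllTwo : Type := lp (fun _ : ℤ => ℂ) 2

/-- The coefficient sequence `⟨k⟩^{-s} x_k` in `H^s` given by `x ∈ ℓ²`. -/
def toSeq (s : ℝ) (x : EllTwo) : ℤ → ℂ := fun k => (bracket k ^ (-s) : ℝ) * x k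

/-- The element `⟨k⟩^s c_k` of `ℓ²` given by a coefficient sequence in `H^s`. -/
def ofSeq (s : ℝ) (c : ℤ → ℂ) : EllTwo :=
  open Classical in
  if h : Memℓp (fun k => ((bracket k ^ s : ℝ) : ℂ) * c k) 2 then ⟨_, h⟩ else 0

theorem wnorm_weight (s : ℝ) (c : ℤ → ℂ) :
    wnorm 0 (fun k => ((bracket k ^ s : ℝ) : ℂ) * c k) = wnorm s c := by
  rw [wnorm, wnorm]
  congr 1; ext k
  rw [Real.rpow_zero, ENNReal.ofReal_one, one_mul, enorm_mul, ← ofReal_norm (_ : ℂ),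
    Complex.norm_real, Real.norm_of_nonneg (bracket_rpow_pos k s).le]

theorem enorm_ellTwo (x : EllTwo) : ‖x‖ₑ = wnorm 0 x := by
  have h1 : ‖x‖ ^ 2 = ∑' k, ‖x k‖ ^ 2 := by
    have := lp.norm_rpow_eq_tsum (p := 2) (by norm_num) x
    simpa using this
  have h2 : ‖x‖ = (wnorm 0 x).toReal := by
    rw [← sqrt_tsum_eq_wnorm, ← Real.sqrt_sq (norm_nonneg x), h1]
    simp
  have h3 : wnorm 0 x < ∞ := by
    rw [← summable_iff_wnorm_lt_top]
    have := (lp.memℓp x).summable (by norm_num)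
    simpa using this
  rw [← ofReal_norm, h2, ENNReal.ofReal_toReal h3.ne]

theorem bracket_cast_mul_neg (s : ℝ) (k : ℤ) :
    ((bracket k ^ s : ℝ) : ℂ) * ((bracket k ^ (-s) : ℝ) : ℂ) = 1 := by
  rw [← Complex.ofReal_mul, ← Real.rpow_add (bracket_pos k)]; simp

theorem wnorm_toSeq (s : ℝ) (x : EllTwo) : wnorm s (toSeq s x) = ‖x‖ₑ := by
  rw [enorm_ellTwo, ← wnorm_weight]
  congr 1; ext k
  rw [toSeq, ← mul_assoc, bracket_cast_mul_neg, one_mul]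

theorem toSeq_sub (s : ℝ) (x y : EllTwo) : toSeq s (x - y) = toSeq s x - toSeq s y := by
  ext k; simp [toSeq, mul_sub]

theorem ofSeq_apply {s : ℝ} {c : ℤ → ℂ} (hc : wnorm s c < ∞) (k : ℤ) :
    ofSeq s c k = ((bracket k ^ s : ℝ) : ℂ) * c k := by
  rw [ofSeq, dif_pos (memℓp_of_wnorm (by rwa [wnorm_weight]))]

theorem toSeq_ofSeq {s : ℝ} {c : ℤ → ℂ} (hc : wnorm s c < ∞) : toSeq s (ofSeq s c) = c := by
  ext k
  rw [toSeq, ofSeq_apply hc, ← mul_assoc, mul_comm (Complex.ofReal _), bracket_cast_mul_neg,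
    one_mul]

theorem enorm_ofSeq {s : ℝ} {c : ℤ → ℂ} (hc : wnorm s c < ∞) : ‖ofSeq s c‖ₑ = wnorm s c := by
  rw [← wnorm_toSeq s, toSeq_ofSeq hc]

theorem edist_ofSeq {s : ℝ} {c d : ℤ → ℂ} (hc : wnorm s c < ∞) (hd : wnorm s d < ∞) :
    edist (ofSeq s c) (ofSeq s d) = wnorm s (c - d) := by
  rw [edist_eq_enorm_sub, ← wnorm_toSeq s, toSeq_sub, toSeq_ofSeq hc, toSeq_ofSeq hd]

theorem edist_eq_wnorm (s : ℝ) (x y : EllTwo) :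
    edist x y = wnorm s (toSeq s x - toSeq s y) := by
  rw [edist_eq_enorm_sub, ← wnorm_toSeq s, toSeq_sub]

theorem WCont.continuousOn_ofSeq {s : ℝ} {I : Set ℝ} {c : ℝ → ℤ → ℂ} (hc : WCont s I c) :
    ContinuousOn (fun t => ofSeq s (c t)) I := by
  intro t₀ ht₀
  rw [ContinuousWithinAt, tendsto_iff_edist_tendsto_0]
  refine (hc.2 t₀ ht₀).congr' ?_
  filter_upwards [self_mem_nhdsWithin] with t ht
  rw [edist_ofSeq (hc.1 t ht) (hc.1 t₀ ht₀)]

theorem wcont_toSeq {s : ℝ} {I : Set ℝ} {X : ℝ → EllTwo} (hX : ContinuousOn X I) :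
    WCont s I (fun t => toSeq s (X t)) := by
  refine ⟨fun t _ => by rw [wnorm_toSeq]; exact enorm_lt_top, fun t₀ ht₀ => ?_⟩
  have := hX t₀ ht₀
  rw [ContinuousWithinAt, tendsto_iff_edist_tendsto_0] at this
  exact this.congr fun t => edist_eq_wnorm s _ _

/-- The equation in the interaction picture, as a vector field on coefficient sequences. -/
def interactionSeq (σ α t : ℝ) (c : ℤ → ℂ) : ℤ → ℂ :=
  (-(Complex.I * σ)) • rot (symbol α) (-t) (cubicSeq (rot (symbol α) t c))

/-- The equation in the interaction picture, as a vector field on `ℓ²`. -/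
def interaction (σ α s t : ℝ) (x : EllTwo) : EllTwo :=
  ofSeq s (interactionSeq σ α t (toSeq s x))

/-- The constant of the cubic estimate in `H^s`. -/
def cubicConst (s : ℝ) : ℝ≥0∞ := 3 * triConst s (3 ^ s)

theorem cubicConst_lt_top {s : ℝ} (hs : 1 / 2 < s) : cubicConst s < ∞ :=
  ENNReal.mul_lt_top (by norm_num) (triConst_lt_top hs _)

theorem wnorm_interactionSeq_le {s : ℝ} (hs : 1 / 2 < s) (σ α t : ℝ) (c : ℤ → ℂ) :
    wnorm s (interactionSeq σ α t c) ≤ ‖(σ : ℂ)‖ₑ * (cubicConst s * wnorm s c ^ 3) := by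
  rw [interactionSeq, wnorm_smul, enorm_neg, enorm_mul, enorm_I, one_mul, wnorm_rot]
  refine mul_le_mul_right ((wnorm_tri_le (three_rpow_nonneg s)
    (admissible_one (by linarith) s) _ _ _).trans (le_of_eq ?_)) _
  rw [mixedNorm_self, wnorm_rot, cubicConst]; ring

theorem wnorm_interactionSeq_lt_top {s : ℝ} (hs : 1 / 2 < s) (σ α t : ℝ) (x : EllTwo) :
    wnorm s (interactionSeq σ α t (toSeq s x)) < ∞ := by
  refine (wnorm_interactionSeq_le hs σ α t _).trans_lt (ENNReal.mul_lt_top enorm_lt_top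
    (ENNReal.mul_lt_top (cubicConst_lt_top hs) (ENNReal.pow_lt_top ?_)))
  rw [wnorm_toSeq]; exact enorm_lt_top

theorem wnorm_interactionSeq_sub_le {s : ℝ} (hs : 1 / 2 < s) (σ α t : ℝ) {R : ℝ≥0∞} (hR : R < ∞)
    {c d : ℤ → ℂ} (hc : wnorm s c ≤ R) (hd : wnorm s d ≤ R) :
    wnorm s (interactionSeq σ α t c - interactionSeq σ α t d) ≤
      ‖(σ : ℂ)‖ₑ * (3 * cubicConst s * R ^ 2) * wnorm s (c - d) := by
  have e : interactionSeq σ α t c - interactionSeq σ α t d = (-(Complex.I * σ)) •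
      rot (symbol α) (-t) (cubicSeq (rot (symbol α) t c) - cubicSeq (rot (symbol α) t d)) := by
    rw [rot_sub, smul_sub]; rfl
  rw [e, wnorm_smul, enorm_neg, enorm_mul, enorm_I, one_mul, wnorm_rot, mul_assoc]
  refine mul_le_mul_right ?_ _
  have hc' : wnorm s (rot (symbol α) t c) < ∞ := by rw [wnorm_rot]; exact hc.trans_lt hR
  have hd' : wnorm s (rot (symbol α) t d) < ∞ := by rw [wnorm_rot]; exact hd.trans_lt hR
  refine (wnorm_tri_sub_le hs le_rfl (three_rpow_nonneg s) (admissible_one (by linarith) s)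
    hc' hc' hc' hd' hd' hd').trans ?_
  rw [← rot_sub]
  simp only [wnorm_rot]
  calc _ ≤ 3 * triConst s (3 ^ s) * (wnorm s (c - d) * (R * R) + R * (wnorm s (c - d) * R) +
        R * (R * wnorm s (c - d))) := by gcongr
    _ = _ := by rw [cubicConst]; ring

/-- Strong continuity of the linear flow suffices, since Picard-Lindelöf asks for continuity in time
only at each fixed point x. -/
theorem continuous_interaction {s : ℝ} (hs : 1 / 2 < s) (σ α : ℝ) (x : EllTwo) :
    ContinuousOn (fun t => interaction σ α s t x) Set.univ := by
  have h1 : WCont s Set.univ (fun _ => toSeq s x) :=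
    WCont.const (by rw [wnorm_toSeq]; exact enorm_lt_top)
  have h2 := h1.rot (symbol α)
  have h3 : WCont s Set.univ (fun t => cubicSeq (rot (symbol α) t (toSeq s x))) :=
    WCont.tri hs le_rfl (three_rpow_nonneg s) (admissible_one (by linarith) s) h2 h2 h2
  exact ((h3.rot_neg (symbol α)).smul _).continuousOn_ofSeq

theorem hasDerivAt_exp_I (θ t : ℝ) :
    HasDerivAt (fun τ : ℝ => Complex.exp (Complex.I * ((τ * θ : ℝ) : ℂ)))
      (Complex.I * θ * Complex.exp (Complex.I * ((t * θ : ℝ) : ℂ))) t := by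
  have h := hasDerivAt_exp_neg_I (-θ) t
  simpa using h

/-- Conjugating by the linear flow removes the unbounded term. The remaining cubic field is locally
Lipschitz on ℓ² uniformly in time, so Picard-Lindelöf applies on a ball of radius 1. -/
theorem exists_interaction_solution {s : ℝ} (hs : 1 / 2 < s) (σ α T : ℝ) (x₀ : EllTwo) :
    ∃ δ > 0, ∃ X : ℝ → EllTwo, X T = x₀ ∧ ∀ t ∈ Set.Ioo (T - δ) (T + δ),
      HasDerivAt X (interaction σ α s t (X t)) t := by
  set R : ℝ≥0∞ := ‖x₀‖ₑ + 1 with hR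
  have hRt : R < ∞ := ENNReal.add_lt_top.2 ⟨enorm_lt_top, ENNReal.one_lt_top⟩
  have hball : ∀ x ∈ Metric.closedBall x₀ ((1 : NNReal) : ℝ), wnorm s (toSeq s x) ≤ R := by
    intro x hx
    rw [wnorm_toSeq, hR]
    have h1 : ‖x - x₀‖ₑ ≤ 1 := by
      rw [Metric.mem_closedBall, dist_eq_norm] at hx
      rw [← ofReal_norm, ← ENNReal.ofReal_one]
      exact ENNReal.ofReal_le_ofReal (by simpa using hx)
    calc ‖x‖ₑ = ‖x₀ + (x - x₀)‖ₑ := by rw [add_sub_cancel]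
      _ ≤ ‖x₀‖ₑ + ‖x - x₀‖ₑ := enorm_add_le _ _
      _ ≤ _ := by gcongr
  set K : ℝ≥0∞ := ‖(σ : ℂ)‖ₑ * (3 * cubicConst s * R ^ 2) with hK
  have hKt : K < ∞ := ENNReal.mul_lt_top enorm_lt_top (ENNReal.mul_lt_top
    (ENNReal.mul_lt_top (by norm_num) (cubicConst_lt_top hs)) (ENNReal.pow_lt_top hRt))
  set L : ℝ≥0∞ := ‖(σ : ℂ)‖ₑ * (cubicConst s * R ^ 3) with hL
  have hLt : L < ∞ := ENNReal.mul_lt_top enorm_lt_top (ENNReal.mul_lt_top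
    (cubicConst_lt_top hs) (ENNReal.pow_lt_top hRt))
  -- This gives Lδ ≤ 1, so a trajectory of speed at most L stays in the unit ball.
  set δ : ℝ := ((L.toNNReal : ℝ) + 1)⁻¹ with hδ
  have hδ0 : 0 < δ := by positivity
  have hPL : IsPicardLindelof (interaction σ α s) (tmin := T - δ) (tmax := T + δ)
      ⟨T, by constructor <;> linarith⟩ x₀ 1 0 L.toNNReal K.toNNReal := by
    refine ⟨fun t _ x hx y hy => ?_, fun x _ => ?_, fun t _ x hx => ?_, ?_⟩
    · rw [ENNReal.coe_toNNReal hKt.ne, interaction, interaction,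
        edist_ofSeq (wnorm_interactionSeq_lt_top hs σ α t x)
          (wnorm_interactionSeq_lt_top hs σ α t y), edist_eq_wnorm s]
      exact wnorm_interactionSeq_sub_le hs σ α t hRt (hball x hx) (hball y hy)
    · exact (continuous_interaction hs σ α x).mono (Set.subset_univ _)
    · have h1 : ‖interaction σ α s t x‖ₑ ≤ L := by
        rw [interaction, enorm_ofSeq (wnorm_interactionSeq_lt_top hs σ α t x)]
        refine (wnorm_interactionSeq_le hs σ α t _).trans ?_
        have := hball x hx
        rw [hL]; gcongr
      have h2 := ENNReal.toReal_mono hLt.ne h1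
      rwa [toReal_enorm] at h2
    · simp only [add_sub_cancel_left, sub_sub_cancel, max_self, NNReal.coe_one, NNReal.coe_zero,
        sub_zero]
      rw [hδ, ← div_eq_mul_inv, div_le_one (by positivity)]
      linarith
  obtain ⟨X, hX0, hX⟩ := hPL.exists_eq_forall_mem_Icc_hasDerivWithinAt₀
  exact ⟨δ, hδ0, X, hX0, fun t ht => (hX t ⟨ht.1.le, ht.2.le⟩).hasDerivAt
    (Icc_mem_nhds ht.1 ht.2)⟩

theorem exists_local_solution {s : ℝ} (hs : 1 / 2 < s) (σ α T : ℝ) {d : ℤ → ℂ}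
    (hd : wnorm s d < ∞) :
    ∃ δ > 0, ∃ c : ℝ → ℤ → ℂ, SeqSolution σ α s (Set.Ioo (T - δ) (T + δ)) c ∧ c T = d := by
  have hd' : wnorm s (rot (symbol α) (-T) d) < ∞ := by rwa [wnorm_rot]
  obtain ⟨δ, hδ, X, hX0, hX⟩ :=
    exists_interaction_solution hs σ α T (ofSeq s (rot (symbol α) (-T) d))
  have hXc : ContinuousOn X (Set.Ioo (T - δ) (T + δ)) := fun t ht =>
    (hX t ht).continuousAt.continuousWithinAt
  refine ⟨δ, hδ, fun t => rot (symbol α) t (toSeq s (X t)), ⟨isOpen_Ioo, Set.ordConnected_Ioo,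
    (wcont_toSeq hXc).rot _, fun t ht k => ?_⟩, ?_⟩
  · have h1 : HasDerivAt (fun τ => X τ k) (interaction σ α s t (X t) k) t :=
      ((lp.evalCLM ℂ (fun _ : ℤ => ℂ) 2 k).restrictScalars ℝ).hasFDerivAt.comp_hasDerivAt t (hX t ht)
    have h2 : HasDerivAt (fun τ => toSeq s (X τ) k)
        (interactionSeq σ α t (toSeq s (X t)) k) t := by
      refine (h1.const_mul ((bracket k ^ (-s) : ℝ) : ℂ)).congr_deriv ?_
      exact congrFun (toSeq_ofSeq (wnorm_interactionSeq_lt_top hs σ α t (X t))) k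
    refine ((hasDerivAt_exp_I (symbol α k) t).mul h2).congr_deriv ?_
    have h3 : Complex.exp (Complex.I * ((t * symbol α k : ℝ) : ℂ)) *
        Complex.exp (Complex.I * ((-t * symbol α k : ℝ) : ℂ)) = 1 := by
      rw [← Complex.exp_add, ← Complex.exp_zero]
      congr 1; push_cast; ring
    rw [rhs, interactionSeq]
    simp only [Pi.smul_apply, smul_eq_mul]
    set N := cubicSeq (rot (symbol α) t (toSeq s (X t))) with hN
    simp only [rot]
    linear_combination (-(Complex.I * σ) * N k) * h3
  · simp only [hX0]
    rw [toSeq_ofSeq hd', rot_rot_neg]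

/-! ### Continuation of solutions -/

/-- One-sided derivatives at x are limits of the nearby derivatives, and both limits are g x. It
serves to recover the equation at the instant where two solutions are glued. -/
theorem hasDerivAt_of_eventually_punctured {f g : ℝ → ℂ} {x : ℝ}
    (hd : ∀ᶠ y in 𝓝[≠] x, HasDerivAt f (g y) y) (hf : ContinuousAt f x) (hg : ContinuousAt g x) :
    HasDerivAt f (g x) x := by
  rw [← Set.Iio_union_Ioi, nhdsWithin_union, eventually_sup] at hd
  obtain ⟨hl, hr⟩ := hd
  have A : HasDerivWithinAt f (g x) (Set.Ici x) x := by
    refine hasDerivWithinAt_Ici_of_tendsto_deriv (s := {y | HasDerivAt f (g y) y})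
      (fun y hy => hy.differentiableAt.differentiableWithinAt) hf.continuousWithinAt hr ?_
    refine (hg.tendsto.mono_left nhdsWithin_le_nhds).congr' ?_
    filter_upwards [hr] with y hy
    exact hy.deriv.symm
  have B : HasDerivWithinAt f (g x) (Set.Iic x) x := by
    refine hasDerivWithinAt_Iic_of_tendsto_deriv (s := {y | HasDerivAt f (g y) y})
      (fun y hy => hy.differentiableAt.differentiableWithinAt) hf.continuousWithinAt hl ?_
    refine (hg.tendsto.mono_left nhdsWithin_le_nhds).congr' ?_
    filter_upwards [hl] with y hy
    exact hy.deriv.symm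
  simpa using B.union A

section Continuation

variable {σ α s : ℝ} {I : Set ℝ} {c : ℝ → ℤ → ℂ}

theorem SeqSolution.rot_sub_eq_integral (hs : 1 / 2 < s) (h : SeqSolution σ α s I c) {t₀ t : ℝ}
    (ht₀ : t₀ ∈ I) (ht : t ∈ I) :
    rot (symbol α) (-t) (c t) - rot (symbol α) (-t₀) (c t₀) =
      fun k => ∫ τ in t₀..t, rot (symbol α) (-τ) ((-(Complex.I * σ)) • cubicSeq (c τ)) k := by
  have hsub := h.uIcc_subset ht₀ ht
  ext k
  have hd : ∀ τ ∈ Set.uIcc t₀ t, HasDerivAt (fun τ => rot (symbol α) (-τ) (c τ) k)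
      (rot (symbol α) (-τ) ((-(Complex.I * σ)) • cubicSeq (c τ)) k) τ := by
    intro τ hτ
    refine ((hasDerivAt_exp_neg_I (symbol α k) τ).mul
      (h.hasDerivAt τ (hsub hτ) k)).congr_deriv ?_
    simp only [rhs, rot, Pi.smul_apply, smul_eq_mul]
    ring
  have hc : ContinuousOn (fun τ => rot (symbol α) (-τ) ((-(Complex.I * σ)) • cubicSeq (c τ)) k)
      (Set.uIcc t₀ t) :=
    ((((h.wcont_cubicSeq hs).smul _).rot_neg (symbol α)).coeff k).mono hsub
  exact (intervalIntegral.integral_eq_sub_of_hasDerivAt hd hc.intervalIntegrable).symm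

/-- The mixed estimate puts only one factor in H^s. A bound in H^q therefore makes the Duhamel
integrand linear in the H^s norm, which rules out blow-up in H^s. -/
theorem SeqSolution.wnorm_rot_sub_le (hs : 1 / 2 < s) (h : SeqSolution σ α s I c)
    (hσ : σ = 1 ∨ σ = -1) {q R : ℝ} (hq : 1 / 2 < q)
    (hR : ∀ t ∈ I, (wnorm q (c t)).toReal ≤ R) (hqs : q ≤ s) {t₀ t : ℝ} (ht₀ : t₀ ∈ I)
    (ht : t ∈ I) :
    wnorm s (rot (symbol α) (-t) (c t) - rot (symbol α) (-t₀) (c t₀)) ≤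
      ENNReal.ofReal |∫ τ in t₀..t,
        3 * (triConst q (3 ^ s)).toReal * R ^ 2 * (wnorm s (c τ)).toReal| := by
  have hsub := h.uIcc_subset ht₀ ht
  rw [h.rot_sub_eq_integral hs ht₀ ht]
  refine wnorm_integral_le (continuousOn_const.mul (h.wcont.norm.mono hsub))
    (fun τ _ => by positivity) fun τ hτ => ?_
  rw [wnorm_rot, wnorm_smul, enorm_neg, enorm_mul, enorm_I, enorm_sign hσ, one_mul, one_mul]
  refine (wnorm_tri_le (three_rpow_nonneg s) (admissible_one (by linarith) q) _ _ _).trans ?_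
  have hcs := h.wcont.1 τ (hsub hτ)
  have hcq : wnorm q (c τ) < ∞ := (wnorm_mono_exp hqs _).trans_lt hcs
  have hT := triConst_lt_top hq (3 ^ s)
  rw [ENNReal.le_ofReal_iff_toReal_le _ (by positivity), mixedNorm_self]
  · simp only [ENNReal.toReal_mul, ENNReal.toReal_pow, ENNReal.toReal_ofNat]
    have h1 : (wnorm q (c τ)).toReal ^ 2 ≤ R ^ 2 :=
      pow_le_pow_left₀ ENNReal.toReal_nonneg (hR τ (hsub hτ)) 2
    calc (triConst q (3 ^ s)).toReal * (3 * ((wnorm s (c τ)).toReal * (wnorm q (c τ)).toReal ^ 2))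
        ≤ (triConst q (3 ^ s)).toReal * (3 * ((wnorm s (c τ)).toReal * R ^ 2)) := by gcongr
      _ = _ := by ring
  · rw [mixedNorm_self]
    exact (ENNReal.mul_lt_top hT (ENNReal.mul_lt_top (by norm_num)
      (ENNReal.mul_lt_top hcs (ENNReal.pow_lt_top hcq)))).ne

/-- A substitute for Gronwall on short intervals. At a point x where the norm is maximal between t₀
and t, the integral is at most half of that maximum and can be absorbed. -/
theorem SeqSolution.norm_le_two_mul (h : SeqSolution σ α s I c) {D : ℝ} (hD : 0 ≤ D)
    (hint : ∀ t₀ ∈ I, ∀ t ∈ I, wnorm s (rot (symbol α) (-t) (c t) - rot (symbol α) (-t₀) (c t₀)) ≤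
      ENNReal.ofReal |∫ τ in t₀..t, D * (wnorm s (c τ)).toReal|)
    {t₀ t : ℝ} (ht₀ : t₀ ∈ I) (ht : t ∈ I) (hDt : D * |t - t₀| ≤ 1 / 2) :
    (wnorm s (c t)).toReal ≤ 2 * (wnorm s (c t₀)).toReal := by
  have hsub := h.uIcc_subset ht₀ ht
  obtain ⟨x, hx, hmax⟩ := isCompact_uIcc.exists_isMaxOn (Set.nonempty_uIcc (a := t₀) (b := t))
    (h.wcont.norm.mono hsub)
  have hxt : |x - t₀| ≤ |t - t₀| := Set.abs_sub_left_of_mem_uIcc hx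
  have h1 := hint t₀ ht₀ x (hsub hx)
  have h2 : |∫ τ in t₀..x, D * (wnorm s (c τ)).toReal| ≤
      (D * (wnorm s (c x)).toReal) * |x - t₀| := by
    rw [← Real.norm_eq_abs (∫ _ in _.._, _)]
    refine intervalIntegral.norm_integral_le_of_norm_le_const fun τ hτ => ?_
    rw [Real.norm_of_nonneg (by positivity)]
    refine mul_le_mul_of_nonneg_left (hmax ?_) hD
    exact Set.uIcc_subset_uIcc_left hx (Set.uIoc_subset_uIcc hτ)
  have h3 : wnorm s (c x) ≤ ENNReal.ofReal ((D * (wnorm s (c x)).toReal) * |x - t₀|) +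
      wnorm s (c t₀) := by
    calc wnorm s (c x) = wnorm s (rot (symbol α) (-x) (c x)) := (wnorm_rot _ _ _ _).symm
      _ = wnorm s ((rot (symbol α) (-x) (c x) - rot (symbol α) (-t₀) (c t₀)) +
          rot (symbol α) (-t₀) (c t₀)) := by rw [sub_add_cancel]
      _ ≤ wnorm s (rot (symbol α) (-x) (c x) - rot (symbol α) (-t₀) (c t₀)) +
          wnorm s (rot (symbol α) (-t₀) (c t₀)) := wnorm_add_le _ _ _
      _ ≤ _ := by
          rw [wnorm_rot s (symbol α) (-t₀)]
          exact add_le_add_left (h1.trans (ENNReal.ofReal_le_ofReal h2)) _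
  have h4 := ENNReal.toReal_mono
    (ENNReal.add_ne_top.2 ⟨ENNReal.ofReal_ne_top, (h.wcont.1 t₀ ht₀).ne⟩) h3
  rw [ENNReal.toReal_add ENNReal.ofReal_ne_top (h.wcont.1 t₀ ht₀).ne,
    ENNReal.toReal_ofReal (by positivity)] at h4
  have h5 : (D * (wnorm s (c x)).toReal) * |x - t₀| ≤ 1 / 2 * (wnorm s (c x)).toReal := by
    have h6 : D * |x - t₀| ≤ 1 / 2 := (mul_le_mul_of_nonneg_left hxt hD).trans hDt
    have h7 : 0 ≤ (wnorm s (c x)).toReal := ENNReal.toReal_nonneg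
    nlinarith
  have h8 : (wnorm s (c t)).toReal ≤ (wnorm s (c x)).toReal := hmax Set.right_mem_uIcc
  linarith

/-- A solution with bounded `H^q` norm has a limit in `H^s` at a finite endpoint. -/
theorem SeqSolution.exists_limit (hs : 1 / 2 < s) (h : SeqSolution σ α s I c)
    (hσ : σ = 1 ∨ σ = -1) {q R : ℝ} (hq : 1 / 2 < q) (hqs : q ≤ s)
    (hR : ∀ t ∈ I, (wnorm q (c t)).toReal ≤ R) {T : ℝ} (hT : T ∈ closure I) :
    ∃ d : ℤ → ℂ, wnorm s d < ∞ ∧ Tendsto (fun t => wnorm s (c t - d)) (𝓝[I] T) (𝓝 0) := by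
  set D : ℝ := 3 * (triConst q (3 ^ s)).toReal * R ^ 2 with hDdef
  have hD : 0 ≤ D := by positivity
  have hint : ∀ t₀ ∈ I, ∀ t ∈ I, wnorm s (rot (symbol α) (-t) (c t) -
      rot (symbol α) (-t₀) (c t₀)) ≤
      ENNReal.ofReal |∫ τ in t₀..t, D * (wnorm s (c τ)).toReal| := fun t₀ ht₀ t ht =>
    h.wnorm_rot_sub_le hs hσ hq hR hqs ht₀ ht
  -- Points of I within η of T are at distance less than 2η from t₁, and D · 2η ≤ 1/2 is what
  -- `SeqSolution.norm_le_two_mul` requires.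
  set η : ℝ := (4 * (D + 1))⁻¹ with hη
  have hη0 : 0 < η := by positivity
  have hDη : D * (2 * η) ≤ 1 / 2 := by
    rw [hη, mul_inv]
    have : D * (D + 1)⁻¹ ≤ 1 := by
      rw [← div_eq_mul_inv, div_le_one (by positivity)]; linarith
    linarith
  obtain ⟨t₁, ht₁, hd₁⟩ := Metric.mem_closure_iff.1 hT η hη0
  set N : ℝ := 2 * (wnorm s (c t₁)).toReal with hN
  have hN0 : 0 ≤ N := by positivity
  have hbd : ∀ t ∈ I ∩ Metric.ball T η, (wnorm s (c t)).toReal ≤ N := fun t ht => by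
    refine h.norm_le_two_mul hD hint ht₁ ht.1 (le_trans ?_ hDη)
    refine mul_le_mul_of_nonneg_left ?_ hD
    have h1 := ht.2
    rw [Metric.mem_ball] at h1
    rw [← Real.dist_eq]
    linarith [dist_triangle t T t₁]
  have hfin : ∀ t ∈ I, wnorm s (rot (symbol α) (-t) (c t)) < ∞ := fun t ht => by
    rw [wnorm_rot]; exact h.wcont.1 t ht
  let F : ℝ → EllTwo := fun t => ofSeq s (rot (symbol α) (-t) (c t))
  -- In the interaction picture the solution is Lipschitz near T, hence Cauchy in the complete space
  -- ℓ². Its limit is then rotated back to time T.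
  have hLip : LipschitzOnWith (Real.toNNReal (D * N)) F (I ∩ Metric.ball T η) := by
    intro x hx y hy
    simp only [F]
    rw [edist_ofSeq (hfin x hx.1) (hfin y hy.1)]
    refine (hint y hy.1 x hx.1).trans ?_
    have hxy : Set.uIcc y x ⊆ I ∩ Metric.ball T η := by
      refine Set.subset_inter (h.uIcc_subset hy.1 hx.1) ?_
      rw [Real.ball_eq_Ioo] at *
      exact Set.ordConnected_Ioo.uIcc_subset hy.2 hx.2
    have h1 : |∫ τ in y..x, D * (wnorm s (c τ)).toReal| ≤ D * N * |x - y| := by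
      rw [← Real.norm_eq_abs (∫ _ in _.._, _)]
      refine intervalIntegral.norm_integral_le_of_norm_le_const fun τ hτ => ?_
      rw [Real.norm_of_nonneg (by positivity)]
      exact mul_le_mul_of_nonneg_left (hbd τ (hxy (Set.uIoc_subset_uIcc hτ))) hD
    refine (ENNReal.ofReal_le_ofReal h1).trans (le_of_eq ?_)
    rw [ENNReal.ofReal_mul (by positivity), edist_dist, Real.dist_eq]
    rfl
  have hne : (𝓝[I ∩ Metric.ball T η] T).NeBot := by
    rw [nhdsWithin_inter_of_mem' (mem_nhdsWithin_of_mem_nhds (Metric.ball_mem_nhds T hη0))]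
    exact mem_closure_iff_nhdsWithin_neBot.1 hT
  have hcauchy : Cauchy (map F (𝓝[I ∩ Metric.ball T η] T)) :=
    (cauchy_nhds.mono nhdsWithin_le_nhds).map_of_le hLip.uniformContinuousOn
      (le_principal_iff.2 self_mem_nhdsWithin)
  obtain ⟨X, hX⟩ := CompleteSpace.complete hcauchy
  have hX' : Tendsto F (𝓝[I] T) (𝓝 X) := by
    rw [nhdsWithin_inter_of_mem' (mem_nhdsWithin_of_mem_nhds (Metric.ball_mem_nhds T hη0))] at hX
    exact hX
  have hXf : wnorm s (toSeq s X) < ∞ := by rw [wnorm_toSeq]; exact enorm_lt_top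
  refine ⟨rot (symbol α) T (toSeq s X), by rwa [wnorm_rot], ?_⟩
  rw [tendsto_iff_edist_tendsto_0] at hX'
  have hsum := hX'.add
    ((tendsto_wnorm_rot_sub (symbol α) hXf T).mono_left (nhdsWithin_le_nhds (s := I)))
  rw [add_zero] at hsum
  refine WCont.tendsto_of_le hsum ?_
  filter_upwards [self_mem_nhdsWithin] with t ht
  have e : c t - rot (symbol α) T (toSeq s X) =
      rot (symbol α) t (rot (symbol α) (-t) (c t) - toSeq s X) +
        (rot (symbol α) t (toSeq s X) - rot (symbol α) T (toSeq s X)) := by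
    rw [rot_sub, rot_rot_neg]; abel
  rw [e]
  refine (wnorm_add_le _ _ _).trans (add_le_add_left (le_of_eq ?_) _)
  rw [wnorm_rot, edist_eq_wnorm s]
  simp only [F]
  rw [toSeq_ofSeq (hfin t ht)]

/-- A point closer to T than |T| lies on the same side of 0 as T. If it is not in I it must
therefore lie beyond T, and the other endpoint of I cannot interfere. -/
theorem eventually_notMem_of_near_endpoint (hI : I.OrdConnected) (h0 : (0 : ℝ) ∈ I) {T t : ℝ}
    (hT : T ∈ closure I) (hTI : T ∉ I) (ht : |t - T| < |T|) (htI : t ∉ I) (htT : t ≠ T) :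
    ∀ᶠ y in 𝓝 t, y ∉ I := by
  rcases lt_trichotomy T 0 with hneg | hzero | hpos
  · rw [abs_of_neg hneg, abs_lt] at ht
    have h1 : ∀ y ∈ I, T < y := fun y hy => by
      by_contra hle
      exact hTI (hI.out hy h0 ⟨not_lt.1 hle, hneg.le⟩)
    have h2 : t < T := by
      refine lt_of_le_of_ne ?_ htT
      by_contra hlt
      obtain ⟨y, hy, hyd⟩ := Metric.mem_closure_iff.1 hT (t - T) (by linarith)
      rw [Real.dist_eq, abs_lt] at hyd
      exact htI (hI.out hy h0 ⟨by linarith, by linarith⟩)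
    filter_upwards [Iio_mem_nhds h2] with y hy hyI
    exact lt_asymm hy (h1 y hyI)
  · exact absurd (hzero ▸ h0) hTI
  · rw [abs_of_pos hpos, abs_lt] at ht
    have h1 : ∀ y ∈ I, y < T := fun y hy => by
      by_contra hle
      exact hTI (hI.out h0 hy ⟨hpos.le, not_lt.1 hle⟩)
    have h2 : T < t := by
      refine lt_of_le_of_ne ?_ htT.symm
      by_contra hlt
      obtain ⟨y, hy, hyd⟩ := Metric.mem_closure_iff.1 hT (T - t) (by linarith)
      rw [Real.dist_eq, abs_lt] at hyd
      exact htI (hI.out h0 hy ⟨by linarith, by linarith⟩)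
    filter_upwards [Ioi_mem_nhds h2] with y hy hyI
    exact lt_asymm hy (h1 y hyI)

/-- The solution has a limit in H^s at T. A local solution started from this limit continues it, and
the glued function is used on the union of the two intervals. -/
theorem SeqSolution.exists_extension (hs : 1 / 2 < s) (h : SeqSolution σ α s I c)
    (hσ : σ = 1 ∨ σ = -1) {q R : ℝ} (hq : 1 / 2 < q) (hqs : q ≤ s)
    (hR : ∀ t ∈ I, (wnorm q (c t)).toReal ≤ R) (h0 : (0 : ℝ) ∈ I) {T : ℝ} (hT : T ∈ closure I)
    (hTI : T ∉ I) :
    ∃ (J : Set ℝ) (v : ℝ → ℤ → ℂ), SeqSolution σ α s J v ∧ I ⊆ J ∧ T ∈ J ∧ ∀ t ∈ I, v t = c t := by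
  classical
  obtain ⟨d, hd, hlim⟩ := h.exists_limit hs hσ hq hqs hR hT
  obtain ⟨δ₀, hδ₀, w, hw, hwT⟩ := exists_local_solution hs σ α T hd
  have hT0 : T ≠ 0 := fun e => hTI (e ▸ h0)
  -- The cap |T| keeps the new interval away from 0 and hence from the other end of I.
  set δ := min δ₀ |T| with hδdef
  have hδ : 0 < δ := lt_min hδ₀ (abs_pos.2 hT0)
  set U := Set.Ioo (T - δ) (T + δ) with hU
  have hUsub : U ⊆ Set.Ioo (T - δ₀) (T + δ₀) := Set.Ioo_subset_Ioo
    (by linarith [min_le_left δ₀ |T|]) (by linarith [min_le_left δ₀ |T|])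
  have hTU : T ∈ U := ⟨by linarith, by linarith⟩
  have hUo : IsOpen U := isOpen_Ioo
  have hJo : IsOpen (I ∪ U) := h.isOpen.union hUo
  let v : ℝ → ℤ → ℂ := fun t => if t ∈ I then c t else w t
  have hvI : ∀ t ∈ I, v t = c t := fun t ht => if_pos ht
  have hvn : ∀ t, t ∉ I → v t = w t := fun t ht => if_neg ht
  have hvT : v T = d := by rw [hvn T hTI, hwT]
  have hloc1 : ∀ t ∈ I, v =ᶠ[𝓝 t] c := fun t ht => by
    filter_upwards [h.isOpen.mem_nhds ht] with y hy
    exact hvI y hy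
  have hloc2 : ∀ t ∈ U, t ∉ I → t ≠ T → v =ᶠ[𝓝 t] w := fun t ht htI htT => by
    have habs : |t - T| < |T| := by
      rw [abs_lt]
      have := min_le_right δ₀ |T|
      exact ⟨by linarith [ht.1], by linarith [ht.2]⟩
    filter_upwards [eventually_notMem_of_near_endpoint h.ordConnected h0 hT hTI habs htI htT] with
      y hy
    exact hvn y hy
  have hwnhds : ∀ t ∈ U, Tendsto (fun y => wnorm s (w y - w t)) (𝓝 t) (𝓝 0) := fun t ht => by
    have := hw.wcont.2 t (hUsub ht)
    rwa [hw.isOpen.nhdsWithin_eq (hUsub ht)] at this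
  have hcont : WCont s (I ∪ U) v := by
    refine ⟨fun t ht => ?_, fun t ht => ?_⟩
    · by_cases htI : t ∈ I
      · rw [hvI t htI]; exact h.wcont.1 t htI
      · rw [hvn t htI]; exact hw.wcont.1 t (hUsub (ht.resolve_left htI))
    · rw [hJo.nhdsWithin_eq ht]
      by_cases htI : t ∈ I
      · have h1 := h.wcont.2 t htI
        rw [h.isOpen.nhdsWithin_eq htI] at h1
        refine h1.congr' ?_
        filter_upwards [hloc1 t htI] with y hy
        rw [hy, hvI t htI]
      · have htU := ht.resolve_left htI
        by_cases htT : t = T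
        · subst htT
          rw [← nhdsWithin_univ, ← Set.union_compl_self I, nhdsWithin_union, hvT]
          refine Tendsto.sup ?_ ?_
          · refine hlim.congr' ?_
            filter_upwards [self_mem_nhdsWithin] with y hy
            rw [hvI y hy]
          · have h2 := (hwnhds t htU).mono_left (nhdsWithin_le_nhds (s := Iᶜ))
            refine h2.congr' ?_
            filter_upwards [self_mem_nhdsWithin] with y hy
            rw [hvn y hy, hwT]
        · refine (hwnhds t htU).congr' ?_
          filter_upwards [hloc2 t htU htI htT] with y hy
          rw [hy, hvn t htI]
  have hder : ∀ t ∈ I ∪ U, t ≠ T → ∀ k, HasDerivAt (fun τ => v τ k) (rhs σ α (v t) k) t := by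
    intro t ht htT k
    by_cases htI : t ∈ I
    · rw [hvI t htI]
      refine (h.hasDerivAt t htI k).congr_of_eventuallyEq ?_
      filter_upwards [hloc1 t htI] with y hy
      rw [hy]
    · have htU := ht.resolve_left htI
      rw [hvn t htI]
      refine (hw.hasDerivAt t (hUsub htU) k).congr_of_eventuallyEq ?_
      filter_upwards [hloc2 t htU htI htT] with y hy
      rw [hy]
  have hTJ : T ∈ I ∪ U := Or.inr hTU
  refine ⟨I ∪ U, v, ⟨hJo, ?_, hcont, fun t ht k => ?_⟩, Set.subset_union_left, hTJ, hvI⟩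
  · rw [← isPreconnected_iff_ordConnected]
    refine IsPreconnected.union' ?_ h.ordConnected.isPreconnected
      Set.ordConnected_Ioo.isPreconnected
    obtain ⟨y, hyU, hyI⟩ := mem_closure_iff.1 hT U hUo hTU
    exact ⟨y, hyI, hyU⟩
  -- At the junction the equation follows from continuity of the solution and of the right-hand
  -- side, together with the equation at the neighbouring times.
  · by_cases htT : t = T
    · rw [htT]
      have hN : WCont s (I ∪ U) (fun τ => cubicSeq (v τ)) :=
        WCont.tri hs le_rfl (three_rpow_nonneg s) (admissible_one (by linarith) s) hcont hcont hcont
      have hvc := (hcont.coeff k).continuousAt (hJo.mem_nhds hTJ)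
      have hNc := (hN.coeff k).continuousAt (hJo.mem_nhds hTJ)
      refine hasDerivAt_of_eventually_punctured (g := fun y => rhs σ α (v y) k) ?_ hvc ?_
      · filter_upwards [self_mem_nhdsWithin, mem_nhdsWithin_of_mem_nhds (hJo.mem_nhds hTJ)] with
          y hy hyJ
        exact hder y hyJ hy k
      · exact (continuousAt_const.mul (continuousAt_const.mul hvc)).sub
          (continuousAt_const.mul (continuousAt_const.mul hNc))
    · exact hder t ht htT k

end Continuation

/-! ### Global existence -/

theorem isSolution_of_seqSolution {σ α s : ℝ} (hs : 1 / 2 < s) {J : Set ℝ} {u : ℝ → L2} {u₀ : L2}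
    (h : SeqSolution σ α s J (fun t => coeff (u t))) (h0 : (0 : ℝ) ∈ J) (hu₀ : u 0 = u₀) :
    IsSolution σ α s u₀ J u where
  isOpen := h.isOpen
  ordConnected := h.ordConnected
  zero_mem := h0
  continuous := continuousInSobolev_iff.2 h.wcont
  initial := hu₀
  equation t ht k := by
    have hd := h.hasDerivAt t ht k
    refine ⟨hd.differentiableAt, ?_⟩
    rw [hd.deriv, cubicCoeff_eq hs (h.wcont.1 t ht), rhs, cubicSeq]
    linear_combination (symbol α k * coeff (u t) k -
      σ * tri (fun _ _ => 1) (coeff (u t)) (coeff (u t)) (coeff (u t)) k) * Complex.I_mul_I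

theorem SeqSolution.congr {σ α s : ℝ} {J : Set ℝ} {v w : ℝ → ℤ → ℂ} (h : SeqSolution σ α s J v)
    (hw : ∀ t ∈ J, w t = v t) : SeqSolution σ α s J w where
  isOpen := h.isOpen
  ordConnected := h.ordConnected
  wcont := h.wcont.congr hw
  hasDerivAt t ht k := by
    rw [hw t ht]
    refine (h.hasDerivAt t ht k).congr_of_eventuallyEq ?_
    filter_upwards [h.isOpen.mem_nhds ht] with y hy
    rw [hw y hy]

/-- A nonempty open proper subset of ℝ has a boundary point outside it. The energy bound is uniform
on I, so the solution extends past that point, against maximality. -/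
theorem IsMaximalSolution.eq_univ {σ α s : ℝ} (hα : 1 / 2 < α) (hα' : α ≤ 1) (hαs : α ≤ s)
    (hσ : σ = 1 ∨ σ = -1) {u₀ : L2} {I : Set ℝ} {u : ℝ → L2}
    (h : IsMaximalSolution σ α s u₀ I u) : I = Set.univ := by
  classical
  have hs : 1 / 2 < s := hα.trans_le hαs
  have hsol := h.isSolution
  have hseq := hsol.seqSolution hs
  by_contra hne
  have hclosed : ¬ IsClosed I := fun hcl =>
    hne (IsClopen.eq_univ ⟨hcl, hsol.isOpen⟩ ⟨0, hsol.zero_mem⟩)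
  have hex : ∃ T ∈ closure I, T ∉ I := by
    by_contra hcon
    push Not at hcon
    exact hclosed (closure_subset_iff_isClosed.1 hcon)
  obtain ⟨T, hT, hTI⟩ := hex
  obtain ⟨R, -, hR⟩ := exists_energy_bound hα hα' (wnorm α (coeff (u 0))).toReal
  have hbound := hR σ I _ hσ (hseq.mono_exp hαs) 0 hsol.zero_mem le_rfl
  obtain ⟨J, v, hv, hIJ, hTJ, hvI⟩ := hseq.exists_extension hs hσ hα hαs hbound hsol.zero_mem hT hTI
  -- On I the original u is kept, because maximality compares elements of L² rather than coefficient
  -- sequences.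
  let w : ℝ → L2 := fun t => if t ∈ I then u t else ofCoeff (v t)
  have hw : ∀ t ∈ J, coeff (w t) = v t := fun t ht => by
    by_cases htI : t ∈ I
    · simp only [w, if_pos htI]; exact (hvI t htI).symm
    · simp only [w, if_neg htI]
      exact coeff_ofCoeff ((wnorm_mono_exp (by linarith) _).trans_lt (hv.wcont.1 t ht))
  have hwI : ∀ t ∈ I, w t = u t := fun t ht => if_pos ht
  have hwsol : IsSolution σ α s u₀ J w :=
    isSolution_of_seqSolution hs (hv.congr hw) (hIJ hsol.zero_mem)
      ((hwI 0 hsol.zero_mem).trans hsol.initial)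
  have := h.maximal J w hwsol hIJ hwI
  exact hTI (this ▸ hTJ)

theorem sobolevNorm_nonneg (s : ℝ) (f : L2) : 0 ≤ sobolevNorm s f := by
  rw [sobolevNorm_eq]; exact ENNReal.toReal_nonneg

/-- Along a global solution the Sobolev norms are continuous functions of time. -/
theorem ContinuousInSobolev.continuous_sobolevNorm {s : ℝ} {u : ℝ → L2}
    (h : ContinuousInSobolev s Set.univ u) : Continuous fun t => sobolevNorm s (u t) := by
  simp only [sobolevNorm_eq]
  exact continuousOn_univ.1 (continuousInSobolev_iff.1 h).norm

theorem abs_integral_le_abs_integral {f g : ℝ → ℝ} (hf : Continuous f) (hg : Continuous g)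
    (hf0 : ∀ t, 0 ≤ f t) (hfg : ∀ t, f t ≤ g t) (a b : ℝ) :
    |∫ t in a..b, f t| ≤ |∫ t in a..b, g t| := by
  rw [intervalIntegral.abs_intervalIntegral_eq, intervalIntegral.abs_intervalIntegral_eq,
    abs_of_nonneg (integral_nonneg hf0),
    abs_of_nonneg (integral_nonneg fun t => (hf0 t).trans (hfg t))]
  exact setIntegral_mono (hf.intervalIntegrable a b).def' (hg.intervalIntegrable a b).def' hfg

/-- This is the general smoothing bound with q = α, where all powers of the H^α norm are bounded by
means of the energy. -/
theorem exists_energy_smoothing_bound {α s r : ℝ} (hα : 1 / 2 < α) (hα' : α ≤ 1) (hαs : α ≤ s)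
    (hr : r ≤ s + (2 * α - 1)) (M : ℝ) :
    ∃ C : ℝ, 0 < C ∧ ∀ σ : ℝ, σ = 1 ∨ σ = -1 → ∀ (u₀ : L2) (u : ℝ → L2),
      IsSolution σ α s u₀ Set.univ u → sobolevNorm α u₀ ≤ M → ∀ t : ℝ,
        sobolevNorm r (u t - phasedFlow σ α t u₀) ≤
          C * (sobolevNorm s u₀ + sobolevNorm s (u t) +
            |∫ τ in (0 : ℝ)..t, sobolevNorm s (u τ)|) := by
  obtain ⟨R, hR0, hR⟩ := exists_energy_bound hα hα' M
  obtain ⟨C, hC0, hC⟩ := exists_smoothing_bound hα hα' hα hαs hr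
  -- R² and R⁴ cover the powers that occur, and the summand 1 keeps the constant positive if R = 0.
  refine ⟨C * (R ^ 2 + R ^ 4 + 1), by positivity, fun σ hσ u₀ u h hM t => ?_⟩
  have hseq := (h.seqSolution (hα.trans_le hαs)).mono_exp hαs
  have hbd : ∀ τ, sobolevNorm α (u τ) ≤ R := fun τ => by
    rw [sobolevNorm_eq]
    refine hR σ _ _ hσ hseq 0 (Set.mem_univ _) ?_ τ (Set.mem_univ _)
    rwa [h.initial, ← sobolevNorm_eq]
  have hbd₀ : sobolevNorm α u₀ ≤ R := h.initial ▸ hbd 0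
  have hs := sobolevNorm_nonneg s
  have hpow : ∀ {f : L2}, sobolevNorm α f ≤ R → ∀ n : ℕ, sobolevNorm α f ^ n ≤ R ^ n :=
    fun hf n => pow_le_pow_left₀ (sobolevNorm_nonneg α _) hf n
  have hcs : Continuous fun τ => sobolevNorm s (u τ) := h.continuous.continuous_sobolevNorm
  have hcα : Continuous fun τ => sobolevNorm α (u τ) :=
    (continuousInSobolev_iff.2 hseq.wcont).continuous_sobolevNorm
  have hterm : ∀ {f : L2}, sobolevNorm α f ≤ R →
      sobolevNorm s f * sobolevNorm α f ^ 2 ≤ (R ^ 2 + R ^ 4 + 1) * sobolevNorm s f := by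
    intro f hf
    rw [mul_comm]
    refine mul_le_mul_of_nonneg_right ((hpow hf 2).trans ?_) (hs f)
    nlinarith [pow_nonneg hR0 4]
  have hI : |∫ τ in (0 : ℝ)..t, sobolevNorm s (u τ) *
      (sobolevNorm α (u τ) ^ 2 + sobolevNorm α (u τ) ^ 4)| ≤
      (R ^ 2 + R ^ 4 + 1) * |∫ τ in (0 : ℝ)..t, sobolevNorm s (u τ)| := by
    rw [← abs_of_nonneg (show (0 : ℝ) ≤ R ^ 2 + R ^ 4 + 1 by positivity), ← abs_mul,
      ← intervalIntegral.integral_const_mul]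
    refine abs_integral_le_abs_integral (by fun_prop) (by fun_prop)
      (fun τ => mul_nonneg (hs _) (by positivity)) (fun τ => ?_) 0 t
    rw [mul_comm]
    refine mul_le_mul_of_nonneg_right ?_ (hs _)
    linarith [hpow (hbd τ) 2, hpow (hbd τ) 4]
  refine (hC σ hσ u₀ Set.univ u h t (Set.mem_univ t)).trans ?_
  rw [mul_assoc]
  refine mul_le_mul_of_nonneg_left ?_ hC0.le
  rw [mul_add, mul_add]
  exact add_le_add (add_le_add (hterm hbd₀) (hterm (hbd t))) hI

end FNLS

end

/-! ### The smoothing theorem -/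

theorem theorem2 (α s a : ℝ) (hα : 1 / 2 < α) (hα' : α ≤ 1) (hs : 1 / 2 < s)
    (ha : a ≤ 2 * α - 1) :
    (∀ σ : ℝ, σ = 1 ∨ σ = -1 → ∀ (u₀ : FNLS.L2) (I : Set ℝ) (u : ℝ → FNLS.L2),
      FNLS.IsMaximalSolution σ α s u₀ I u →
        FNLS.ContinuousInSobolev (s + a) I (fun t => u t - FNLS.phasedFlow σ α t u₀)) ∧
    (∀ ε : ℝ, 0 < ε → 1 / 2 + ε ≤ s → ∃ C : ℝ, 0 < C ∧
      ∀ σ : ℝ, σ = 1 ∨ σ = -1 → ∀ (u₀ : FNLS.L2) (I : Set ℝ) (u : ℝ → FNLS.L2),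
        FNLS.IsMaximalSolution σ α s u₀ I u → ∀ t ∈ I,
          FNLS.sobolevNorm (s + a) (u t - FNLS.phasedFlow σ α t u₀) ≤
            C * (FNLS.sobolevNorm s u₀ * (1 + FNLS.sobolevNorm (1 / 2 + ε) u₀ ^ 2) +
              FNLS.sobolevNorm s (u t) * FNLS.sobolevNorm (1 / 2 + ε) (u t) ^ 2 +
              |∫ τ in (0 : ℝ)..t, FNLS.sobolevNorm s (u τ) *
                (FNLS.sobolevNorm (1 / 2 + ε) (u τ) ^ 2 +
                  FNLS.sobolevNorm (1 / 2 + ε) (u τ) ^ 4)|)) ∧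
    (α ≤ s →
      (∀ σ : ℝ, σ = 1 ∨ σ = -1 → ∀ (u₀ : FNLS.L2) (I : Set ℝ) (u : ℝ → FNLS.L2),
        FNLS.IsMaximalSolution σ α s u₀ I u → I = Set.univ) ∧
      ∀ M : ℝ, ∃ C : ℝ, 0 < C ∧
        ∀ σ : ℝ, σ = 1 ∨ σ = -1 → ∀ (u₀ : FNLS.L2) (I : Set ℝ) (u : ℝ → FNLS.L2),
          FNLS.IsMaximalSolution σ α s u₀ I u → FNLS.sobolevNorm α u₀ ≤ M → ∀ t : ℝ,
            FNLS.sobolevNorm (s + a) (u t - FNLS.phasedFlow σ α t u₀) ≤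
              C * (FNLS.sobolevNorm s u₀ + FNLS.sobolevNorm s (u t) +
                |∫ τ in (0 : ℝ)..t, FNLS.sobolevNorm s (u τ)|)) := by
  refine ⟨fun σ _ u₀ I u h => ?_, fun ε hε hεs => ?_, fun hαs => ⟨?_, fun M => ?_⟩⟩
  · exact h.isSolution.continuousInSobolev_difference hα hα' hs (by linarith)
  · obtain ⟨C, hC0, hC⟩ := FNLS.exists_smoothing_bound (r := s + a) hα hα'
      (show 1 / 2 < 1 / 2 + ε by linarith) hεs (by linarith)
    refine ⟨C, hC0, fun σ hσ u₀ I u h t ht => (hC σ hσ u₀ I u h.isSolution t ht).trans ?_⟩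
    refine mul_le_mul_of_nonneg_left ?_ hC0.le
    -- The bound already proved has no term linear in the initial datum, so the summand 1 in the
    -- statement is slack.
    gcongr
    · exact FNLS.sobolevNorm_nonneg s u₀
    · linarith
  · exact fun σ hσ u₀ I u h => h.eq_univ hα hα' hαs hσ
  · obtain ⟨C, hC0, hC⟩ := FNLS.exists_energy_smoothing_bound (r := s + a) hα hα' hαs
      (by linarith) M
    refine ⟨C, hC0, fun σ hσ u₀ I u h hM t => ?_⟩
    obtain rfl := h.eq_univ hα hα' hαs hσ
    exact hC σ hσ u₀ u h.isSolution hM t
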